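/- **Setting.** Let $r\ge k\ge 1$ and let $\Omega_1,\dots,\Omega_r$ be finite probability spaces (all subsets measurable). For $I\subseteq[r]$ let $\Omega_I=\prod_{i\in I}\Omega_i$; its elements are the index-$I$ edges, and a random $e\in\Omega_I$ has independent coordinates. For $J\subseteq I$ write $e|_J$ for the restriction of $e$ to $J$. All indices of colored edges below are sets $I\subseteq[r]$ with $1\le|I|\le k$. *Colored hypergraphs.* For $\vec b=(b_1,\dots,b_k)$, a $\vec b$-colored ($k$-bounded $r$-partite) hypergraph $G$ on $\Omega=(\Omega_i)_i$ consists of, for every index $I$, a set $C_I(G)$ of exactly $b_{|I|}$ colors and a map $\Omega_I\to C_I(G)$, $e\mapsto G(e)$. Put $G(\partial e)=(G(e|_J))_{\emptyset\ne J\subsetneq I}$ and $G\langle e\rangle=(G(e|_J))_{\emptyset\ne J\subseteq I}$ for $e\in\Omega_I$. *Samples.* For an integer $m\ge0$, $\Phi(m)$ is the set of all families $\varphi=(\varphi^i)_{i\in[r]}$ of maps $\varphi^i:[m]\to\Omega_i$; a random $\varphi\in\Phi(m)$ maps all $rm$ labels independently according to the laws of the $\Omega_i$. *Regularization.* For $1\le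 s<k$ and $\varphi\in\Phi(m)$, the hypergraph $G/^s\varphi$ on $\Omega$ is obtained from $G$ by replacing, for each $I$ with $|I|\le s$, the color of each $e\in\Omega_I$ by the vector of all colors $G(e\cup f)$, where $J$ ranges over the subsets of $[r]\setminus I$ with $|J|\le s+1-|I|$, and $f$ over the edges $(\varphi^j(a_j))_{j\in J}$ with $a\in[m]^J$ (the entries are indexed by the pairs $(J,a)$, and the new color set is the full product of the corresponding old color sets). Edges of size larger than $s$ keep their colors. For $\vec\varphi=(\varphi_i)_{i\in[k-1]}$ with $\varphi_i\in\Phi(m_i)$ let $$G/\vec\varphi=\bigl(\cdots\bigl((G/^{k-1}\varphi_{k-1})/^{k-2}\varphi_{k-2}\bigr)\cdots\bigr)/^1\varphi_1 ,$$ so that $G/\vec\varphi=G$ if $k=1$. *Relative density.* For an index $I$ and $c=(c_J)_{\emptyset\ne J\subseteq I}$ with $c_J\in C_J(G)$, let $d_G(c)=\mathbb P_{e\in\Omega_I}[\,G(e)=c_I\mid G(\partial e)=(c_J)_{J\subsetneq I}\,]$, and $d_G(c)=1$ if the condition has probability $0$. *Complexes.* A complex $S\in\mathcal S_{k,h,G}$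 has $h$ vertices in each of its $r$ classes, and assigns to each edge $e$ of index $I$ (a choice of one vertex from each class $i\in I$) either a color $S(e)\in C_I(G)$ (then $e$ is visible) or the label "invisible", such that every edge containing an invisible edge is invisible. Let $\mathbb V(S)$ be the set of visible edges, and $S\langle e\rangle=(S(e|_J))_{\emptyset\neq J\subseteq I}$ for $e\in\mathbb V(S)$ of index $I$. *Regularity.* For $\varepsilon\ge0$ and an integer $h\ge1$, $G$ is $(\varepsilon,k,h)$-regular if there is a function $\delta\ge0$ on the tuples $c$ as above such that 1. for every $S\in\mathcal S_{k,h,G}$ there are real numbers $x_e$, $e\in\mathbb V(S)$, with $$\max\{0,d_G(S\langle e\rangle)-\delta(S\langle e\rangle)\}\le x_e\le\min\{1,d_G(S\langle e\rangle)+\delta(S\langle e\rangle)\}$$ and $$\mathbb P_{\phi\in\Phi(h)}[\,G(\phi(e))=S(e)\ \ \forall e\in\mathbb V(S)\,]=\prod_{e\in\mathbb V(S)}x_e ;$$ 2. $\mathbb E_{e\in\Omega_I}[\delta(G\langle e\rangle)]\le\varepsilon/|C_I(G)|$ for every index $I$. Let $\mathrm{reg}_{k,h}(G)$ be the least $\varepsilon\ge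 0$ such that $G$ is $(\varepsilon,k,h)$-regular. **Theorem.** For all integers $r\ge k\ge1$ and $h\ge1$, every $\vec b=(b_i)_{i\in[k]}$ and every $\varepsilon>0$ there are functions $$m^{(i)}:\mathbb N^{k-i}\to\mathbb N,\qquad \tilde n^{(i)}:\mathbb N^{k-1-i}\to\mathbb N_{>0}\qquad(i\in[k-1]),$$ nondecreasing in each argument (with $\tilde n^{(k-1)}$ a constant) and depending only on $r,k,h,\vec b,\varepsilon$, such that for all finite probability spaces $\Omega_1,\dots,\Omega_r$ and every $\vec b$-colored hypergraph $G$ on $\Omega$ $$\mathbb E_{\vec n=(n^{(1)},\dots,n^{(k-1)})}\ \mathbb E_{\vec\varphi=(\varphi_i)_{i\in[k-1]}}\bigl[\mathrm{reg}_{k,h}(G/\vec\varphi)\bigr]\le\varepsilon .$$ Here, from $i=k-1$ down to $i=1$, the integer $n^{(i)}$ is picked uniformly at random from $\{0,\dots,\tilde n^{(i)}(n^{(i+1)},\dots,n^{(k-1)})-1\}$, and then the $\varphi_i\in\Phi\bigl(m^{(i)}(n^{(i)},\dots,n^{(k-1)})\bigr)$ are random and independent. -/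

import Mathlib

universe u w

namespace HypergraphRegularity

open Finset

/-- The indices `I` with `1 ≤ |I| ≤ k`, where the `r` vertex classes are labelled by `Fin r`. -/
abbrev Idx (r k : ℕ) : Type := {I : Finset (Fin r) // 1 ≤ #I ∧ #I ≤ k}

/-- An index-`I` edge: one vertex from each of the classes `V i`, `i ∈ I`. -/
abbrev Edge {r : ℕ} (V : Fin r → Type u) (I : Finset (Fin r)) : Type u := (i : I) → V i

/-- The restriction `e|_J` of an index-`I` edge `e` to `J ⊆ I`. -/
def Edge.restrict {r : ℕ} {V : Fin r → Type u} {I J : Finset (Fin r)} (e : Edge V I)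
    (hJ : J ⊆ I) : Edge V J :=
  fun j => e ⟨j.1, hJ j.2⟩

/-- Partitionwise maps from `r` classes of `m` labels each to the vertex classes `Ω i`. -/
abbrev PMap {r : ℕ} (Ω : Fin r → Type u) (m : ℕ) : Type u := (i : Fin r) → Fin m → Ω i

/-! ### Expectations and probabilities -/

section Probability

variable {r : ℕ} {Ω : Fin r → Type u} [∀ i, Fintype (Ω i)]

/-- The expectation over a random index-`I` edge. The probability space `Ω i` has the point
masses `p i`, and the vertices of the edge are independent. -/
noncomputable def edgeExp (p : (i : Fin r) → Ω i → ℝ) (I : Finset (Fin r))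
    (f : Edge Ω I → ℝ) : ℝ :=
  ∑ e : Edge Ω I, (∏ i : I, p i (e i)) * f e

open Classical in
/-- The probability of an event about a random index-`I` edge. -/
noncomputable def edgeProb (p : (i : Fin r) → Ω i → ℝ) (I : Finset (Fin r))
    (A : Edge Ω I → Prop) : ℝ :=
  edgeExp p I fun e => if A e then 1 else 0

/-- The probability that a random partitionwise map equals `φ`: all labels are mapped
independently. -/
noncomputable def mapWeight (p : (i : Fin r) → Ω i → ℝ) {m : ℕ} (φ : PMap Ω m) : ℝ :=
  ∏ i, ∏ a, p i (φ i a)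

open Classical in
/-- The probability of an event about a random partitionwise map `φ ∈ Φ(m)`. -/
noncomputable def mapProb (p : (i : Fin r) → Ω i → ℝ) (m : ℕ) (A : PMap Ω m → Prop) : ℝ :=
  ∑ φ : PMap Ω m, mapWeight p φ * if A φ then 1 else 0

/-- The expectation over a tuple of independent random partitionwise maps `φ i ∈ Φ(m i)`. -/
noncomputable def tupleExp (p : (i : Fin r) → Ω i → ℝ) {t : ℕ} (m : Fin t → ℕ)
    (f : ((i : Fin t) → PMap Ω (m i)) → ℝ) : ℝ :=
  ∑ φ : ((i : Fin t) → PMap Ω (m i)), (∏ i, mapWeight p (φ i)) * f φ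

end Probability

/-- The expectation over random integers `n i`, `i : Fin t`, which are picked from the last one
down to the first one: given the `n j` with `j > i`, the integer `n i` is uniform on
`{0, …, N i (n j)_{j > i} - 1}`. -/
noncomputable def intExp {t : ℕ} (N : (i : Fin t) → (Set.Ioi i → ℕ) → ℕ)
    (f : (Fin t → ℕ) → ℝ) : ℝ :=
  ∑ᶠ n ∈ {n : Fin t → ℕ | ∀ i, n i < N i fun j => n j},
    (∏ i, ((N i fun j => n j : ℕ) : ℝ)⁻¹) * f n

/-! ### Colored hypergraphs -/

/-- A `k`-bounded colored `r`-partite hypergraph with vertex classes `V i`: a finite set of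
colors for each index `I`, and a color for each index-`I` edge. -/
structure ColoredGraph (r k : ℕ) (V : Fin r → Type u) where
  Color : Idx r k → Type w
  finite_color : ∀ I, Finite (Color I)
  color : (I : Idx r k) → Edge V I.1 → Color I

namespace ColoredGraph

variable {r k : ℕ} {Ω : Fin r → Type u}

/-- `G` is `b`-colored: it has exactly `b |I|` colors of index `I`.
Only the values `b 1, …, b k` matter. -/
def IsColored (G : ColoredGraph.{u, w} r k Ω) (b : ℕ → ℕ) : Prop :=
  ∀ I : Idx r k, Nat.card (G.Color I) = b (#I.1)

/-- Formal total colors of index `I`: a color of index `J` for each nonempty `J ⊆ I`. -/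
abbrev TotalColor (G : ColoredGraph.{u, w} r k Ω) (I : Idx r k) : Type w :=
  (J : {J : Idx r k // J.1 ⊆ I.1}) → G.Color J.1

/-- The total color of an edge. -/
def total (G : ColoredGraph.{u, w} r k Ω) (I : Idx r k) (e : Edge Ω I.1) : G.TotalColor I :=
  fun J => G.color J.1 (Edge.restrict e J.2)

/-- The edge `e ∪ f` of index `K ⊇ I`, where `f` consists of the sampled vertices
`φ j (a j)`, `j ∈ K \ I`. -/
def extendEdge {m : ℕ} (φ : PMap Ω m) {I K : Finset (Fin r)} (e : Edge Ω I)
    (a : (j : ↥(K \ I)) → Fin m) : Edge Ω K :=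
  fun j => if hj : j.1 ∈ I then e ⟨j.1, hj⟩ else φ j.1 (a ⟨j.1, mem_sdiff.2 ⟨j.2, hj⟩⟩)

/-- The `s`-regularization of `G` by `φ` (for `1 ≤ s < k`): an edge `e` of index `I` with
`|I| ≤ s` gets as its new color the vector of the colors of all edges `e ∪ f` of size at most
`s + 1`, where `f` consists of sampled vertices from classes outside `I`
(so `K = I ∪ J`, with `J` the index of `f`).
An edge of size at least `s + 1` keeps its color: for it `K = I` is the only choice, and the
vector has a single entry, namely the old color of `e`. -/
def regularizeStep (G : ColoredGraph.{u, w} r k Ω) (s : ℕ) {m : ℕ} (φ : PMap Ω m) :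
    ColoredGraph.{u, w} r k Ω where
  Color I := (K : {K : Idx r k // I.1 ⊆ K.1 ∧ #K.1 ≤ max (s + 1) (#I.1)}) →
    ((j : ↥(K.1.1 \ I.1)) → Fin m) → G.Color K.1
  finite_color I := by
    have := G.finite_color
    infer_instance
  color I e := fun K a => G.color K.1 (extendEdge φ e a)

/-- The regularization by a tuple of partitionwise maps. The entry `φ i`, `i : Fin t`, is used
for the `(i + 1)`-regularization, and the steps are carried out from `s = t` down to `s = 1`. -/
def regularize (G : ColoredGraph.{u, w} r k Ω) :
    {t : ℕ} → {m : Fin t → ℕ} → ((i : Fin t) → PMap Ω (m i)) → ColoredGraph.{u, w} r k Ω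
  | 0, _, _ => G
  | t + 1, _, φ =>
    regularize (G.regularizeStep (t + 1) (φ (Fin.last t))) (fun i : Fin t => φ i.castSucc)

/-- A `k`-bounded simplicial complex with `h` vertices in each class whose visible colors are
colors of `G`. The invisible color is `none`. -/
structure Complex (G : ColoredGraph.{u, w} r k Ω) (h : ℕ) where
  face : (I : Idx r k) → Edge (fun _ : Fin r => Fin h) I.1 → Option (G.Color I)
  invisible_of_subset : ∀ (I J : Idx r k) (hJ : J.1 ⊆ I.1) (e : Edge (fun _ : Fin r => Fin h) I.1),
    face J (Edge.restrict e hJ) = none → face I e = none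

/-- The visible edges of a complex. -/
abbrev Complex.Visible {G : ColoredGraph.{u, w} r k Ω} {h : ℕ} (S : G.Complex h) : Type :=
  {e : (I : Idx r k) × Edge (fun _ : Fin r => Fin h) I.1 // (S.face e.1 e.2).isSome}

/-- The total color of a visible edge; all of its faces are visible too. -/
def Complex.total {G : ColoredGraph.{u, w} r k Ω} {h : ℕ} (S : G.Complex h) (e : S.Visible) :
    G.TotalColor e.1.1 :=
  fun J => (S.face J.1 (Edge.restrict e.1.2 J.2)).get (by
    rw [Option.isSome_iff_ne_none]
    exact fun hn => Option.isSome_iff_ne_none.1 e.2 (S.invisible_of_subset _ _ J.2 _ hn))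

variable [∀ i, Fintype (Ω i)]

open Classical in
/-- The relative density: the conditional probability that a random index-`I` edge has color
`c I` given that its frame-color is `(c J)_{J ⊊ I}`. It is one if the condition has
probability zero. -/
noncomputable def relDensity (G : ColoredGraph.{u, w} r k Ω) (p : (i : Fin r) → Ω i → ℝ)
    (I : Idx r k) (c : G.TotalColor I) : ℝ :=
  if edgeProb p I.1 (fun e => ∀ J, J.1 ≠ I → G.total I e J = c J) = 0 then 1
  else edgeProb p I.1 (fun e => G.total I e = c) /
    edgeProb p I.1 (fun e => ∀ J, J.1 ≠ I → G.total I e J = c J)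

open Classical in
/-- `(ε, k, h)`-regularity. The function `δ` is defined on all formal total colors; only its
values on the total colors that occur in `G` enter the second bound. The numbers `x e` are the
values that `d ± δ` stands for, one for each visible edge `e`. -/
def IsRegular (G : ColoredGraph.{u, w} r k Ω) (p : (i : Fin r) → Ω i → ℝ) (h : ℕ) (ε : ℝ) :
    Prop :=
  ∃ δ : (I : Idx r k) → G.TotalColor I → ℝ,
    (∀ I c, 0 ≤ δ I c) ∧
    (∀ S : G.Complex h, ∃ x : S.Visible → ℝ,
      (∀ e : S.Visible,
        max 0 (G.relDensity p e.1.1 (S.total e) - δ e.1.1 (S.total e)) ≤ x e ∧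
        x e ≤ min 1 (G.relDensity p e.1.1 (S.total e) + δ e.1.1 (S.total e))) ∧
      mapProb p h (fun φ => ∀ e : S.Visible,
        G.color e.1.1 (fun i => φ i (e.1.2 i)) = (S.face e.1.1 e.1.2).get e.2) = ∏ e, x e) ∧
    ∀ I : Idx r k, edgeExp p I.1 (fun e => δ I (G.total I e)) ≤ ε / Nat.card (G.Color I)

/-- The regularity value: the least `ε ≥ 0` for which `G` is `(ε, k, h)`-regular. -/
noncomputable def reg (G : ColoredGraph.{u, w} r k Ω) (p : (i : Fin r) → Ω i → ℝ) (h : ℕ) : ℝ :=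
  sInf {ε : ℝ | 0 ≤ ε ∧ G.IsRegular p h ε}

end ColoredGraph

end HypergraphRegularity

/-!
The regularity of `G` is proved one edge size after the other. `IsControlled p q h ε η ρ bad` says
that, outside of a set `bad` of total colors, the edges of size at most `q` behave as they should: a
good total color has relative density at least `η`, an edge is bad with probability at most `ρ`
(weighted with the number of colors), and every pattern of good colors on at most `h` labels per
class has probability a product of numbers close to its relative densities. Control of all sizes
gives regularity (`IsControlled.isRegular`): `δ` is `1` on the bad total colors. As bad total colors
are closed upwards, the good faces of a complex form a complex, and the factors of the bad faces are
free to account for the rest of the probability.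

*From size `q` to size `q + 1`* (`IsControlled.succ`). The indicators of the faces of size `q + 1`
of a pattern are replaced, one at a time, by their relative densities. The other faces depend on the
edge `x` in place of the face `e₀` only through the colors of edges that consist of a proper subedge
of `x` and of the images of the other labels. These labels are averaged over `N` independent copies,
after which the weight with which `x` occurs is a function of the *profile* of `x` with respect to a
sample of a fixed size. Hence the indicator of the color of `x` may be replaced by its conditional
expectation given the profile, and the error (`count_swap_sq_le`) is bounded, by the Cauchy–Schwarz
inequality, by the mean square difference between the densities relative to the profile and relative
to the frame (`increment`), times the second moment of the number of extensions of `x` to the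
pattern. The latter counts two copies of the pattern glued along `e₀` (`Ex_extAvg_sq`), and so it is
bounded by control at size `q` with `2 h` labels (`IsControlled.count_doubled_le`). Total colors
with a small density or a large increment are declared bad; they are rare if the increments are
small in the mean.

*The increments* (`tupleExp_incrementSum_le`). The frames of `G/φ` determine the profiles of `G`
with respect to the sample used for the size in question, and all the profiles that matter are
determined by the profiles of `G` with respect to the union of all samples. By the theorem of
Pythagoras the increments are therefore at most the growth of the energy, the mean square of the
densities relative to a profile, between two sample sizes. The sample sizes for the last integer
equal to `n` and to `n + 1` are chosen such that all the samples of the former fit into the latter.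
The sum over `n` of these growths telescopes and is bounded, so that the growth is small for the
mean over a long range of `n`; this is why the integers `n` are random.

*The choice of the functions* (`exists_scheme`). The number of sampling steps is the induction
variable: once the first sample `φ` is drawn, the remaining steps regularize `G/φ`, whose number of
colors is bounded. The failure of control is measured by the infimum of the possible `ρ`
(`ctrlVal`), a number whose expectation passes linearly through the induction. The functions are
nondecreasing because every scheme can be chosen above a given one, hence above those chosen for
smaller `n`.
-/

namespace HypergraphRegularity
open Finset

/-! ### Expectations over finite weighted sets -/

open Classical in
/-- The indicator of a proposition, as a real number. -/
noncomputable def ind (P : Prop) : ℝ := if P then 1 else 0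

/-- The expectation of `f` with respect to the point masses `w`. -/
def Ex {T : Type*} [Fintype T] (w f : T → ℝ) : ℝ := ∑ x, w x * f x

theorem ind_of {P : Prop} (h : P) : ind P = 1 := by simp [ind, h]
theorem ind_not {P : Prop} (h : ¬P) : ind P = 0 := by simp [ind, h]
theorem ind_nonneg (P : Prop) : 0 ≤ ind P := by unfold ind; split_ifs <;> norm_num
theorem ind_le_one (P : Prop) : ind P ≤ 1 := by unfold ind; split_ifs <;> norm_num
theorem ind_and (P Q : Prop) : ind (P ∧ Q) = ind P * ind Q := by
  unfold ind; split_ifs <;> simp_all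
theorem ind_mul_self (P : Prop) : ind P * ind P = ind P := by unfold ind; split_ifs <;> simp
theorem ind_congr {P Q : Prop} (h : P ↔ Q) : ind P = ind Q := by rw [propext h]
theorem ind_mono {P Q : Prop} (h : P → Q) : ind P ≤ ind Q := by
  unfold ind; split_ifs <;> simp_all

section Ex

variable {T : Type*} [Fintype T] {w : T → ℝ}

theorem Ex_add (f g : T → ℝ) : Ex w (fun x => f x + g x) = Ex w f + Ex w g := by
  simp [Ex, mul_add, sum_add_distrib]

theorem Ex_sub (f g : T → ℝ) : Ex w (fun x => f x - g x) = Ex w f - Ex w g := by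
  simp [Ex, mul_sub]

theorem Ex_mul_left (a : ℝ) (f : T → ℝ) : Ex w (fun x => a * f x) = a * Ex w f := by
  simp only [Ex, mul_sum]; exact sum_congr rfl fun _ _ => by ring

theorem Ex_mul_right (a : ℝ) (f : T → ℝ) : Ex w (fun x => f x * a) = Ex w f * a := by
  simp only [Ex, sum_mul]; exact sum_congr rfl fun _ _ => by ring

theorem Ex_sum {ι : Type*} (s : Finset ι) (f : ι → T → ℝ) :
    Ex w (fun x => ∑ i ∈ s, f i x) = ∑ i ∈ s, Ex w (f i) := by
  simp only [Ex, mul_sum]; exact sum_comm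

theorem Ex_comm {U : Type*} [Fintype U] {v : U → ℝ} (f : T → U → ℝ) :
    Ex w (fun x => Ex v (f x)) = Ex v (fun y => Ex w (fun x => f x y)) := by
  simp only [Ex, mul_sum]
  rw [sum_comm]
  exact sum_congr rfl fun _ _ => sum_congr rfl fun _ _ => by ring

theorem Ex_const (hw : w ∈ stdSimplex ℝ T) (a : ℝ) : Ex w (fun _ => a) = a := by
  simp [Ex, ← sum_mul, hw.2]

theorem Ex_mono (hw : w ∈ stdSimplex ℝ T) {f g : T → ℝ} (h : ∀ x, f x ≤ g x) :
    Ex w f ≤ Ex w g :=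
  sum_le_sum fun x _ => mul_le_mul_of_nonneg_left (h x) (hw.1 x)

theorem Ex_mono_of_ne (hw : w ∈ stdSimplex ℝ T) {f g : T → ℝ} (h : ∀ x, w x ≠ 0 → f x ≤ g x) :
    Ex w f ≤ Ex w g :=
  sum_le_sum fun x _ => by
    by_cases hx : w x = 0
    · simp [hx]
    · exact mul_le_mul_of_nonneg_left (h x hx) (hw.1 x)

theorem Ex_nonneg (hw : w ∈ stdSimplex ℝ T) {f : T → ℝ} (h : ∀ x, 0 ≤ f x) : 0 ≤ Ex w f :=
  sum_nonneg fun x _ => mul_nonneg (hw.1 x) (h x)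

theorem Ex_le_const (hw : w ∈ stdSimplex ℝ T) {f : T → ℝ} {a : ℝ} (h : ∀ x, f x ≤ a) :
    Ex w f ≤ a :=
  (Ex_mono hw h).trans (Ex_const hw a).le

/-- The Cauchy–Schwarz inequality. -/
theorem Ex_mul_sq_le (hw : w ∈ stdSimplex ℝ T) (f g : T → ℝ) :
    Ex w (fun x => f x * g x) ^ 2 ≤ Ex w (fun x => f x ^ 2) * Ex w (fun x => g x ^ 2) :=
  sum_sq_le_sum_mul_sum_of_sq_le_mul _
    (fun x _ => mul_nonneg (hw.1 x) (sq_nonneg _)) (fun x _ => mul_nonneg (hw.1 x) (sq_nonneg _))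
    (fun x _ => (by ring : _ = _).le)

theorem Ex_equiv {U : Type*} [Fintype U] {v : U → ℝ} (σ : T ≃ U) (h : ∀ x, w x = v (σ x))
    (f : U → ℝ) : Ex w (fun x => f (σ x)) = Ex v f :=
  Fintype.sum_equiv σ _ _ fun x => by rw [h]

/-- Markov's inequality for an event. -/
theorem Ex_ind_lt_le (hw : w ∈ stdSimplex ℝ T) {f : T → ℝ} (hf : ∀ x, 0 ≤ f x) {a : ℝ}
    (ha : 0 < a) : Ex w (fun x => ind (a < f x)) ≤ Ex w f / a := by
  rw [le_div_iff₀ ha, ← Ex_mul_right]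
  refine Ex_mono hw fun x => ?_
  by_cases h : a < f x
  · rw [ind_of h]; linarith
  · rw [ind_not h]; linarith [hf x]

end Ex

/-! ### Product weights -/

section Pi

variable {A B : Type*} [Fintype A] [Fintype B] [DecidableEq A] [DecidableEq B]
  {X : A → Type*} [∀ a, Fintype (X a)]

theorem pi_mem_stdSimplex {w : (a : A) → X a → ℝ} (hw : ∀ a, w a ∈ stdSimplex ℝ (X a)) :
    (fun x : (a : A) → X a => ∏ a, w a (x a)) ∈ stdSimplex ℝ ((a : A) → X a) := by
  refine ⟨fun x => prod_nonneg fun a _ => (hw a).1 _, ?_⟩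
  have := prod_univ_sum (fun a => (univ : Finset (X a))) w
  rw [Fintype.piFinset_univ] at this
  rw [← this]
  exact prod_eq_one fun a _ => (hw a).2

/-- The coordinates picked out by an injective map are independent with the expected laws. -/
theorem Ex_pi_comp (w : (a : A) → X a → ℝ) (hw : ∀ a, w a ∈ stdSimplex ℝ (X a))
    (f : B → A) (hf : Function.Injective f) (F : ((b : B) → X (f b)) → ℝ) :
    Ex (fun x : (a : A) → X a => ∏ a, w a (x a)) (fun x => F fun b => x (f b)) =
      Ex (fun y : (b : B) → X (f b) => ∏ b, w (f b) (y b)) F := by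
  classical
  unfold Ex
  rw [← sum_fiberwise univ (fun (x : (a : A) → X a) (b : B) => x (f b))]
  refine sum_congr rfl fun y _ => ?_
  let S : (a : A) → Finset (X a) := fun a => univ.filter fun z => ∀ b (h : f b = a), h ▸ y b = z
  have hS : (univ.filter fun x : (a : A) → X a => (fun b => x (f b)) = y) =
      Fintype.piFinset S := by
    ext x
    simp only [mem_filter, mem_univ, true_and, Fintype.mem_piFinset, S]
    constructor
    · rintro rfl a b rfl; rfl
    · intro h; funext b; exact (h (f b) b rfl).symm
  rw [hS]
  have h1 : ∀ x ∈ Fintype.piFinset S, (∏ a, w a (x a)) * F (fun b => x (f b)) =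
      (∏ a, w a (x a)) * F y := by
    intro x hx
    rw [← hS] at hx
    rw [(mem_filter.1 hx).2]
  rw [sum_congr rfl h1, ← sum_mul, ← prod_univ_sum]
  congr 1
  symm
  refine Fintype.prod_of_injective f hf _ _ (fun a ha => ?_) (fun b => ?_)
  · have : S a = univ := by
      ext z
      simp only [mem_filter, mem_univ, true_and, S, iff_true]
      intro b hb
      exact absurd ⟨b, hb⟩ ha
    rw [this]
    exact (hw a).2
  · have : S (f b) = {y b} := by
      ext z
      simp only [mem_filter, mem_univ, true_and, S, mem_singleton]
      constructor
      · intro h; exact (h b rfl).symm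
      · rintro rfl b' hb'
        obtain rfl := hf hb'
        rfl
    rw [this, sum_singleton]

end Pi

/-! ### Random samples -/

section Samples

variable {r : ℕ} {Ω : Fin r → Type*} [∀ i, Fintype (Ω i)] {p : (i : Fin r) → Ω i → ℝ}

/-- A sample: for each class `i`, a map from the label set `V` to `Ω i`. -/
abbrev Sample (Ω : Fin r → Type*) (V : Type*) := (i : Fin r) → V → Ω i

/-- The probability of a sample whose labels are all mapped independently. -/
def sampleWeight (p : (i : Fin r) → Ω i → ℝ) {V : Type*} [Fintype V] (φ : Sample Ω V) : ℝ :=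
  ∏ i, ∏ v, p i (φ i v)

/-- The probability of an index-`I` edge. -/
def edgeWeight (p : (i : Fin r) → Ω i → ℝ) (I : Finset (Fin r)) (e : Edge Ω I) : ℝ :=
  ∏ i : I, p i (e i)

theorem edgeWeight_mem (hp : ∀ i, p i ∈ stdSimplex ℝ (Ω i)) (I : Finset (Fin r)) :
    edgeWeight p I ∈ stdSimplex ℝ (Edge Ω I) :=
  pi_mem_stdSimplex fun i : I => hp i

theorem sampleWeight_mem (hp : ∀ i, p i ∈ stdSimplex ℝ (Ω i)) (V : Type*) [Fintype V]
    [DecidableEq V] : sampleWeight p ∈ stdSimplex ℝ (Sample Ω V) :=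
  pi_mem_stdSimplex fun i => pi_mem_stdSimplex fun _ => hp i

variable {V W : Type*} [Fintype V] [Fintype W] [DecidableEq V] [DecidableEq W]

theorem Ex_sample_uncurry (F : Sample Ω V → ℝ) :
    Ex (sampleWeight p) F = Ex (fun x : (a : (_ : Fin r) × V) → Ω a.1 => ∏ a, p a.1 (x a))
      (fun x => F fun i v => x ⟨i, v⟩) :=
  (Ex_equiv (Equiv.piCurry fun (i : Fin r) (_ : V) => Ω i)
    (fun _ => Fintype.prod_sigma _) F).symm

/-- The images of any set of labels are independent with the expected laws. -/
theorem Ex_sample_comp (hp : ∀ i, p i ∈ stdSimplex ℝ (Ω i)) (f : V → W)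
    (hf : Function.Injective f) (F : Sample Ω V → ℝ) :
    Ex (sampleWeight p) (fun φ : Sample Ω W => F fun i v => φ i (f v)) =
      Ex (sampleWeight p) F := by
  rw [Ex_sample_uncurry, Ex_sample_uncurry]
  exact Ex_pi_comp (A := (_ : Fin r) × W) (B := (_ : Fin r) × V) (X := fun a => Ω a.1)
    (fun a => p a.1) (fun a => hp a.1) (fun a => ⟨a.1, f a.2⟩)
    (fun a b h => by
      obtain ⟨i, v⟩ := a
      obtain ⟨j, u⟩ := b
      simp only [Sigma.mk.injEq, heq_eq_eq] at h
      obtain ⟨rfl, h⟩ := h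
      rw [hf h]) (fun x => F fun i v => x ⟨i, v⟩)

theorem Ex_sample_edge (hp : ∀ i, p i ∈ stdSimplex ℝ (Ω i)) {I : Finset (Fin r)}
    (e : Edge (fun _ => V) I) (F : Edge Ω I → ℝ) :
    Ex (sampleWeight p) (fun φ : Sample Ω V => F fun i => φ i (e i)) = Ex (edgeWeight p I) F := by
  rw [Ex_sample_uncurry]
  exact Ex_pi_comp (A := (_ : Fin r) × V) (B := I) (X := fun a => Ω a.1)
    (fun a => p a.1) (fun a => hp a.1) (fun a => ⟨a.1, e a⟩)
    (fun _ _ h => Subtype.ext (congrArg Sigma.fst h)) F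

theorem Ex_edge_restrict (hp : ∀ i, p i ∈ stdSimplex ℝ (Ω i)) {I J : Finset (Fin r)}
    (hJ : J ⊆ I) (F : Edge Ω J → ℝ) :
    Ex (edgeWeight p I) (fun e => F (Edge.restrict e hJ)) = Ex (edgeWeight p J) F :=
  Ex_pi_comp (A := I) (B := J) (X := fun a : I => Ω a.1)
    (fun a => p a.1) (fun a => hp a.1) (fun a => ⟨a.1, hJ a.2⟩)
    (fun _ _ h => Subtype.ext (congrArg (fun x : I => x.1) h)) F

/-- A sample on a disjoint union consists of two independent samples. -/
theorem Ex_sample_sum (F : Sample Ω (V ⊕ W) → ℝ) :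
    Ex (sampleWeight p) F = Ex (sampleWeight p) (fun φ : Sample Ω V =>
      Ex (sampleWeight p) fun ψ : Sample Ω W => F fun i => Sum.elim (φ i) (ψ i)) := by
  let σ : Sample Ω V × Sample Ω W ≃ Sample Ω (V ⊕ W) :=
    { toFun := fun x i => Sum.elim (x.1 i) (x.2 i)
      invFun := fun φ => (fun i v => φ i (Sum.inl v), fun i v => φ i (Sum.inr v))
      left_inv := fun x => rfl
      right_inv := fun φ => by funext i v; cases v <;> rfl }
  rw [← Ex_equiv (w := fun x : Sample Ω V × Sample Ω W => sampleWeight p x.1 * sampleWeight p x.2)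
    σ (fun x => ?_) F]
  · simp only [Ex, Fintype.sum_prod_type, mul_sum]
    exact sum_congr rfl fun _ _ => sum_congr rfl fun _ _ => mul_assoc _ _ _
  · simp only [sampleWeight, Fintype.prod_sum_type, prod_mul_distrib]
    rfl

theorem tuple_mem (hp : ∀ i, p i ∈ stdSimplex ℝ (Ω i)) {t : ℕ} (m : Fin t → ℕ) :
    (fun φ : (i : Fin t) → PMap Ω (m i) => ∏ i, mapWeight p (φ i)) ∈ stdSimplex ℝ _ :=
  pi_mem_stdSimplex fun i => sampleWeight_mem hp (Fin (m i))

/-- A tuple of independent samples is a sample on the disjoint union of the label sets. -/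
theorem Ex_sample_sigma {t : ℕ} (m : Fin t → ℕ) (F : Sample Ω ((i : Fin t) × Fin (m i)) → ℝ) :
    tupleExp p m (fun φ => F fun j a => φ a.1 j a.2) = Ex (sampleWeight p) F := by
  let σ : ((i : Fin t) → PMap Ω (m i)) ≃ Sample Ω ((i : Fin t) × Fin (m i)) :=
    { toFun := fun φ j a => φ a.1 j a.2
      invFun := fun φ i j a => φ j ⟨i, a⟩
      left_inv := fun x => rfl
      right_inv := fun φ => rfl }
  have hσ : ∀ φ, ∏ i, mapWeight p (φ i) = sampleWeight p (σ φ) := fun φ => by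
    simp only [sampleWeight, mapWeight, Fintype.prod_sigma]
    exact prod_comm
  exact Ex_equiv σ hσ F

open Classical in
/-- The sample that agrees with `φ` on the labels in `P` and with `ψ` on the other ones. -/
noncomputable def Sample.merge {Ω : Fin r → Type*} {V : Type*} (P : Fin r → V → Prop)
    (φ ψ : Sample Ω V) : Sample Ω V :=
  fun i v => if P i v then φ i v else ψ i v

/-- Exchanging `φ` and `ψ` outside of `P` preserves the law of an independent pair `(φ, ψ)`. -/
theorem Ex_sample_merge (hp : ∀ i, p i ∈ stdSimplex ℝ (Ω i)) (P : Fin r → V → Prop)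
    (F : Sample Ω V → ℝ) :
    Ex (sampleWeight p) F = Ex (sampleWeight p) (fun φ : Sample Ω V =>
      Ex (sampleWeight p) fun ψ : Sample Ω V => F (Sample.merge P φ ψ)) := by
  have h1 : Ex (sampleWeight p) F = Ex (sampleWeight p) (fun φ : Sample Ω V =>
      Ex (sampleWeight p) fun _ : Sample Ω V => F φ) := by
    simp only [Ex_const (sampleWeight_mem hp V)]
  rw [h1]
  simp only [Ex, mul_sum, ← Fintype.sum_prod_type']
  refine sum_nbij' (fun x => (Sample.merge P x.1 x.2, Sample.merge P x.2 x.1))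
    (fun x => (Sample.merge P x.1 x.2, Sample.merge P x.2 x.1)) (fun _ _ => mem_univ _)
    (fun _ _ => mem_univ _) ?_ ?_ ?_
  · rintro ⟨x, y⟩ -
    ext i v <;> simp only [Sample.merge] <;> split_ifs <;> rfl
  · rintro ⟨x, y⟩ -
    ext i v <;> simp only [Sample.merge] <;> split_ifs <;> rfl
  · rintro ⟨x, y⟩ -
    have h2 : Sample.merge P (Sample.merge P x y) (Sample.merge P y x) = x := by
      funext i v; simp only [Sample.merge]; split_ifs <;> rfl
    simp only [h2]
    rw [← mul_assoc, ← mul_assoc]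
    congr 1
    simp only [sampleWeight, ← prod_mul_distrib]
    refine prod_congr rfl fun i _ => prod_congr rfl fun v _ => ?_
    simp only [Sample.merge]
    split_ifs
    · rfl
    · exact mul_comm _ _

open Classical in
/-- The sample `φ` with the labels on the edge `e` remapped to the edge `x`. -/
noncomputable def Sample.update {Ω : Fin r → Type*} {V : Type*} {I : Finset (Fin r)}
    (φ : Sample Ω V) (e : Edge (fun _ => V) I) (x : Edge Ω I) : Sample Ω V :=
  fun i v => if h : ∃ h : i ∈ I, v = e ⟨i, h⟩ then x ⟨i, h.1⟩ else φ i v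

/-- The image of the edge `e` can be picked first, and independently of the other labels. -/
theorem Ex_sample_update (hp : ∀ i, p i ∈ stdSimplex ℝ (Ω i)) {I : Finset (Fin r)}
    (e : Edge (fun _ => V) I) (F : Sample Ω V → ℝ) :
    Ex (sampleWeight p) F = Ex (edgeWeight p I) (fun x =>
      Ex (sampleWeight p) fun φ : Sample Ω V => F (φ.update e x)) := by
  rw [Ex_sample_merge hp (fun i v => ∃ h : i ∈ I, v = e ⟨i, h⟩) F,
    ← Ex_sample_edge hp e fun x => Ex (sampleWeight p) fun φ : Sample Ω V => F (φ.update e x)]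
  congr 1; funext ψ; congr 1; funext φ; congr 1; funext i v
  simp only [Sample.merge, Sample.update]
  split_ifs with h
  · obtain ⟨h, rfl⟩ := h; rfl
  · rfl

end Samples

/-! ### Conditional expectations with respect to a finite partition -/

section Cond

variable {T : Type*} [Fintype T] {w : T → ℝ}

/-- The conditional expectation of `X`, given the value of `π`. It is zero on fibres of
weight zero. -/
noncomputable def cond {β : Type*} (w : T → ℝ) (π : T → β) (X : T → ℝ) (e : T) : ℝ :=
  Ex w (fun x => ind (π x = π e) * X x) / Ex w (fun x => ind (π x = π e))

variable {β γ : Type*} {π : T → β} {ρ : T → γ}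

theorem cond_congr (X : T → ℝ) {e e' : T} (h : π e = π e') : cond w π X e = cond w π X e' := by
  simp only [cond, h]

/-- Two maps with the same fibres have the same conditional expectations. -/
theorem cond_eq_of_iff (h : ∀ e e', π e = π e' ↔ ρ e = ρ e') (X : T → ℝ) :
    cond w π X = cond w ρ X := by
  funext e
  simp only [cond, propext (h _ _)]

theorem cond_nonneg (hw : w ∈ stdSimplex ℝ T) {X : T → ℝ} (hX : ∀ e, 0 ≤ X e) (e : T) :
    0 ≤ cond w π X e :=
  div_nonneg (Ex_nonneg hw fun x => mul_nonneg (ind_nonneg _) (hX x))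
    (Ex_nonneg hw fun _ => ind_nonneg _)

theorem cond_le_one (hw : w ∈ stdSimplex ℝ T) {X : T → ℝ} (hX : ∀ e, X e ≤ 1) (e : T) :
    cond w π X e ≤ 1 :=
  div_le_one_of_le₀ (Ex_mono hw fun x => mul_le_of_le_one_right (ind_nonneg _) (hX x))
    (Ex_nonneg hw fun _ => ind_nonneg _)

theorem fibre_pos (hw : w ∈ stdSimplex ℝ T) {e : T} (he : w e ≠ 0) :
    0 < Ex w (fun x => ind (π x = π e)) := by
  have h : w e * ind (π e = π e) ≤ Ex w (fun x => ind (π x = π e)) :=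
    single_le_sum (f := fun x => w x * ind (π x = π e))
      (fun x _ => mul_nonneg (hw.1 x) (ind_nonneg _)) (mem_univ e)
  rw [ind_of rfl, mul_one] at h
  exact lt_of_lt_of_le (lt_of_le_of_ne (hw.1 e) (Ne.symm he)) h

/-- The conditional expectation is the orthogonal projection to the functions of `π`. -/
theorem Ex_cond_mul (hw : w ∈ stdSimplex ℝ T) (X : T → ℝ) {g : T → ℝ}
    (hg : ∀ e e', π e = π e' → g e = g e') :
    Ex w (fun e => cond w π X e * g e) = Ex w (fun e => X e * g e) := by
  have h1 : ∀ e, cond w π X e * g e = Ex w (fun x => ind (π x = π e) * X x * g x *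
      (Ex w (fun y => ind (π y = π x)))⁻¹) := by
    intro e
    rw [cond, div_mul_eq_mul_div, div_eq_mul_inv, ← Ex_mul_right, ← Ex_mul_right]
    congr 1; funext x
    by_cases h : π x = π e
    · rw [hg x e h, h]
    · simp [ind_not h]
  simp only [h1]
  rw [Ex_comm]
  unfold Ex
  refine sum_congr rfl fun x _ => ?_
  by_cases hx : w x = 0
  · simp [hx]
  have hpos := fibre_pos (π := π) hw hx
  congr 1
  have h2 : ∀ e, w e * (ind (π x = π e) * X x * g x * (∑ y, w y * ind (π y = π x))⁻¹) =
      (w e * ind (π e = π x)) * (X x * g x * (∑ y, w y * ind (π y = π x))⁻¹) := by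
    intro e; rw [ind_congr (eq_comm (a := π x))]; ring
  change ∑ e, w e * (ind (π x = π e) * X x * g x * (∑ y, w y * ind (π y = π x))⁻¹) = X x * g x
  rw [sum_congr rfl fun e _ => h2 e, ← sum_mul]
  have : (∑ y, w y * ind (π y = π x)) ≠ 0 := hpos.ne'
  field_simp

theorem Ex_cond (hw : w ∈ stdSimplex ℝ T) (X : T → ℝ) : Ex w (cond w π X) = Ex w X := by
  simpa using Ex_cond_mul (π := π) hw X (g := fun _ => 1) fun _ _ _ => rfl

/-- Pythagoras for a partition `ρ` that refines `π`. -/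
theorem Ex_cond_sub_sq (hw : w ∈ stdSimplex ℝ T) (X : T → ℝ)
    (h : ∀ e e', ρ e = ρ e' → π e = π e') :
    Ex w (fun e => (cond w ρ X e - cond w π X e) ^ 2) =
      Ex w (fun e => cond w ρ X e ^ 2) - Ex w (fun e => cond w π X e ^ 2) := by
  have h1 : Ex w (fun e => cond w ρ X e * cond w π X e) = Ex w (fun e => X e * cond w π X e) :=
    Ex_cond_mul hw X fun e e' he => cond_congr X (h e e' he)
  have h2 : Ex w (fun e => cond w π X e * cond w π X e) = Ex w (fun e => X e * cond w π X e) :=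
    Ex_cond_mul hw X fun e e' he => cond_congr X he
  have h3 : Ex w (fun e => (cond w ρ X e - cond w π X e) ^ 2) =
      Ex w (fun e => cond w ρ X e ^ 2) - 2 * Ex w (fun e => cond w ρ X e * cond w π X e) +
        Ex w (fun e => cond w π X e * cond w π X e) := by
    rw [← Ex_mul_left, ← Ex_sub, ← Ex_add]
    congr 1; funext e; ring
  have h4 : Ex w (fun e => cond w π X e ^ 2) = Ex w (fun e => cond w π X e * cond w π X e) := by
    congr 1; funext e; ring
  rw [h3, h4, h1, h2]; ring

/-- The energy of the partition given by `π`: the mean square of the conditional expectation. -/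
noncomputable def energy {β : Type*} (w : T → ℝ) (π : T → β) (X : T → ℝ) : ℝ :=
  Ex w fun e => cond w π X e ^ 2

theorem energy_mono (hw : w ∈ stdSimplex ℝ T) (X : T → ℝ)
    (h : ∀ e e', ρ e = ρ e' → π e = π e') : energy w π X ≤ energy w ρ X := by
  have h1 := Ex_cond_sub_sq hw X h
  have h2 : 0 ≤ Ex w (fun e => (cond w ρ X e - cond w π X e) ^ 2) :=
    Ex_nonneg hw fun _ => sq_nonneg _
  unfold energy
  linarith

theorem energy_nonneg (hw : w ∈ stdSimplex ℝ T) (X : T → ℝ) : 0 ≤ energy w π X :=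
  Ex_nonneg hw fun _ => sq_nonneg _

theorem energy_le_one (hw : w ∈ stdSimplex ℝ T) {X : T → ℝ} (h0 : ∀ e, 0 ≤ X e)
    (h1 : ∀ e, X e ≤ 1) : energy w π X ≤ 1 :=
  Ex_le_const hw fun e => pow_le_one₀ (cond_nonneg hw h0 e) (cond_le_one hw h1 e)

end Cond

/-! ### Products with prescribed value -/

/-- A number close to `∏ d i` is a product of numbers close to the `d i`. The factors stay in
`[0, 1]`, so that a single factor cannot always account for the whole difference. -/
theorem exists_prod_eq_of_close {ι : Type*} [DecidableEq ι] (s : Finset ι) (d : ι → ℝ)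
    {η δ y : ℝ} (hη : 0 < η) (hη1 : η ≤ 1) (hd : ∀ i ∈ s, η ≤ d i) (hd1 : ∀ i ∈ s, d i ≤ 1)
    (hδ : 0 ≤ δ) (hy0 : 0 ≤ y) (hy1 : y ≤ 1) (hs : s = ∅ → y = 1)
    (hy : |y - ∏ i ∈ s, d i| ≤ δ * η ^ #s) :
    ∃ x : ι → ℝ, (∀ i ∈ s, |x i - d i| ≤ δ ∧ 0 ≤ x i ∧ x i ≤ 1) ∧ ∏ i ∈ s, x i = y := by
  have hpow : ∀ a ∈ s, η ^ #s ≤ ∏ i ∈ s.erase a, d i := fun a ha => by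
    calc η ^ #s ≤ η ^ #(s.erase a) :=
          pow_le_pow_of_le_one hη.le hη1 (card_le_card (erase_subset a s))
      _ = ∏ i ∈ s.erase a, η := by rw [prod_const]
      _ ≤ _ := prod_le_prod (fun _ _ => hη.le) fun i hi => hd i (mem_of_mem_erase hi)
  rcases s.eq_empty_or_nonempty with rfl | ⟨a, ha⟩
  · exact ⟨d, by simp, by simp [hs rfl]⟩
  rw [abs_le] at hy
  rcases le_or_gt y (∏ i ∈ s, d i) with hle | hlt
  · -- Only the factor at `a` has to be lowered.
    have hpos : 0 < ∏ i ∈ s.erase a, d i := lt_of_lt_of_le (by positivity) (hpow a ha)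
    have hsplit : d a * ∏ i ∈ s.erase a, d i = ∏ i ∈ s, d i := mul_prod_erase s d ha
    have hxa : y / ∏ i ∈ s.erase a, d i ≤ d a := by
      rw [div_le_iff₀ hpos, hsplit]; exact hle
    have hxa' : d a - δ ≤ y / ∏ i ∈ s.erase a, d i := by
      rw [le_div_iff₀ hpos, sub_mul, hsplit]
      nlinarith [mul_le_mul_of_nonneg_left (hpow a ha) hδ]
    refine ⟨Function.update d a (y / ∏ i ∈ s.erase a, d i), fun i hi => ?_, ?_⟩
    · rcases eq_or_ne i a with rfl | hia
      · rw [Function.update_self, abs_le]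
        exact ⟨⟨by linarith, by linarith⟩, div_nonneg hy0 hpos.le, hxa.trans (hd1 i hi)⟩
      · rw [Function.update_of_ne hia, sub_self, abs_zero]
        exact ⟨hδ, hη.le.trans (hd i hi), hd1 i hi⟩
    · rw [← mul_prod_erase s _ ha, Function.update_self,
        prod_congr rfl fun i hi => Function.update_of_ne (ne_of_mem_erase hi) _ _]
      exact div_mul_cancel₀ _ hpos.ne'
  · -- All factors are raised at the same rate until the product reaches `y`.
    have hcont : ContinuousOn (fun t : ℝ => ∏ i ∈ s, min 1 (d i + t)) (Set.Icc 0 δ) := by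
      fun_prop
    have h0 : ∏ i ∈ s, min 1 (d i + 0) = ∏ i ∈ s, d i :=
      prod_congr rfl fun i hi => by rw [add_zero, min_eq_right (hd1 i hi)]
    have hbig : y ≤ ∏ i ∈ s, min 1 (d i + δ) := by
      by_cases hall : ∀ i ∈ s, 1 ≤ d i + δ
      · rw [prod_eq_one fun i hi => min_eq_left (hall i hi)]; exact hy1
      · push Not at hall
        obtain ⟨b, hb, hb1⟩ := hall
        rw [← mul_prod_erase s _ hb, min_eq_right hb1.le]
        have h1 : ∏ i ∈ s.erase b, d i ≤ ∏ i ∈ s.erase b, min 1 (d i + δ) :=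
          prod_le_prod (fun i hi => hη.le.trans (hd i (mem_of_mem_erase hi))) fun i hi =>
            le_min (hd1 i (mem_of_mem_erase hi)) (by linarith)
        have hb0 : 0 ≤ d b + δ := by linarith [hd b hb]
        have h2 := mul_le_mul_of_nonneg_left h1 hb0
        have h3 := mul_le_mul_of_nonneg_left (hpow b hb) hδ
        rw [add_mul, mul_prod_erase s d hb] at h2
        linarith
    obtain ⟨t, ht, hty⟩ := intermediate_value_Icc hδ hcont ⟨h0.trans_le hlt.le, hbig⟩
    refine ⟨fun i => min 1 (d i + t), fun i hi => ⟨?_, ?_, min_le_left _ _⟩, hty⟩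
    · have h1 : d i ≤ min 1 (d i + t) := le_min (hd1 i hi) (by linarith [ht.1])
      rw [abs_of_nonneg (by linarith)]
      linarith [min_le_right 1 (d i + t), ht.2]
    · exact le_min zero_le_one (by linarith [hd i hi, ht.1])

/-! ### Faces, patterns and profiles -/

/-- A face on the label set `V`: an index together with one label for each of its classes. -/
abbrev Face (r k : ℕ) (V : Type*) : Type _ := (I : Idx r k) × Edge (fun _ : Fin r => V) I.1

/-- The subface of index `J`. -/
def Face.sub {r k : ℕ} {V : Type*} (e : Face r k V) (J : Idx r k) (hJ : J.1 ⊆ e.1.1) :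
    Face r k V :=
  ⟨J, Edge.restrict e.2 hJ⟩

/-- A set of faces that contains all subfaces of its members. -/
def DownClosed {r k : ℕ} {V : Type*} (s : Finset (Face r k V)) : Prop :=
  ∀ e ∈ s, ∀ (J : Idx r k) (hJ : J.1 ⊆ e.1.1), e.sub J hJ ∈ s

theorem DownClosed.filter_card {r k : ℕ} {V : Type*} {s : Finset (Face r k V)}
    (hs : DownClosed s) (q : ℕ) :
    DownClosed (s.filter fun e => #e.1.1 ≤ q) := by
  intro e he J hJ
  rw [mem_filter] at he ⊢
  exact ⟨hs e he.1 J hJ, (card_le_card hJ).trans he.2⟩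

theorem Face.ext_of_apply {r k : ℕ} {V : Type*} {e f : Face r k V} (h : e.1.1 = f.1.1)
    (h' : ∀ i (hi : i ∈ e.1.1) (hi' : i ∈ f.1.1), e.2 ⟨i, hi⟩ = f.2 ⟨i, hi'⟩) : e = f := by
  obtain ⟨⟨I, hI⟩, e⟩ := e
  obtain ⟨⟨J, hJ⟩, f⟩ := f
  obtain rfl : I = J := h
  congr 1
  funext i
  exact h' i.1 i.2 i.2

/-- The edge onto which a sample maps a face. -/
def Sample.image {r k : ℕ} {Ω : Fin r → Type*} {V : Type*} (φ : Sample Ω V) (e : Face r k V) :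
    Edge Ω e.1.1 :=
  fun i => φ i (e.2 i)

/-- The edge of index `K` whose vertices in the classes of `J` are those of `e`, while the other
ones are sampled vertices. -/
def mix {r : ℕ} {Ω : Fin r → Type*} {W : Type*} {I J : Finset (Fin r)} (hJ : J ⊆ I)
    (e : Edge Ω I) (Φ : Sample Ω W) (K : Finset (Fin r)) (a : K → W) : Edge Ω K :=
  fun i => if h : i.1 ∈ J then e ⟨i, hJ h⟩ else Φ i (a i)

theorem Sample.update_image_self {r k : ℕ} {Ω : Fin r → Type*} {V : Type*} (φ : Sample Ω V)
    (e : Face r k V) (x : Edge Ω e.1.1) : (φ.update e.2 x).image e = x := by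
  funext i
  exact dif_pos ⟨i.2, rfl⟩

theorem Sample.update_image_sub {r k : ℕ} {Ω : Fin r → Type*} {V : Type*} (φ : Sample Ω V)
    (e : Face r k V) (x : Edge Ω e.1.1) (J : Idx r k) (hJ : J.1 ⊆ e.1.1) :
    (φ.update e.2 x).image (e.sub J hJ) = Edge.restrict x hJ := by
  funext i
  exact dif_pos ⟨hJ i.2, rfl⟩

namespace ColoredGraph

variable {r k : ℕ} {Ω : Fin r → Type u} (G : ColoredGraph.{u, w} r k Ω)

/-- The total color that a coloring `col` of the faces gives to a face. -/
def faceTotal {V : Type*} (col : (e : Face r k V) → G.Color e.1) (e : Face r k V) :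
    G.TotalColor e.1 :=
  fun J => col (e.sub J.1 J.2)

/-- The sample `φ` maps all faces in `s` onto edges of the prescribed colors. -/
def Matches {V : Type*} (col : (e : Face r k V) → G.Color e.1) (s : Finset (Face r k V))
    (φ : Sample Ω V) : Prop :=
  ∀ e ∈ s, G.color e.1 (φ.image e) = col e

/-- The frame-color of an edge: the colors of its proper subedges. -/
def frame (I : Idx r k) (e : Edge Ω I.1) :
    (J : {J : {J : Idx r k // J.1 ⊆ I.1} // J.1 ≠ I}) → G.Color J.1.1 :=
  fun J => G.total I e J.1

/-- The profile of an edge `e` with respect to a sample: the colors of all edges of size at most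
`q` that consist of a proper subedge of `e` (possibly an empty one) and of sampled vertices. -/
def profile (q : ℕ) (I : Idx r k) {W : Type*} (Φ : Sample Ω W) (e : Edge Ω I.1) :
    (x : (_ : {J : Finset (Fin r) // J ⊂ I.1}) × (K : {K : Idx r k // #K.1 ≤ q}) ×
      (K.1.1 → W)) → G.Color x.2.1.1 :=
  fun x => G.color x.2.1.1 (mix x.1.2.subset e Φ x.2.1.1.1 x.2.2)

/-- The restriction of a formal total color to a smaller index. -/
def restrictTotal {G : ColoredGraph.{u, w} r k Ω} {I J : Idx r k} (c : G.TotalColor I)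
    (hJ : J.1 ⊆ I.1) : G.TotalColor J :=
  fun L => c ⟨L.1, L.2.trans hJ⟩

/-- The colors of the faces other than `e₀` which the sample `ψ` spans together with an edge
`x` in place of `e₀` depend on the profile of `x` only. -/
theorem color_update_congr {q : ℕ} {V W : Type*} (e₀ e : Face r k V) (he₀ : #e₀.1.1 = q)
    (he : #e.1.1 ≤ q) (hne : e ≠ e₀) (ψ : Sample Ω W) (f : V → W) {x x' : Edge Ω e₀.1.1}
    (h : G.profile q e₀.1 ψ x = G.profile q e₀.1 ψ x') :
    G.color e.1 (Sample.image (Sample.update (fun i v => ψ i (f v)) e₀.2 x) e) =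
      G.color e.1 (Sample.image (Sample.update (fun i v => ψ i (f v)) e₀.2 x') e) := by
  classical
  -- The classes in which `e` has the same label as `e₀`; they are not all classes of `e₀`.
  let J : Finset (Fin r) :=
    univ.filter fun i => ∃ (h₀ : i ∈ e₀.1.1) (h : i ∈ e.1.1), e.2 ⟨i, h⟩ = e₀.2 ⟨i, h₀⟩
  have hJ : J ⊂ e₀.1.1 := by
    refine ⟨fun i hi => (mem_filter.1 hi).2.1, fun hsub => hne ?_⟩
    have h1 : e₀.1.1 ⊆ e.1.1 := fun i hi => (mem_filter.1 (hsub hi)).2.2.1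
    have h2 : e₀.1.1 = e.1.1 := eq_of_subset_of_card_le h1 (he.trans he₀.ge)
    exact Face.ext_of_apply h2.symm fun i hi hi' => (mem_filter.1 (hsub hi')).2.2.2
  have key : ∀ y : Edge Ω e₀.1.1,
      Sample.image (Sample.update (fun i v => ψ i (f v)) e₀.2 y) e =
        mix hJ.subset y ψ e.1.1 (fun i => f (e.2 i)) := by
    intro y
    funext i
    simp only [Sample.image, Sample.update, mix]
    by_cases hi : i.1 ∈ J
    · obtain ⟨h₀, h₁, h₂⟩ := (mem_filter.1 hi).2
      rw [dif_pos hi, dif_pos ⟨h₀, h₂⟩]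
    · rw [dif_neg hi, dif_neg]
      rintro ⟨h₀, h₂⟩
      exact hi (mem_filter.2 ⟨mem_univ _, h₀, i.2, h₂⟩)
  rw [key, key]
  exact congrFun h ⟨⟨J, hJ⟩, ⟨e.1, he⟩, fun i => f (e.2 i)⟩

variable [∀ i, Fintype (Ω i)] {p : (i : Fin r) → Ω i → ℝ}

theorem edgeProb_eq_Ex (I : Finset (Fin r)) (A : Edge Ω I → Prop) :
    edgeProb p I A = Ex (edgeWeight p I) fun e => ind (A e) := rfl

/-- The relative density is the conditional probability of the color given the frame. -/
theorem relDensity_eq_cond (I : Idx r k) (c : G.TotalColor I) (e : Edge Ω I.1)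
    (he : ∀ J, J.1 ≠ I → G.total I e J = c J)
    (hpos : Ex (edgeWeight p I.1) (fun x => ind (G.frame I x = G.frame I e)) ≠ 0) :
    G.relDensity p I c = cond (edgeWeight p I.1) (G.frame I)
      (fun x => ind (G.color I x = c ⟨I, Subset.rfl⟩)) e := by
  have h1 : ∀ x, (∀ J, J.1 ≠ I → G.total I x J = c J) ↔ G.frame I x = G.frame I e := by
    intro x
    constructor
    · intro h; funext J; exact (h J.1 J.2).trans (he J.1 J.2).symm
    · intro h J hJ; exact (congrFun h ⟨J, hJ⟩).trans (he J hJ)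
  have h2 : ∀ x, G.total I x = c ↔
      G.frame I x = G.frame I e ∧ G.color I x = c ⟨I, Subset.rfl⟩ := by
    intro x
    rw [← h1]
    constructor
    · rintro rfl; exact ⟨fun _ _ => rfl, rfl⟩
    · rintro ⟨h, h'⟩
      funext ⟨J, hJ⟩
      by_cases hJI : J = I
      · subst hJI; exact h'
      · exact h ⟨J, hJ⟩ hJI
  rw [relDensity, edgeProb_eq_Ex, edgeProb_eq_Ex]
  simp only [h1, h2]
  rw [if_neg hpos, cond]
  simp only [ind_and]

theorem relDensity_nonneg (hp : ∀ i, p i ∈ stdSimplex ℝ (Ω i)) (I : Idx r k)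
    (c : G.TotalColor I) : 0 ≤ G.relDensity p I c := by
  unfold relDensity
  split_ifs
  · exact zero_le_one
  · exact div_nonneg (Ex_nonneg (edgeWeight_mem hp _) fun _ => ind_nonneg _)
      (Ex_nonneg (edgeWeight_mem hp _) fun _ => ind_nonneg _)

theorem relDensity_le_one (hp : ∀ i, p i ∈ stdSimplex ℝ (Ω i)) (I : Idx r k)
    (c : G.TotalColor I) : G.relDensity p I c ≤ 1 := by
  unfold relDensity
  split_ifs
  · exact le_rfl
  · refine div_le_one_of_le₀ ?_ (Ex_nonneg (edgeWeight_mem hp _) fun _ => ind_nonneg _)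
    refine Ex_mono (edgeWeight_mem hp _) fun e => ind_mono ?_
    rintro rfl J -
    rfl

end ColoredGraph

/-! ### Replacing one indicator by its density -/

/-- The Cauchy–Schwarz inequality for two independent variables. -/
theorem Ex_Ex_mul_sq_le {T U : Type*} [Fintype T] [Fintype U] {w : T → ℝ} {v : U → ℝ}
    (hw : w ∈ stdSimplex ℝ T) (hv : v ∈ stdSimplex ℝ U) (f g : T → U → ℝ) :
    Ex w (fun x => Ex v fun y => f x y * g x y) ^ 2 ≤
      Ex w (fun x => Ex v fun y => f x y ^ 2) * Ex w (fun x => Ex v fun y => g x y ^ 2) := by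
  have h : ∀ F : T → U → ℝ, Ex w (fun x => Ex v fun y => F x y) =
      Ex (fun z : T × U => w z.1 * v z.2) fun z => F z.1 z.2 := by
    intro F
    simp only [Ex, Fintype.sum_prod_type, mul_sum, mul_assoc]
  have hmem : (fun z : T × U => w z.1 * v z.2) ∈ stdSimplex ℝ (T × U) := by
    refine ⟨fun z => mul_nonneg (hw.1 _) (hv.1 _), ?_⟩
    simp only [Fintype.sum_prod_type, ← mul_sum, hv.2, mul_one, hw.2]
  rw [h, h, h]
  exact Ex_mul_sq_le hmem (fun z => f z.1 z.2) (fun z => g z.1 z.2)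

section Average

variable {r : ℕ} {Ω : Fin r → Type*} [∀ i, Fintype (Ω i)] {p : (i : Fin r) → Ω i → ℝ}
  {V : Type*} [Fintype V] [DecidableEq V]

/-- The conditional expectation of `T`, given that the edge `e` is mapped to `x`. -/
noncomputable def extAvg (p : (i : Fin r) → Ω i → ℝ) {I : Finset (Fin r)}
    (e : Edge (fun _ : Fin r => V) I) (T : Sample Ω V → ℝ) (x : Edge Ω I) : ℝ :=
  Ex (sampleWeight p) fun φ : Sample Ω V => T (φ.update e x)

/-- Second moment of the average of `N` independent copies of an indicator. -/
theorem Ex_copies_sq_le (hp : ∀ i, p i ∈ stdSimplex ℝ (Ω i)) {N : ℕ} (hN : 0 < N) {L : Type*}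
    [Fintype L] [DecidableEq L] (f : V → L) (hf : Function.Injective f)
    (P : Sample Ω V → Prop) :
    Ex (sampleWeight p) (fun ψ : Sample Ω (Fin N × L) =>
        ((N : ℝ)⁻¹ * ∑ j, ind (P fun i v => ψ i (j, f v))) ^ 2) ≤
      Ex (sampleWeight p) (fun φ => ind (P φ)) ^ 2 +
        (N : ℝ)⁻¹ * Ex (sampleWeight p) (fun φ => ind (P φ)) := by
  set a := Ex (sampleWeight p) (fun φ => ind (P φ)) with ha
  have ha0 : 0 ≤ a := Ex_nonneg (sampleWeight_mem hp V) fun _ => ind_nonneg _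
  have hpair : ∀ j j' : Fin N, Ex (sampleWeight p) (fun ψ : Sample Ω (Fin N × L) =>
      ind (P fun i v => ψ i (j, f v)) * ind (P fun i v => ψ i (j', f v))) ≤
        a ^ 2 + if j = j' then a else 0 := by
    intro j j'
    split_ifs with h
    · subst h
      simp only [ind_mul_self]
      have := Ex_sample_comp (p := p) hp (fun v => (j, f v))
        (fun v v' h => hf (Prod.ext_iff.1 h).2) (fun φ : Sample Ω V => ind (P φ))
      rw [this]
      nlinarith [sq_nonneg a]
    · let g : V ⊕ V → Fin N × L := Sum.elim (fun v => (j, f v)) (fun v => (j', f v))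
      have hg : Function.Injective g := by
        rintro (v | v) (v' | v') hv
        · exact congrArg _ (hf (Prod.ext_iff.1 hv).2)
        · exact absurd (Prod.ext_iff.1 hv).1 h
        · exact absurd (Prod.ext_iff.1 hv).1.symm h
        · exact congrArg _ (hf (Prod.ext_iff.1 hv).2)
      have h1 := Ex_sample_comp (p := p) hp g hg (fun φ : Sample Ω (V ⊕ V) =>
        ind (P fun i v => φ i (Sum.inl v)) * ind (P fun i v => φ i (Sum.inr v)))
      rw [Ex_sample_sum] at h1
      simp only [Sum.elim_inl, Sum.elim_inr, Ex_mul_left, Ex_mul_right, g] at h1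
      rw [h1, add_zero, ← ha, sq]
  have hN' : (N : ℝ) ≠ 0 := by positivity
  have h2 : ∀ ψ : Sample Ω (Fin N × L),
      ((N : ℝ)⁻¹ * ∑ j, ind (P fun i v => ψ i (j, f v))) ^ 2 = ((N : ℝ)⁻¹) ^ 2 *
        ∑ j, ∑ j', ind (P fun i v => ψ i (j, f v)) * ind (P fun i v => ψ i (j', f v)) := by
    intro ψ
    rw [mul_pow, sq (∑ j, _), sum_mul_sum]
  simp only [h2]
  rw [Ex_mul_left, Ex_sum]
  have h3 : ∑ j, Ex (sampleWeight p) (fun ψ : Sample Ω (Fin N × L) =>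
      ∑ j', ind (P fun i v => ψ i (j, f v)) * ind (P fun i v => ψ i (j', f v))) ≤
      ∑ _j : Fin N, (N * a ^ 2 + a) := by
    refine sum_le_sum fun j _ => ?_
    rw [Ex_sum]
    refine (sum_le_sum fun j' _ => hpair j j').trans ?_
    simp [sum_add_distrib]
  refine (mul_le_mul_of_nonneg_left h3 (by positivity)).trans (le_of_eq ?_)
  simp only [sum_const, card_univ, Fintype.card_fin, nsmul_eq_mul]
  field_simp

end Average

namespace ColoredGraph

variable {r k : ℕ} {Ω : Fin r → Type u} (G : ColoredGraph.{u, w} r k Ω) [∀ i, Fintype (Ω i)]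
  {p : (i : Fin r) → Ω i → ℝ}

/-- The indicator of the edges with a given color. -/
noncomputable def colorInd (I : Idx r k) (c : G.Color I) (x : Edge Ω I.1) : ℝ :=
  ind (G.color I x = c)

/-- The increment at an edge `x`: the mean square change of the density of the color `c` when the
frame is refined to the profile of a random sample. -/
noncomputable def increment (p : (i : Fin r) → Ω i → ℝ) (q : ℕ) (L : Type) [Fintype L]
    [DecidableEq L] (I : Idx r k) (c : G.Color I) (x : Edge Ω I.1) : ℝ :=
  Ex (sampleWeight p) fun ψ : Sample Ω L =>
    (cond (edgeWeight p I.1) (G.profile q I ψ) (G.colorInd I c) x -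
      cond (edgeWeight p I.1) (G.frame I) (G.colorInd I c) x) ^ 2

theorem increment_nonneg (hp : ∀ i, p i ∈ stdSimplex ℝ (Ω i)) {q : ℕ} (L : Type) [Fintype L]
    [DecidableEq L] (I : Idx r k) (c : G.Color I) (x : Edge Ω I.1) :
    0 ≤ G.increment p q L I c x :=
  Ex_nonneg (sampleWeight_mem hp L) fun _ => sq_nonneg _

variable {V : Type} [Fintype V] [DecidableEq V]

/-- Replacing the indicator of a largest face `e₀` by its density `d` changes a count by little:
the other faces are correlated with `e₀` through the profile with respect to the remaining
labels only. Averaging over `N` copies of these labels makes the correlating function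
measurable with respect to the profile of a sample that does not depend on the labels. -/
theorem count_swap_sq_le (hp : ∀ i, p i ∈ stdSimplex ℝ (Ω i)) {q N h : ℕ} (hN : 0 < N)
    (f : V → Fin h) (hf : Function.Injective f) (col : (e : Face r k V) → G.Color e.1)
    (e₀ : Face r k V) (he₀ : #e₀.1.1 = q) (s : Finset (Face r k V))
    (hs : ∀ e ∈ s, #e.1.1 ≤ q ∧ e ≠ e₀)
    (hsub : ∀ (J : Idx r k) (hJ : J.1 ⊆ e₀.1.1), J ≠ e₀.1 → e₀.sub J hJ ∈ s) :
    Ex (sampleWeight p) (fun φ : Sample Ω V => ind (G.Matches col s φ) *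
        (ind (G.color e₀.1 (φ.image e₀) = col e₀) -
          G.relDensity p e₀.1 (G.faceTotal col e₀))) ^ 2 ≤
      Ex (edgeWeight p e₀.1.1) (fun x => G.increment p q (Fin N × Fin h) e₀.1 (col e₀) x *
          ind (∀ J, J.1 ≠ e₀.1 → G.total e₀.1 x J = G.faceTotal col e₀ J)) *
        (Ex (edgeWeight p e₀.1.1)
            (fun x => extAvg p e₀.2 (fun φ : Sample Ω V => ind (G.Matches col s φ)) x ^ 2) +
          (N : ℝ)⁻¹ * Ex (sampleWeight p) fun φ : Sample Ω V => ind (G.Matches col s φ)) := by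
  set w := edgeWeight p e₀.1.1 with hw_def
  have hw : w ∈ stdSimplex ℝ _ := edgeWeight_mem hp _
  have hsw := fun (L : Type) [Fintype L] [DecidableEq L] => sampleWeight_mem hp L
  set d := G.relDensity p e₀.1 (G.faceTotal col e₀) with hd
  set X := G.colorInd e₀.1 (col e₀) with hX
  set T : Sample Ω V → ℝ := fun φ => ind (G.Matches col s φ) with hT
  set cell : Edge Ω e₀.1.1 → Prop := fun x =>
    ∀ J, J.1 ≠ e₀.1 → G.total e₀.1 x J = G.faceTotal col e₀ J with hcell
  set W := extAvg p e₀.2 T with hW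
  have hTcell : ∀ (φ : Sample Ω V) x, ¬ cell x → T (φ.update e₀.2 x) = 0 := by
    intro φ x hx
    refine ind_not fun hm => hx fun J hJ => ?_
    have := hm _ (hsub J.1 J.2 hJ)
    rwa [Sample.update_image_sub] at this
  -- The left-hand side as an expectation over the edge in place of `e₀`.
  have h1 : Ex (sampleWeight p) (fun φ : Sample Ω V => T φ *
      (ind (G.color e₀.1 (φ.image e₀) = col e₀) - d)) =
        Ex w fun x => (X x - cond w (G.frame e₀.1) X x) * W x := by
    rw [Ex_sample_update hp e₀.2]
    simp only [Sample.update_image_self, Ex_mul_right]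
    refine sum_congr rfl fun x _ => ?_
    by_cases hwx : w x = 0
    · rw [← hw_def, hwx, zero_mul, zero_mul]
    congr 1
    by_cases hx : cell x
    · have := G.relDensity_eq_cond (p := p) e₀.1 (G.faceTotal col e₀) x hx (fibre_pos hw hwx).ne'
      rw [← hd] at this
      rw [this]
      exact mul_comm _ _
    · have h0 : W x = 0 := by
        simp only [hW, extAvg, hTcell _ x hx]
        exact Ex_const (hsw V) 0
      change W x * _ = _ * W x
      rw [h0, mul_zero, zero_mul]
  -- Replace the average by the one over `N` copies.
  set WN : Sample Ω (Fin N × Fin h) → Edge Ω e₀.1.1 → ℝ := fun ψ x =>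
    (N : ℝ)⁻¹ * ∑ j, T (Sample.update (fun i v => ψ i (j, f v)) e₀.2 x) with hWN
  have hN' : (N : ℝ) ≠ 0 := by positivity
  have hWavg : ∀ x, Ex (sampleWeight p) (fun ψ => WN ψ x) = W x := by
    intro x
    have : ∀ j : Fin N, Ex (sampleWeight p) (fun ψ : Sample Ω (Fin N × Fin h) =>
        T (Sample.update (fun i v => ψ i (j, f v)) e₀.2 x)) = W x := fun j =>
      Ex_sample_comp (p := p) hp (fun v => (j, f v)) (fun v v' h => hf (Prod.ext_iff.1 h).2)
        (fun φ : Sample Ω V => T (φ.update e₀.2 x))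
    simp only [hWN]
    rw [Ex_mul_left, Ex_sum, sum_congr rfl fun j _ => this j]
    simp only [sum_const, card_univ, Fintype.card_fin, nsmul_eq_mul]
    field_simp
  have hmeas : ∀ ψ x x', G.profile q e₀.1 ψ x = G.profile q e₀.1 ψ x' → WN ψ x = WN ψ x' := by
    intro ψ x x' hxx
    simp only [hWN, hT]
    congr 1
    refine sum_congr rfl fun j _ => ind_congr (forall₂_congr fun e he => ?_)
    rw [G.color_update_congr e₀ e he₀ (hs e he).1 (hs e he).2 ψ (fun v => (j, f v)) hxx]
  have hWNcell : ∀ ψ x, WN ψ x = ind (cell x) * WN ψ x := by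
    intro ψ x
    by_cases hx : cell x
    · rw [ind_of hx, one_mul]
    · simp only [hWN, hTcell _ x hx, sum_const_zero, mul_zero]
  -- As `WN ψ` is a function of the profile, `X` may be replaced by its conditional expectation.
  have h2 : Ex w (fun x => (X x - cond w (G.frame e₀.1) X x) * W x) =
      Ex (sampleWeight p) fun ψ : Sample Ω (Fin N × Fin h) => Ex w fun x =>
        ((cond w (G.profile q e₀.1 ψ) X x - cond w (G.frame e₀.1) X x) * ind (cell x)) *
          WN ψ x := by
    have : ∀ x, (X x - cond w (G.frame e₀.1) X x) * W x =
        Ex (sampleWeight p) fun ψ : Sample Ω (Fin N × Fin h) =>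
          (X x - cond w (G.frame e₀.1) X x) * WN ψ x := fun x => by
      rw [Ex_mul_left, hWavg]
    simp only [this]
    rw [Ex_comm]
    congr 1; funext ψ
    simp only [mul_assoc, ← hWNcell]
    simp only [sub_mul]
    rw [Ex_sub, Ex_sub, Ex_cond_mul hw X (hmeas ψ)]
  rw [h1, h2]
  refine (Ex_Ex_mul_sq_le (hsw _) hw _ _).trans ?_
  have h3 : Ex (sampleWeight p) (fun ψ : Sample Ω (Fin N × Fin h) => Ex w fun x =>
      ((cond w (G.profile q e₀.1 ψ) X x - cond w (G.frame e₀.1) X x) * ind (cell x)) ^ 2) =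
      Ex w fun x => G.increment p q (Fin N × Fin h) e₀.1 (col e₀) x * ind (cell x) := by
    rw [Ex_comm]
    congr 1; funext x
    rw [increment, ← Ex_mul_right]
    congr 1; funext ψ
    rw [mul_pow, sq (ind _), ind_mul_self]
  rw [h3]
  refine mul_le_mul_of_nonneg_left ?_
    (Ex_nonneg hw fun x => mul_nonneg (G.increment_nonneg hp _ _ _ _) (ind_nonneg _))
  rw [Ex_comm, Ex_sample_update hp e₀.2 T, ← Ex_mul_left, ← Ex_add]
  exact Ex_mono hw fun x => Ex_copies_sq_le hp hN f hf fun φ => G.Matches col s (φ.update e₀.2 x)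

end ColoredGraph

/-! ### Doubling a pattern over a face -/

section Doubling

variable {r k : ℕ}

/-- The image of a face under a relabelling. -/
def Face.lift {V V' : Type*} (g : Fin r → V → V') (e : Face r k V) :
    Face r k V' :=
  ⟨e.1, fun i => g i (e.2 i)⟩

/-- The face `e` is contained in `e₀`. -/
def Face.IsSub {V : Type*} (e e₀ : Face r k V) : Prop :=
  ∃ hJ : e.1.1 ⊆ e₀.1.1, e = e₀.sub e.1 hJ

theorem Face.IsSub.sub {V : Type*} {e e₀ : Face r k V} (h : e.IsSub e₀)
    (J : Idx r k) (hJ : J.1 ⊆ e.1.1) : (e.sub J hJ).IsSub e₀ := by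
  obtain ⟨I, e⟩ := e
  obtain ⟨hI, heq⟩ := h
  simp only [Face.sub, Sigma.mk.injEq, heq_eq_eq, true_and] at heq
  refine ⟨Subset.trans hJ hI, ?_⟩
  simp only [Face.sub, heq]
  rfl

open Classical in
/-- The second copy of the label `v` of class `i`, when a pattern is doubled over `e₀`: the labels
of `e₀` are shared by the two copies, and the other ones are duplicated. -/
noncomputable def dupLabel {V : Type*} (e₀ : Face r k V) (i : Fin r) (v : V) : V × Bool :=
  (v, decide (¬ ∃ h : i ∈ e₀.1.1, v = e₀.2 ⟨i, h⟩))

open Classical in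
/-- Two copies of the pattern `s`, glued together along the face `e₀`. -/
noncomputable def doubled {V : Type*} (e₀ : Face r k V) (s : Finset (Face r k V)) :
    Finset (Face r k (V × Bool)) :=
  s.image (Face.lift fun _ v => (v, false)) ∪
    (s.filter fun e => ¬ e.IsSub e₀).image (Face.lift (dupLabel e₀))

/-- The subfaces of `e₀` are shared by the two copies. -/
theorem lift_dupLabel_of_isSub {V : Type*} {e e₀ : Face r k V} (h : e.IsSub e₀) :
    e.lift (dupLabel e₀) = e.lift fun _ v => (v, false) := by
  obtain ⟨hJ, he⟩ := h
  refine Face.ext_of_apply rfl fun i hi _ => ?_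
  have : e.2 ⟨i, hi⟩ = e₀.2 ⟨i, hJ hi⟩ := by
    generalize_proofs at he
    obtain ⟨I, e⟩ := e
    simp only [Face.sub, Sigma.mk.injEq, heq_eq_eq, true_and] at he
    exact congrFun he ⟨i, hi⟩
  refine Prod.ext rfl ?_
  simp only [Face.lift, dupLabel, decide_eq_false_iff_not, not_not]
  exact ⟨hJ hi, this⟩

/-- The other faces have two different copies. -/
theorem lift_dupLabel_ne {V : Type*} {e e' e₀ : Face r k V} (h : ¬ e.IsSub e₀) :
    e.lift (dupLabel e₀) ≠ e'.lift fun _ v => (v, false) := by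
  intro heq
  apply h
  have h1 : ∀ i (hi : i ∈ e.1.1), ∃ h : i ∈ e₀.1.1, e.2 ⟨i, hi⟩ = e₀.2 ⟨i, h⟩ := by
    obtain ⟨I, e⟩ := e
    obtain ⟨I', e'⟩ := e'
    obtain rfl : I = I' := congrArg Sigma.fst heq
    simp only [Face.lift, Sigma.mk.injEq, heq_eq_eq, true_and] at heq
    intro i hi
    have := congrArg Prod.snd (congrFun heq ⟨i, hi⟩)
    simpa only [dupLabel, decide_eq_false_iff_not, not_not] using this
  exact ⟨fun i hi => (h1 i hi).1, Face.ext_of_apply rfl fun i hi _ => (h1 i hi).2⟩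

theorem mem_doubled {V : Type*} {e₀ : Face r k V} {s : Finset (Face r k V)}
    {e : Face r k (V × Bool)} : e ∈ doubled e₀ s ↔
      (∃ f ∈ s, (f.lift fun _ v => (v, false)) = e) ∨
        ∃ f ∈ s, ¬ f.IsSub e₀ ∧ f.lift (dupLabel e₀) = e := by
  classical
  simp only [doubled, mem_union, mem_image, mem_filter, and_assoc]

theorem downClosed_doubled {V : Type*} (e₀ : Face r k V) {s : Finset (Face r k V)}
    (hs : DownClosed s) : DownClosed (doubled e₀ s) := by
  intro e he J hJ
  rcases mem_doubled.1 he with ⟨f, hf, rfl⟩ | ⟨f, hf, -, rfl⟩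
  · exact mem_doubled.2 (Or.inl ⟨f.sub J hJ, hs f hf J hJ, rfl⟩)
  · by_cases h : (f.sub J hJ).IsSub e₀
    · exact mem_doubled.2 (Or.inl ⟨_, hs f hf J hJ, (lift_dupLabel_of_isSub h).symm⟩)
    · exact mem_doubled.2 (Or.inr ⟨_, hs f hf J hJ, h, rfl⟩)

theorem lift_fst_mem_of_mem_doubled {V : Type*} {e₀ : Face r k V} {s : Finset (Face r k V)}
    {e : Face r k (V × Bool)} (he : e ∈ doubled e₀ s) : e.lift (fun _ => Prod.fst) ∈ s := by
  rcases mem_doubled.1 he with ⟨f, hf, rfl⟩ | ⟨f, hf, -, rfl⟩ <;> exact hf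

open Classical in
/-- A product over the doubled pattern counts the faces outside of `e₀` twice. -/
theorem prod_doubled {V : Type*} (e₀ : Face r k V) (s : Finset (Face r k V))
    (g : Face r k V → ℝ) :
    ∏ e ∈ doubled e₀ s, g (e.lift fun _ => Prod.fst) =
      (∏ e ∈ s, g e) * ∏ e ∈ s with ¬ e.IsSub e₀, g e := by
  have hinj : ∀ u : Fin r → V → V × Bool, (∀ i v, (u i v).1 = v) →
      Function.Injective (Face.lift (k := k) u) := by
    intro u hu
    refine Function.LeftInverse.injective (g := Face.lift fun _ => Prod.fst) fun e => ?_
    exact Face.ext_of_apply rfl fun i hi _ => hu _ _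
  have hdisj : Disjoint (s.image (Face.lift fun _ v => (v, false)))
      ((s.filter fun e => ¬ e.IsSub e₀).image (Face.lift (dupLabel e₀))) := by
    rw [disjoint_left]
    intro e he he'
    obtain ⟨f, -, rfl⟩ := mem_image.1 he
    obtain ⟨f', hf', h⟩ := mem_image.1 he'
    exact lift_dupLabel_ne (mem_filter.1 hf').2 h
  rw [doubled, prod_union hdisj, prod_image (hinj (fun _ v => (v, false)) fun _ _ => rfl).injOn,
    prod_image (hinj (dupLabel e₀) fun _ _ => rfl).injOn]
  rfl

end Doubling

namespace ColoredGraph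

variable {r k : ℕ} {Ω : Fin r → Type u} (G : ColoredGraph.{u, w} r k Ω)

/-- The doubled pattern appears if and only if the pattern appears for both of the samples, which
agree on the labels of `e₀`. -/
theorem matches_doubled_iff {V : Type*} (col : (e : Face r k V) → G.Color e.1) (e₀ : Face r k V)
    (s : Finset (Face r k V)) (φ ψ : Sample Ω V) :
    G.Matches (fun e => col (e.lift fun _ => Prod.fst)) (doubled e₀ s)
        (fun i v => if v.2 then ψ i v.1 else φ i v.1) ↔
      G.Matches col s φ ∧ G.Matches col s
        (Sample.merge (fun i v => ∃ h : i ∈ e₀.1.1, v = e₀.2 ⟨i, h⟩) φ ψ) := by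
  classical
  set z : Sample Ω (V × Bool) := fun i v => if v.2 then ψ i v.1 else φ i v.1 with hz
  have h0 : ∀ e : Face r k V, z.image (e.lift fun _ v => (v, false)) = φ.image e := by
    intro e
    funext i
    simp [hz, Sample.image, Face.lift]
  have h1 : ∀ e : Face r k V, z.image (e.lift (dupLabel e₀)) =
      (Sample.merge (fun i v => ∃ h : i ∈ e₀.1.1, v = e₀.2 ⟨i, h⟩) φ ψ).image e := by
    intro e
    funext i
    by_cases h : ∃ h : i.1 ∈ e₀.1.1, e.2 i = e₀.2 ⟨i.1, h⟩
    · simp only [hz, Sample.image, Face.lift, dupLabel, Sample.merge, if_pos h]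
      simp [h]
    · simp only [hz, Sample.image, Face.lift, dupLabel, Sample.merge, if_neg h]
      simp [h]
  have h0' : ∀ e : Face r k V, G.color (e.lift fun _ v => (v, false)).1
      (z.image (e.lift fun _ v => (v, false))) = G.color e.1 (φ.image e) := fun e => by
    rw [h0]; rfl
  have h1' : ∀ e : Face r k V, G.color (e.lift (dupLabel e₀)).1
      (z.image (e.lift (dupLabel e₀))) = G.color e.1 (Sample.image (Sample.merge
        (fun i v => ∃ h : i ∈ e₀.1.1, v = e₀.2 ⟨i, h⟩) φ ψ) e) := fun e => by
    rw [h1]; rfl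
  constructor
  · intro h
    have hφ : G.Matches col s φ := fun e he =>
      (h0' e).symm.trans (h _ (mem_doubled.2 (Or.inl ⟨e, he, rfl⟩)))
    refine ⟨hφ, fun e he => (h1' e).symm.trans ?_⟩
    by_cases hsub : e.IsSub e₀
    · have := h _ (mem_doubled.2 (Or.inl ⟨e, he, rfl⟩))
      rw [← lift_dupLabel_of_isSub hsub] at this
      exact this
    · exact h _ (mem_doubled.2 (Or.inr ⟨e, he, hsub, rfl⟩))
  · rintro ⟨hφ, hψ⟩ e he
    rcases mem_doubled.1 he with ⟨f, hf, rfl⟩ | ⟨f, hf, -, rfl⟩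
    · exact (h0' f).trans (hφ f hf)
    · exact (h1' f).trans (hψ f hf)

variable [∀ i, Fintype (Ω i)] {p : (i : Fin r) → Ω i → ℝ} {V : Type} [Fintype V] [DecidableEq V]

/-- The second moment of the number of extensions of an edge to a pattern counts the doubled
pattern. -/
theorem Ex_extAvg_sq (hp : ∀ i, p i ∈ stdSimplex ℝ (Ω i)) (col : (e : Face r k V) → G.Color e.1)
    (e₀ : Face r k V) (s : Finset (Face r k V)) :
    Ex (edgeWeight p e₀.1.1)
        (fun x => extAvg p e₀.2 (fun φ : Sample Ω V => ind (G.Matches col s φ)) x ^ 2) =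
      Ex (sampleWeight p) fun φ : Sample Ω (V × Bool) =>
        ind (G.Matches (fun e => col (e.lift fun _ => Prod.fst)) (doubled e₀ s) φ) := by
  set P : Fin r → V → Prop := fun i v => ∃ h : i ∈ e₀.1.1, v = e₀.2 ⟨i, h⟩ with hP
  let f : V × Bool → V ⊕ V := fun v => if v.2 then Sum.inr v.1 else Sum.inl v.1
  have hf : Function.Injective f := by
    rintro ⟨v, b⟩ ⟨v', b'⟩ h
    cases b <;> cases b' <;> simp_all [f]
  rw [← Ex_sample_comp (p := p) hp f hf, Ex_sample_sum]
  have h1 : ∀ φ ψ : Sample Ω V, (fun i v => Sum.elim (φ i) (ψ i) (f v)) =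
      fun i (v : V × Bool) => if v.2 then ψ i v.1 else φ i v.1 := by
    intro φ ψ
    funext i v
    simp only [f]
    split_ifs <;> rfl
  simp only [h1, matches_doubled_iff, ind_and]
  rw [Ex_sample_update hp e₀.2]
  congr 1; funext x
  rw [sq, extAvg, ← Ex_mul_right]
  congr 1; funext φ
  rw [Ex_mul_left]
  congr 1
  congr 1; funext ψ
  congr 2
  funext i v
  simp only [Sample.merge, Sample.update]
  split_ifs <;> rfl

end ColoredGraph

/-! ### Controlled total colors -/

namespace ColoredGraph

variable {r k : ℕ} {Ω : Fin r → Type u} (G : ColoredGraph.{u, w} r k Ω)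

noncomputable instance (I : Idx r k) : Fintype (G.Color I) :=
  @Fintype.ofFinite _ (G.finite_color I)

variable [∀ i, Fintype (Ω i)] {p : (i : Fin r) → Ω i → ℝ}

/-- The total colors outside of `bad` behave regularly, for the indices of size at most `q`: a
random edge is unlikely to have a bad total color, the relative densities of the other total
colors are at least `η`, and a pattern on at most `h` labels per class without bad faces appears
with probability a product of numbers close to its relative densities, both in the additive and in
the multiplicative sense. The additive error is weighted with the number of colors in the same way
as the probability of a bad total color, because regularity is. The multiplicative bounds do not
involve `ε`; they allow patterns to be compared with their doubles. -/
structure IsControlled (p : (i : Fin r) → Ω i → ℝ) (q h : ℕ) (ε η ρ : ℝ)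
    (bad : (I : Idx r k) → G.TotalColor I → Prop) : Prop where
  up : ∀ (I J : Idx r k) (hJ : J.1 ⊆ I.1) (c : G.TotalColor I),
    bad J (restrictTotal c hJ) → bad I c
  prob : ∀ I : Idx r k, #I.1 ≤ q →
    Nat.card (G.Color I) * edgeProb p I.1 (fun e => bad I (G.total I e)) ≤ ρ
  dens : ∀ (I : Idx r k) (c : G.TotalColor I), #I.1 ≤ q → ¬ bad I c → η ≤ G.relDensity p I c
  count : ∀ (V : Type) [Fintype V] [DecidableEq V], Fintype.card V ≤ h →
    ∀ (vis : Finset (Face r k V)) (col : (e : Face r k V) → G.Color e.1), DownClosed vis →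
      (∀ e ∈ vis, #e.1.1 ≤ q ∧ ¬ bad e.1 (G.faceTotal col e)) →
      ∃ x : Face r k V → ℝ, (∀ e ∈ vis,
          |x e - G.relDensity p e.1 (G.faceTotal col e)| * Nat.card (G.Color e.1) ≤ ε ∧
          G.relDensity p e.1 (G.faceTotal col e) / 2 ≤ x e ∧
          x e ≤ 2 * G.relDensity p e.1 (G.faceTotal col e) ∧ x e ≤ 1) ∧
        Ex (sampleWeight p) (fun φ : Sample Ω V => ind (G.Matches col vis φ)) = ∏ e ∈ vis, x e

/-- The sum of the mean increments over all indices of size `q` and all colors. -/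
noncomputable def incrementSum (p : (i : Fin r) → Ω i → ℝ) (q : ℕ) (L : Type) [Fintype L]
    [DecidableEq L] : ℝ :=
  ∑ I : Idx r k with #I.1 = q, ∑ c : G.Color I,
    Ex (edgeWeight p I.1) (G.increment p q L I c)

/-- The total color `c` has a large increment: the mean square change of the density of its last
color on the edges with its frame is more than `κ`. -/
def IncBad (p : (i : Fin r) → Ω i → ℝ) (q : ℕ) (L : Type) [Fintype L] [DecidableEq L] (κ : ℝ)
    (I : Idx r k) (c : G.TotalColor I) : Prop :=
  κ * Ex (edgeWeight p I.1) (fun x => ind (∀ J, J.1 ≠ I → G.total I x J = c J)) <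
    Ex (edgeWeight p I.1) fun x => G.increment p q L I (c ⟨I, Subset.rfl⟩) x *
      ind (∀ J, J.1 ≠ I → G.total I x J = c J)

/-- Few edges have a small relative density. -/
theorem Ex_relDensity_lt (hp : ∀ i, p i ∈ stdSimplex ℝ (Ω i)) (I : Idx r k) {η : ℝ}
    (hη : 0 ≤ η) :
    Ex (edgeWeight p I.1) (fun e => ind (G.relDensity p I (G.total I e) < η)) ≤
      η * Nat.card (G.Color I) := by
  have hw := edgeWeight_mem hp I.1
  set D := fun c => cond (edgeWeight p I.1) (G.frame I) (G.colorInd I c) with hD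
  have h1 : Ex (edgeWeight p I.1) (fun e => ind (G.relDensity p I (G.total I e) < η)) ≤
      Ex (edgeWeight p I.1) fun e => ∑ c, G.colorInd I c e * ind (D c e < η) := by
    refine Ex_mono_of_ne hw fun e he => ?_
    rw [G.relDensity_eq_cond I (G.total I e) e (fun _ _ => rfl) (fibre_pos hw he).ne']
    refine le_trans (le_of_eq ?_) (single_le_sum (f := fun c => G.colorInd I c e *
      ind (D c e < η)) (fun c _ => mul_nonneg (ind_nonneg _) (ind_nonneg _))
      (mem_univ (G.color I e)))
    simp only [colorInd, ind_of, one_mul]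
    rfl
  refine h1.trans ?_
  rw [Ex_sum]
  have h2 : ∀ c ∈ (univ : Finset (G.Color I)), Ex (edgeWeight p I.1)
      (fun e => G.colorInd I c e * ind (D c e < η)) ≤ η := by
    intro c _
    rw [← Ex_cond_mul (π := G.frame I) hw (G.colorInd I c) (fun e e' h => by
      simp only [hD, cond_congr (π := G.frame I) (G.colorInd I c) h])]
    refine Ex_le_const hw fun e => ?_
    by_cases h : D c e < η
    · rw [ind_of h, mul_one]; exact h.le
    · rw [ind_not h, mul_zero]; exact hη
  refine (sum_le_sum h2).trans (le_of_eq ?_)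
  rw [sum_const, nsmul_eq_mul, card_univ, Nat.card_eq_fintype_card, mul_comm]

/-- Few edges have a large increment. -/
theorem Ex_incBad_le (hp : ∀ i, p i ∈ stdSimplex ℝ (Ω i)) (q : ℕ) (L : Type) [Fintype L]
    [DecidableEq L] {κ : ℝ} (hκ : 0 < κ) (I : Idx r k) :
    Ex (edgeWeight p I.1) (fun e => ind (G.IncBad p q L κ I (G.total I e))) ≤
      (∑ c, Ex (edgeWeight p I.1) (G.increment p q L I c)) / κ := by
  have hw := edgeWeight_mem hp I.1
  set D := fun c => cond (edgeWeight p I.1) (G.frame I) (G.increment p q L I c) with hD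
  have hD0 : ∀ c e, 0 ≤ D c e := fun c e =>
    cond_nonneg hw (fun x => G.increment_nonneg hp L I c x) e
  have h1 : Ex (edgeWeight p I.1) (fun e => ind (G.IncBad p q L κ I (G.total I e))) ≤
      Ex (edgeWeight p I.1) fun e => ∑ c, ind (κ < D c e) := by
    refine Ex_mono_of_ne hw fun e he => ?_
    refine le_trans (ind_mono fun h => ?_) (single_le_sum (f := fun c => ind (κ < D c e))
      (fun c _ => ind_nonneg _) (mem_univ (G.color I e)))
    have hpos := fibre_pos (π := G.frame I) hw he
    have hfr : ∀ x, (∀ J, J.1 ≠ I → G.total I x J = G.total I e J) ↔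
        G.frame I x = G.frame I e := fun x =>
      ⟨fun h => funext fun J => h J.1 J.2, fun h J hJ => congrFun h ⟨J, hJ⟩⟩
    simp only [IncBad, hfr] at h
    simp only [hD, cond]
    rw [lt_div_iff₀ hpos]
    refine h.trans_le (le_of_eq ?_)
    congr 1; funext x
    exact mul_comm _ _
  refine h1.trans ?_
  rw [Ex_sum, sum_div]
  refine sum_le_sum fun c _ => ?_
  refine (Ex_ind_lt_le hw (hD0 c) hκ).trans (le_of_eq ?_)
  rw [Ex_cond hw]

variable {G}
variable {q h : ℕ} {ε η ρ : ℝ} {bad : (I : Idx r k) → G.TotalColor I → Prop}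
  {V : Type} [Fintype V] [DecidableEq V]

/-- A pattern without bad faces is not too rare. -/
theorem IsControlled.pow_le_count (C : G.IsControlled p q h ε η ρ bad) (hη : 0 < η) (hη1 : η ≤ 1)
    {T : ℕ} (hV : Fintype.card V ≤ h) {s : Finset (Face r k V)} (hT : #s ≤ T)
    {col : (e : Face r k V) → G.Color e.1} (hs : DownClosed s)
    (hgood : ∀ e ∈ s, #e.1.1 ≤ q ∧ ¬ bad e.1 (G.faceTotal col e)) :
    (η / 2) ^ T ≤ Ex (sampleWeight p) fun φ : Sample Ω V => ind (G.Matches col s φ) := by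
  obtain ⟨x, hx, hP⟩ := C.count V hV s col hs hgood
  rw [hP]
  calc (η / 2) ^ T ≤ (η / 2) ^ #s := pow_le_pow_of_le_one (by linarith) (by linarith) hT
    _ = ∏ e ∈ s, η / 2 := by rw [prod_const]
    _ ≤ _ := prod_le_prod (fun _ _ => by linarith) fun e he => by
      have := C.dens e.1 (G.faceTotal col e) (hgood e he).1 (hgood e he).2
      linarith [(hx e he).2.1]

/-- The count of a pattern doubled over a face is bounded by the square of the count of the
pattern, relative to the count of the frame of this face. -/
theorem IsControlled.count_doubled_le (hp : ∀ i, p i ∈ stdSimplex ℝ (Ω i))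
    (C : G.IsControlled p q (2 * h) ε η ρ bad)
    {T : ℕ} (hV : Fintype.card V ≤ h) {s : Finset (Face r k V)} (hT : #s ≤ T)
    {col : (e : Face r k V) → G.Color e.1} (hs : DownClosed s)
    (hgood : ∀ e ∈ s, #e.1.1 ≤ q ∧ ¬ bad e.1 (G.faceTotal col e)) (e₀ : Face r k V)
    (he₀ : #e₀.1.1 = q + 1)
    (hsub : ∀ (J : Idx r k) (hJ : J.1 ⊆ e₀.1.1), J ≠ e₀.1 → e₀.sub J hJ ∈ s) :
    Ex (edgeWeight p e₀.1.1)
        (fun x => ind (∀ J, J.1 ≠ e₀.1 → G.total e₀.1 x J = G.faceTotal col e₀ J)) *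
      Ex (edgeWeight p e₀.1.1)
        (fun x => extAvg p e₀.2 (fun φ : Sample Ω V => ind (G.Matches col s φ)) x ^ 2) ≤
      16 ^ T * (Ex (sampleWeight p) fun φ : Sample Ω V => ind (G.Matches col s φ)) ^ 2 := by
  classical
  set d : Face r k V → ℝ := fun e => G.relDensity p e.1 (G.faceTotal col e) with hd
  have hd0 : ∀ e, 0 ≤ d e := fun e => G.relDensity_nonneg hp _ _
  -- The frame of `e₀`.
  set F := s.filter fun e => e.IsSub e₀ with hF
  have hFcell : ∀ φ : Sample Ω V, G.Matches col F φ ↔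
      ∀ J, J.1 ≠ e₀.1 → G.total e₀.1 (φ.image e₀) J = G.faceTotal col e₀ J := by
    intro φ
    constructor
    · intro hm J hJ
      exact hm _ (mem_filter.2 ⟨hsub J.1 J.2 hJ, J.2, rfl⟩)
    · rintro hm ⟨I, e⟩ he
      obtain ⟨he, hJ, heq⟩ := mem_filter.1 he
      have hne : I ≠ e₀.1 := by
        rintro rfl
        have : #e₀.1.1 ≤ q := (hgood _ he).1
        omega
      have := hm ⟨I, hJ⟩ hne
      rw [heq]
      exact this
  have hFdown : DownClosed F := by
    intro e he J hJ
    rw [hF, mem_filter] at he ⊢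
    exact ⟨hs _ he.1 J hJ, he.2.sub J hJ⟩
  obtain ⟨x₁, hx₁, hP₁⟩ := C.count V (by omega) F col hFdown
    fun e he => hgood e (mem_filter.1 he).1
  have hcellEx : Ex (edgeWeight p e₀.1.1)
      (fun x => ind (∀ J, J.1 ≠ e₀.1 → G.total e₀.1 x J = G.faceTotal col e₀ J)) =
      ∏ e ∈ F, x₁ e := by
    rw [← hP₁]
    simp only [hFcell]
    exact (Ex_sample_edge hp e₀.2 fun x =>
      ind (∀ J, J.1 ≠ e₀.1 → G.total e₀.1 x J = G.faceTotal col e₀ J)).symm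
  obtain ⟨x₂, hx₂, hP₂⟩ := C.count (V × Bool)
    (by rw [Fintype.card_prod, Fintype.card_bool]; omega) (doubled e₀ s)
    (fun e => col (e.lift fun _ => Prod.fst)) (downClosed_doubled e₀ hs)
    fun e he => hgood _ (lift_fst_mem_of_mem_doubled he)
  obtain ⟨x₃, hx₃, hP₃⟩ := C.count V (by omega) s col hs hgood
  rw [G.Ex_extAvg_sq hp, hcellEx, hP₂, hP₃]
  have hb₁ : ∏ e ∈ F, x₁ e ≤ ∏ e ∈ F, 2 * d e :=
    prod_le_prod (fun e he => by linarith [hd0 e, (hx₁ e he).2.1]) fun e he => (hx₁ e he).2.2.1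
  have hb₂ : ∏ e ∈ doubled e₀ s, x₂ e ≤
      ∏ e ∈ doubled e₀ s, 2 * d (e.lift fun _ => Prod.fst) :=
    prod_le_prod (fun e he =>
        le_trans (div_nonneg (hd0 (e.lift fun _ => Prod.fst)) two_pos.le) (hx₂ e he).2.1)
      fun e he => (hx₂ e he).2.2.1
  have hb₃ : ∏ e ∈ s, 2 * d e ≤ 4 ^ T * ∏ e ∈ s, x₃ e := by
    have h0 : 0 ≤ ∏ e ∈ s, x₃ e := prod_nonneg fun e he => by
      linarith [hd0 e, (hx₃ e he).2.1]
    calc ∏ e ∈ s, 2 * d e ≤ ∏ e ∈ s, 4 * x₃ e :=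
          prod_le_prod (fun e _ => by linarith [hd0 e]) fun e he => by linarith [(hx₃ e he).2.1]
      _ = 4 ^ #s * ∏ e ∈ s, x₃ e := by rw [prod_mul_distrib, prod_const]
      _ ≤ _ := mul_le_mul_of_nonneg_right (pow_le_pow_right₀ (by norm_num) hT) h0
  rw [prod_doubled e₀ s fun e => 2 * d e] at hb₂
  have h0F : 0 ≤ ∏ e ∈ F, 2 * d e := prod_nonneg fun e _ => by linarith [hd0 e]
  have h0d : 0 ≤ ∏ e ∈ doubled e₀ s, x₂ e := prod_nonneg fun e he =>
    le_trans (div_nonneg (hd0 (e.lift fun _ => Prod.fst)) two_pos.le) (hx₂ e he).2.1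
  have h0s : 0 ≤ ∏ e ∈ s, 2 * d e := prod_nonneg fun e _ => by linarith [hd0 e]
  calc (∏ e ∈ F, x₁ e) * ∏ e ∈ doubled e₀ s, x₂ e
      ≤ (∏ e ∈ F, 2 * d e) * ((∏ e ∈ s, 2 * d e) * ∏ e ∈ s with ¬ e.IsSub e₀, 2 * d e) :=
        mul_le_mul hb₁ hb₂ h0d h0F
    _ = (∏ e ∈ s, 2 * d e) ^ 2 := by
        rw [sq, mul_left_comm, ← prod_filter_mul_prod_filter_not s (fun e => e.IsSub e₀)]
    _ ≤ (4 ^ T * ∏ e ∈ s, x₃ e) ^ 2 := pow_le_pow_left₀ h0s hb₃ 2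
    _ = 16 ^ T * (∏ e ∈ s, x₃ e) ^ 2 := by
        rw [mul_pow, ← pow_mul, mul_comm T 2, pow_mul]; norm_num

end ColoredGraph

namespace ColoredGraph

variable {r k : ℕ} {Ω : Fin r → Type u} {G : ColoredGraph.{u, w} r k Ω}
variable [∀ i, Fintype (Ω i)] {p : (i : Fin r) → Ω i → ℝ}
variable {q h : ℕ} {ε η ρ : ℝ} {bad : (I : Idx r k) → G.TotalColor I → Prop}

/-! ### From size `q` to size `q + 1` -/

/-- The bad total colors of the step from size `q` to size `q + 1`: those with a bad subcolor of
size at most `q`, and those of size `q + 1` which have a small relative density or a large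
increment. All total colors of size more than `q + 1` count as bad, which makes the bad ones closed
upwards. -/
def nextBad (G : ColoredGraph.{u, w} r k Ω) (p : (i : Fin r) → Ω i → ℝ) (q : ℕ) (L : Type)
    [Fintype L] [DecidableEq L] (κ η₁ : ℝ) (bad : (I : Idx r k) → G.TotalColor I → Prop)
    (I : Idx r k) (c : G.TotalColor I) : Prop :=
  (#I.1 ≤ q ∧ bad I c) ∨ q + 1 < #I.1 ∨ (#I.1 = q + 1 ∧
    ((∃ (J : Idx r k) (hJ : J.1 ⊆ I.1), J ≠ I ∧ bad J (restrictTotal c hJ)) ∨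
      G.relDensity p I c < η₁ ∨ G.IncBad p (q + 1) L κ I c))

theorem card_lt_of_ne {I J : Idx r k} (hJ : J.1 ⊆ I.1) (hne : J ≠ I) : #J.1 < #I.1 :=
  card_lt_card (hJ.ssubset_of_ne fun h => hne (Subtype.ext h))

theorem IsControlled.up_nextBad (C : G.IsControlled p q h ε η ρ bad) {L : Type} [Fintype L]
    [DecidableEq L] {κ η₁ : ℝ} (I J : Idx r k) (hJ : J.1 ⊆ I.1) (c : G.TotalColor I)
    (hbad : G.nextBad p q L κ η₁ bad J (restrictTotal c hJ)) :
    G.nextBad p q L κ η₁ bad I c := by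
  by_cases hJI : J = I
  · subst hJI; exact hbad
  have hlt := card_lt_of_ne hJ hJI
  rcases lt_trichotomy (#I.1) (q + 1) with hI | hI | hI
  · rcases hbad with ⟨-, hb⟩ | hb | ⟨hb, -⟩
    · exact Or.inl ⟨by omega, C.up I J hJ c hb⟩
    · omega
    · omega
  · rcases hbad with ⟨-, hb⟩ | hb | ⟨hb, -⟩
    · exact Or.inr (Or.inr ⟨hI, Or.inl ⟨J, hJ, hJI, hb⟩⟩)
    · omega
    · omega
  · exact Or.inr (Or.inl hI)

theorem edge_nonempty (hp : ∀ i, p i ∈ stdSimplex ℝ (Ω i)) (I : Finset (Fin r)) :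
    Nonempty (Edge Ω I) := by
  by_contra hne
  rw [not_nonempty_iff] at hne
  have := (edgeWeight_mem hp I).2
  rw [univ_eq_empty, sum_empty] at this
  exact zero_ne_one this

theorem one_le_card_color (G : ColoredGraph.{u, w} r k Ω)
    (hp : ∀ i, p i ∈ stdSimplex ℝ (Ω i)) (I : Idx r k) : 1 ≤ Nat.card (G.Color I) := by
  obtain ⟨e⟩ := edge_nonempty hp I.1
  have := G.finite_color I
  have : Nonempty (G.Color I) := ⟨G.color I e⟩
  exact Nat.card_pos

/-- The union bound over the reasons for which a total color of size `q + 1` is bad. -/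
theorem IsControlled.edgeProb_nextBad_le (hp : ∀ i, p i ∈ stdSimplex ℝ (Ω i))
    (C : G.IsControlled p q h ε η ρ bad) {L : Type} [Fintype L]
    [DecidableEq L] {κ η₁ : ℝ} (hκ : 0 < κ) (hη₁ : 0 ≤ η₁) {B : ℕ}
    (hB : ∀ I : Idx r k, #I.1 = q + 1 → Nat.card (G.Color I) ≤ B) (hρ : 0 ≤ ρ)
    (I : Idx r k) (hI : #I.1 = q + 1) :
    edgeProb p I.1 (fun e => G.nextBad p q L κ η₁ bad I (G.total I e)) ≤
      Fintype.card (Idx r k) * ρ + η₁ * B + G.incrementSum p (q + 1) L / κ := by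
  classical
  have hw := edgeWeight_mem hp I.1
  let g : Edge Ω I.1 → Idx r k → ℝ := fun e J => ind (∃ hJ : J.1 ⊆ I.1, J ≠ I ∧
    bad J (restrictTotal (G.total I e) hJ))
  have h1 : ∀ e, ind (G.nextBad p q L κ η₁ bad I (G.total I e)) ≤ (∑ J, g e J) +
      ind (G.relDensity p I (G.total I e) < η₁) +
        ind (G.IncBad p (q + 1) L κ I (G.total I e)) := by
    intro e
    have h0 : 0 ≤ ∑ J, g e J := sum_nonneg fun _ _ => ind_nonneg _
    by_cases hb : G.nextBad p q L κ η₁ bad I (G.total I e)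
    · rw [ind_of hb]
      rcases hb with ⟨hb, -⟩ | hb | ⟨-, ⟨J, hJ, hb⟩ | hb | hb⟩
      · omega
      · omega
      · have h2 : g e J ≤ ∑ J, g e J :=
          single_le_sum (f := g e) (fun _ _ => ind_nonneg _) (mem_univ J)
        have h3 : g e J = 1 := ind_of ⟨hJ, hb⟩
        linarith [ind_nonneg (G.relDensity p I (G.total I e) < η₁),
          ind_nonneg (G.IncBad p (q + 1) L κ I (G.total I e))]
      · rw [ind_of hb]
        linarith [ind_nonneg (G.IncBad p (q + 1) L κ I (G.total I e))]
      · rw [ind_of hb]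
        linarith [ind_nonneg (G.relDensity p I (G.total I e) < η₁)]
    · rw [ind_not hb]
      linarith [ind_nonneg (G.relDensity p I (G.total I e) < η₁),
          ind_nonneg (G.IncBad p (q + 1) L κ I (G.total I e))]
  have h2 : ∀ J ∈ (univ : Finset (Idx r k)), Ex (edgeWeight p I.1) (fun e => g e J) ≤ ρ := by
    intro J _
    by_cases hJ : J.1 ⊆ I.1 ∧ J ≠ I
    · have hJq : #J.1 ≤ q := by have := card_lt_of_ne hJ.1 hJ.2; omega
      have h3 : Ex (edgeWeight p I.1) (fun e => g e J) ≤
          edgeProb p J.1 fun e => bad J (G.total J e) := by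
        rw [edgeProb_eq_Ex, ← Ex_edge_restrict hp hJ.1]
        exact Ex_mono hw fun e => ind_mono fun ⟨_, _, h⟩ => h
      have h4 : 0 ≤ edgeProb p J.1 fun e => bad J (G.total J e) :=
        Ex_nonneg (edgeWeight_mem hp _) fun _ => ind_nonneg _
      have h5 : (1 : ℝ) ≤ Nat.card (G.Color J) := by exact_mod_cast G.one_le_card_color hp J
      nlinarith [C.prob J hJq]
    · refine le_trans (le_of_eq ?_) hρ
      have : ∀ e, g e J = 0 := fun e => ind_not fun ⟨h, h', _⟩ => hJ ⟨h, h'⟩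
      simp only [this]
      exact Ex_const hw 0
  rw [edgeProb_eq_Ex]
  refine (Ex_mono hw h1).trans ?_
  rw [Ex_add, Ex_add, Ex_sum]
  refine add_le_add (add_le_add ?_ ?_) ?_
  · refine (sum_le_sum h2).trans (le_of_eq ?_)
    rw [sum_const, nsmul_eq_mul, card_univ]
  · refine (G.Ex_relDensity_lt hp I hη₁).trans ?_
    exact mul_le_mul_of_nonneg_left (by exact_mod_cast hB I hI) hη₁
  · refine (G.Ex_incBad_le hp (q + 1) L hκ I).trans ?_
    refine div_le_div_of_nonneg_right ?_ hκ.le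
    exact single_le_sum (f := fun I : Idx r k => ∑ c : G.Color I,
      Ex (edgeWeight p I.1) (G.increment p (q + 1) L I c))
      (fun I _ => sum_nonneg fun c _ => Ex_nonneg (edgeWeight_mem hp _)
        fun x => G.increment_nonneg hp L I c x) (mem_filter.2 ⟨mem_univ I, hI⟩)

/-- The number of faces of a pattern on at most `h` labels is bounded in terms of `h`. -/
theorem card_face_le {V : Type} [Fintype V] {h : ℕ} (hV : Fintype.card V ≤ h)
    (s : Finset (Face r k V)) :
    #s ≤ Fintype.card (Face r k (Fin h)) := by
  refine (card_le_univ s).trans ?_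
  obtain ⟨f⟩ : Nonempty (V ↪ Fin h) := Function.Embedding.nonempty_of_card_le (by simpa using hV)
  refine Fintype.card_le_of_injective (Face.lift fun _ => f) fun e e' hee => ?_
  obtain ⟨I, e⟩ := e
  obtain ⟨J, e'⟩ := e'
  obtain rfl : I = J := congrArg Sigma.fst hee
  simp only [Face.lift, Sigma.mk.injEq, heq_eq_eq, true_and] at hee
  congr 1
  funext i
  exact f.injective (congrFun hee i)

variable {V : Type} [Fintype V] [DecidableEq V]

/-- The count of a pattern without bad faces, when the indicators of its faces of size `q + 1` are
replaced by their relative densities. The number `N` of copies is so large that the variance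
`N⁻¹` of their average is below the count of the faces of size at most `q`. -/
theorem IsControlled.abs_count_sub_le (hp : ∀ i, p i ∈ stdSimplex ℝ (Ω i))
    (C : G.IsControlled p q (2 * h) ε η ρ bad) (hη : 0 < η) (hη1 : η ≤ 1)
    {T N : ℕ} (hT : T = Fintype.card (Face r k (Fin h))) {κ γ : ℝ} (hκ : 0 ≤ κ) (hγ : 0 ≤ γ)
    (hκγ : κ * (16 ^ T + 1) ≤ γ ^ 2) (hN : 1 ≤ N * (η / 2) ^ T) (hV : Fintype.card V ≤ h)
    {s : Finset (Face r k V)} {col : (e : Face r k V) → G.Color e.1} (hs : DownClosed s)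
    (hgood : ∀ e ∈ s, #e.1.1 ≤ q ∧ ¬ bad e.1 (G.faceTotal col e)) (U : Finset (Face r k V))
    (hU : ∀ e ∈ U, #e.1.1 = q + 1 ∧
      (∀ (J : Idx r k) (hJ : J.1 ⊆ e.1.1), J ≠ e.1 → e.sub J hJ ∈ s) ∧
        ¬ G.IncBad p (q + 1) (Fin N × Fin h) κ e.1 (G.faceTotal col e)) :
    |Ex (sampleWeight p) (fun φ : Sample Ω V => ind (G.Matches col (s ∪ U) φ)) -
        Ex (sampleWeight p) (fun φ : Sample Ω V => ind (G.Matches col s φ)) *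
          ∏ e ∈ U, G.relDensity p e.1 (G.faceTotal col e)| ≤
      #U * γ * Ex (sampleWeight p) fun φ : Sample Ω V => ind (G.Matches col s φ) := by
  classical
  have hsw := sampleWeight_mem hp V
  set P := Ex (sampleWeight p) fun φ : Sample Ω V => ind (G.Matches col s φ) with hP
  have hTs : #s ≤ T := hT ▸ card_face_le hV s
  have hPlow : (η / 2) ^ T ≤ P := C.pow_le_count hη hη1 (by omega) hTs hs hgood
  have hpow : 0 < (η / 2) ^ T := by positivity
  have hN0 : 0 < N := by
    rcases Nat.eq_zero_or_pos N with rfl | h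
    · norm_num at hN
    · exact h
  have hN0' : (0 : ℝ) < N := by exact_mod_cast hN0
  have hNP : (N : ℝ)⁻¹ ≤ P := by
    refine le_trans ?_ hPlow
    rw [inv_le_iff_one_le_mul₀ hN0']
    linarith
  obtain ⟨f⟩ : Nonempty (V ↪ Fin h) := Function.Embedding.nonempty_of_card_le (by simpa using hV)
  induction U using Finset.induction_on with
  | empty => simp [← hP]
  | insert e₀ U he₀ ih =>
    have ih := ih fun e he => hU e (mem_insert_of_mem he)
    obtain ⟨hcard, hsub, hinc⟩ := hU e₀ (mem_insert_self _ _)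
    set d := G.relDensity p e₀.1 (G.faceTotal col e₀) with hd
    have hd0 : 0 ≤ d := G.relDensity_nonneg hp _ _
    have hd1 : d ≤ 1 := G.relDensity_le_one hp _ _
    set Q := Ex (sampleWeight p) fun φ : Sample Ω V => ind (G.Matches col (s ∪ U) φ) with hQ
    set E := Ex (sampleWeight p) (fun φ : Sample Ω V => ind (G.Matches col (s ∪ U) φ) *
        (ind (G.color e₀.1 (φ.image e₀) = col e₀) - d)) with hE
    have hmono : ∀ φ : Sample Ω V, ind (G.Matches col (s ∪ U) φ) ≤ ind (G.Matches col s φ) :=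
      fun φ => ind_mono fun hm e he => hm e (mem_union_left _ he)
    have hQP : Q ≤ P := Ex_mono hsw hmono
    -- The swap of `e₀` costs at most `γ P`.
    have hswap : E ^ 2 ≤ (γ * P) ^ 2 := by
      have h1 := G.count_swap_sq_le hp hN0 f f.injective col e₀ hcard (s ∪ U) (fun e he => by
        rcases mem_union.1 he with he | he
        · refine ⟨by have := (hgood e he).1; omega, ?_⟩
          rintro rfl
          have := (hgood e he).1
          omega
        · exact ⟨(hU e (mem_insert_of_mem he)).1.le, fun h => he₀ (h ▸ he)⟩)
        (fun J hJ hne => mem_union_left _ (hsub J hJ hne))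
      refine h1.trans ?_
      have h2 := C.count_doubled_le hp hV hTs hs hgood e₀ hcard hsub
      set cellP := Ex (edgeWeight p e₀.1.1)
        (fun x => ind (∀ J, J.1 ≠ e₀.1 → G.total e₀.1 x J = G.faceTotal col e₀ J)) with hcell
      set D := Ex (edgeWeight p e₀.1.1)
        (fun x => extAvg p e₀.2 (fun φ : Sample Ω V => ind (G.Matches col s φ)) x ^ 2) with hD
      have h3 : Ex (edgeWeight p e₀.1.1) (fun x =>
          extAvg p e₀.2 (fun φ : Sample Ω V => ind (G.Matches col (s ∪ U) φ)) x ^ 2) ≤ D := by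
        refine Ex_mono (edgeWeight_mem hp _) fun x => ?_
        exact pow_le_pow_left₀ (Ex_nonneg hsw fun _ => ind_nonneg _)
          (Ex_mono hsw fun φ => hmono _) 2
      have h4 : Ex (edgeWeight p e₀.1.1) (fun x =>
          G.increment p (q + 1) (Fin N × Fin h) e₀.1 (col e₀) x *
          ind (∀ J, J.1 ≠ e₀.1 → G.total e₀.1 x J = G.faceTotal col e₀ J)) ≤ κ * cellP :=
        not_lt.1 hinc
      have hc0 : 0 ≤ cellP := Ex_nonneg (edgeWeight_mem hp _) fun _ => ind_nonneg _
      have hc1 : cellP ≤ 1 := Ex_le_const (edgeWeight_mem hp _) fun _ => ind_le_one _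
      have hP0 : 0 < P := hpow.trans_le hPlow
      have hQ0 : 0 ≤ Q := Ex_nonneg hsw fun _ => ind_nonneg _
      have hD0 : 0 ≤ D := Ex_nonneg (edgeWeight_mem hp _) fun _ => sq_nonneg _
      have h5 : (N : ℝ)⁻¹ * Q ≤ P * P := mul_le_mul hNP hQP hQ0 hP0.le
      calc _ ≤ κ * cellP * (D + P * P) :=
            mul_le_mul h4 (add_le_add h3 h5)
              (add_nonneg (Ex_nonneg (edgeWeight_mem hp _) fun _ => sq_nonneg _)
                (mul_nonneg (inv_nonneg.2 hN0'.le) hQ0)) (mul_nonneg hκ hc0)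
        _ = κ * (cellP * D + cellP * (P * P)) := by ring
        _ ≤ κ * (16 ^ T * P ^ 2 + 1 * (P * P)) := by
            refine mul_le_mul_of_nonneg_left (add_le_add h2 ?_) hκ
            exact mul_le_mul_of_nonneg_right hc1 (by positivity)
        _ = κ * (16 ^ T + 1) * P ^ 2 := by ring
        _ ≤ γ ^ 2 * P ^ 2 := mul_le_mul_of_nonneg_right hκγ (by positivity)
        _ = (γ * P) ^ 2 := by ring
    have hP0 : 0 ≤ P := hpow.le.trans hPlow
    have hE1 : |E| ≤ γ * P := abs_le_of_sq_le_sq hswap (mul_nonneg hγ hP0)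
    have hE2 : Ex (sampleWeight p)
        (fun φ : Sample Ω V => ind (G.Matches col (s ∪ insert e₀ U) φ)) = E + d * Q := by
      rw [hE, hQ, ← Ex_mul_left, ← Ex_add]
      congr 1; funext φ
      have : G.Matches col (s ∪ insert e₀ U) φ ↔
          G.Matches col (s ∪ U) φ ∧ G.color e₀.1 (φ.image e₀) = col e₀ := by
        rw [union_insert]
        simp only [Matches, mem_insert, forall_eq_or_imp]
        exact and_comm
      rw [ind_congr this, ind_and]
      ring
    rw [hE2, prod_insert he₀, card_insert_of_notMem he₀]
    have h6 : E + d * Q - P * (d * ∏ e ∈ U, G.relDensity p e.1 (G.faceTotal col e)) =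
        E + d * (Q - P * ∏ e ∈ U, G.relDensity p e.1 (G.faceTotal col e)) := by ring
    rw [← hd, h6]
    refine (abs_add_le _ _).trans ?_
    rw [abs_mul, abs_of_nonneg hd0]
    have h7 := mul_le_mul hd1 ih (abs_nonneg _) zero_le_one
    push_cast
    linarith

/-- If the patterns of size at most `q` are controlled for `2 h` labels, then those of size at most
`q + 1` are controlled for `h` labels. -/
theorem IsControlled.succ (hp : ∀ i, p i ∈ stdSimplex ℝ (Ω i))
    (C : G.IsControlled p q (2 * h) ε η ρ bad) (hη : 0 < η) (hη1 : η ≤ 1) (hρ : 0 ≤ ρ)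
    {B T N : ℕ} (hB : ∀ I : Idx r k, #I.1 = q + 1 → Nat.card (G.Color I) ≤ B)
    (hT : T = Fintype.card (Face r k (Fin h))) {κ γ δ η₁ : ℝ} (hη₁ : 0 < η₁) (hη₁1 : η₁ ≤ 1)
    (hδ : 0 ≤ δ) (hδε : δ * B ≤ ε) (hδη : 2 * δ ≤ η₁) (hκ : 0 < κ) (hγ : 0 ≤ γ)
    (hκγ : κ * (16 ^ T + 1) ≤ γ ^ 2) (hTγ : T * γ ≤ δ * η₁ ^ T) (hN : 1 ≤ N * (η / 2) ^ T) :
    G.IsControlled p (q + 1) h ε (min η η₁)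
      (ρ + B * (Fintype.card (Idx r k) * ρ + η₁ * B +
        G.incrementSum p (q + 1) (Fin N × Fin h) / κ))
      (G.nextBad p q (Fin N × Fin h) κ η₁ bad) := by
  classical
  have hinc0 : 0 ≤ G.incrementSum p (q + 1) (Fin N × Fin h) :=
    sum_nonneg fun I _ => sum_nonneg fun c _ => Ex_nonneg (edgeWeight_mem hp _)
      fun x => G.increment_nonneg hp _ I c x
  have hR : 0 ≤ Fintype.card (Idx r k) * ρ + η₁ * B +
        G.incrementSum p (q + 1) (Fin N × Fin h) / κ := by positivity
  refine ⟨C.up_nextBad, fun I hI => ?_, fun I c hI hc => ?_, ?_⟩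
  · rcases Nat.lt_or_ge q (#I.1) with hq | hq
    · have h1 := C.edgeProb_nextBad_le hp (L := Fin N × Fin h) hκ hη₁.le hB hρ I (by omega)
      have h2 : (Nat.card (G.Color I) : ℝ) ≤ B := by exact_mod_cast hB I (by omega)
      have h3 := mul_le_mul h2 h1 (Ex_nonneg (edgeWeight_mem hp _) fun _ => ind_nonneg _)
        (Nat.cast_nonneg B)
      linarith
    · have h1 : ∀ e, G.nextBad p q (Fin N × Fin h) κ η₁ bad I (G.total I e) ↔
          bad I (G.total I e) := by
        intro e
        constructor
        · rintro (⟨-, hb⟩ | hb | ⟨hb, -⟩)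
          · exact hb
          · omega
          · omega
        · exact fun hb => Or.inl ⟨hq, hb⟩
      simp only [h1]
      have := C.prob I hq
      have h2 : 0 ≤ (B : ℝ) * (Fintype.card (Idx r k) * ρ + η₁ * B +
        G.incrementSum p (q + 1) (Fin N × Fin h) / κ) := by positivity
      linarith
  · rcases Nat.lt_or_ge q (#I.1) with hq | hq
    · refine (min_le_right _ _).trans (not_lt.1 fun hlt => hc ?_)
      exact Or.inr (Or.inr ⟨by omega, Or.inr (Or.inl hlt)⟩)
    · exact (min_le_left _ _).trans (C.dens I c hq fun hb => hc (Or.inl ⟨hq, hb⟩))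
  · intro V _ _ hV vis col hvis hgood
    set d : Face r k V → ℝ := fun e => G.relDensity p e.1 (G.faceTotal col e) with hd
    set s := vis.filter fun e => #e.1.1 ≤ q with hs_def
    set U := vis.filter fun e => ¬ #e.1.1 ≤ q with hU_def
    have hunion : s ∪ U = vis := filter_union_filter_not_eq _ _
    have hsgood : ∀ e ∈ s, #e.1.1 ≤ q ∧ ¬ bad e.1 (G.faceTotal col e) := fun e he => by
      obtain ⟨hev, heq⟩ := mem_filter.1 he
      exact ⟨heq, fun hb => (hgood e hev).2 (Or.inl ⟨heq, hb⟩)⟩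
    have hsdown : DownClosed s := hvis.filter_card q
    have hUcard : ∀ e ∈ U, #e.1.1 = q + 1 := fun e he => by
      obtain ⟨hev, heq⟩ := mem_filter.1 he
      have := (hgood e hev).1
      omega
    have hUgood : ∀ e ∈ U, η₁ ≤ d e := fun e he => not_lt.1 fun hlt =>
      (hgood e (mem_filter.1 he).1).2 (Or.inr (Or.inr ⟨hUcard e he, Or.inr (Or.inl hlt)⟩))
    have hU : ∀ e ∈ U, #e.1.1 = q + 1 ∧
        (∀ (J : Idx r k) (hJ : J.1 ⊆ e.1.1), J ≠ e.1 → e.sub J hJ ∈ s) ∧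
        ¬ G.IncBad p (q + 1) (Fin N × Fin h) κ e.1 (G.faceTotal col e) := fun e he => by
      refine ⟨hUcard e he, fun J hJ hne => ?_, fun hb => ?_⟩
      · have h1 := card_lt_of_ne hJ hne
        have h2 := hUcard e he
        have h3 : #(e.sub J hJ).1.1 = #J.1 := rfl
        exact mem_filter.2 ⟨hvis e (mem_filter.1 he).1 J hJ, by omega⟩
      · exact (hgood e (mem_filter.1 he).1).2
          (Or.inr (Or.inr ⟨hUcard e he, Or.inr (Or.inr hb)⟩))
    have habs := C.abs_count_sub_le hp hη hη1 hT hκ.le hγ hκγ hN hV hsdown hsgood U hU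
    have hPlow := C.pow_le_count hη hη1 (V := V) (by omega) (hT ▸ card_face_le hV s) hsdown hsgood
    obtain ⟨x₀, hx₀, hP₀⟩ := C.count V (by omega) s col hsdown hsgood
    rw [hunion] at habs
    set P := Ex (sampleWeight p) fun φ : Sample Ω V => ind (G.Matches col s φ) with hP
    set Q := Ex (sampleWeight p) fun φ : Sample Ω V => ind (G.Matches col vis φ) with hQ
    have hP0 : 0 < P := lt_of_lt_of_le (by positivity) hPlow
    have hQ0 : 0 ≤ Q := Ex_nonneg (sampleWeight_mem hp V) fun _ => ind_nonneg _
    have hQP : Q ≤ P := Ex_mono (sampleWeight_mem hp V) fun φ =>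
      ind_mono fun hm e he => hm e (mem_filter.1 he).1
    have hUT : #U ≤ T := hT ▸ card_face_le hV U
    -- The conditional probability of the faces in `U`, given those in `s`, is close to the product
    -- of their densities.
    have hclose : |Q / P - ∏ e ∈ U, d e| ≤ δ * η₁ ^ #U := by
      have h1 : Q / P - ∏ e ∈ U, d e = (Q - P * ∏ e ∈ U, d e) / P := by
        field_simp
      rw [h1, abs_div, abs_of_pos hP0, div_le_iff₀ hP0]
      refine habs.trans (mul_le_mul_of_nonneg_right ?_ hP0.le)
      have h2 : (#U : ℝ) * γ ≤ T * γ :=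
        mul_le_mul_of_nonneg_right (by exact_mod_cast hUT) hγ
      have h3 : δ * η₁ ^ T ≤ δ * η₁ ^ #U :=
        mul_le_mul_of_nonneg_left (pow_le_pow_of_le_one hη₁.le hη₁1 hUT) hδ
      linarith
    obtain ⟨x₁, hx₁, hP₁⟩ := exists_prod_eq_of_close U d hη₁ hη₁1 hUgood
      (fun e _ => G.relDensity_le_one hp _ _) hδ (div_nonneg hQ0 hP0.le)
      ((div_le_one hP0).2 hQP) (fun hU0 => by
        have : s = vis := by rw [← hunion, hU0, union_empty]
        rw [hQ, ← this]
        exact div_self hP0.ne') hclose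
    refine ⟨fun e => if #e.1.1 ≤ q then x₀ e else x₁ e, fun e he => ?_, ?_⟩
    · by_cases heq : #e.1.1 ≤ q
      · simp only [if_pos heq]
        exact hx₀ e (mem_filter.2 ⟨he, heq⟩)
      · simp only [if_neg heq]
        have heU : e ∈ U := mem_filter.2 ⟨he, heq⟩
        obtain ⟨h1, h2, h3⟩ := hx₁ e heU
        have h4 := hUgood e heU
        have h5 := abs_le.1 h1
        refine ⟨?_, ?_, ?_, h3⟩
        · refine le_trans (mul_le_mul h1 ?_ (Nat.cast_nonneg _) hδ) hδε
          exact_mod_cast hB e.1 (hUcard e heU)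
        · change d e / 2 ≤ x₁ e
          linarith [h5.1]
        · change x₁ e ≤ 2 * d e
          linarith [h5.2]
    · rw [← prod_filter_mul_prod_filter_not vis (fun e => #e.1.1 ≤ q)]
      rw [prod_congr rfl fun e he => if_pos (mem_filter.1 he).2,
        prod_congr (s₁ := vis.filter fun e => ¬ #e.1.1 ≤ q) rfl
          fun e he => if_neg (mem_filter.1 he).2, ← hs_def, ← hU_def, ← hP₀, hP₁]
      field_simp

end ColoredGraph

namespace ColoredGraph

variable {r k : ℕ} {Ω : Fin r → Type u} (G : ColoredGraph.{u, w} r k Ω)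

/-! ### Regularization and profiles -/

theorem regularize_succ {t : ℕ} {m : Fin (t + 1) → ℕ} (φ : (i : Fin (t + 1)) → PMap Ω (m i)) :
    G.regularize φ = (G.regularizeStep (t + 1) (φ (Fin.last t))).regularize
      fun i : Fin t => φ i.castSucc := rfl

/-- The old color of an edge is an entry of its new color. -/
def stepProj (s : ℕ) {m : ℕ} (φ : PMap Ω m) (I : Idx r k)
    (c : (G.regularizeStep s φ).Color I) : G.Color I :=
  c ⟨I, Subset.rfl, le_max_right _ _⟩ fun j => absurd j.2 (by simp)

theorem stepProj_color (s : ℕ) {m : ℕ} (φ : PMap Ω m) (I : Idx r k) (e : Edge Ω I.1) :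
    G.stepProj s φ I ((G.regularizeStep s φ).color I e) = G.color I e := by
  change G.color I (extendEdge φ e _) = G.color I e
  congr 1
  funext j
  exact dif_pos j.2

/-- An edge of size more than `s` keeps its color. -/
theorem stepProj_injective {s m : ℕ} (φ : PMap Ω m) {I : Idx r k} (hI : s < #I.1) :
    Function.Injective (G.stepProj s φ I) := by
  intro c c' h
  funext ⟨K, hK, hcard⟩ a
  have hKI : K = I := by
    refine Subtype.ext (eq_of_subset_of_card_le hK ?_).symm
    rwa [max_eq_right (by omega)] at hcard
  subst hKI
  have ha : a = fun j => absurd j.2 (by simp) := by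
    funext j
    exact absurd j.2 (by simp)
  rw [ha]
  exact h

/-- The new colors refine the old ones, and for the sizes more than `t` they are not finer. -/
theorem exists_regularize_proj {t : ℕ} {m : Fin t → ℕ} (φ : (i : Fin t) → PMap Ω (m i))
    (I : Idx r k) : ∃ f : (G.regularize φ).Color I → G.Color I,
      (∀ e, f ((G.regularize φ).color I e) = G.color I e) ∧
        (t < #I.1 → Function.Injective f) := by
  induction t generalizing G with
  | zero => exact ⟨id, fun _ => rfl, fun _ => Function.injective_id⟩
  | succ t ih =>
    obtain ⟨f, hf, hinj⟩ := ih (G.regularizeStep (t + 1) (φ (Fin.last t))) fun i => φ i.castSucc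
    refine ⟨fun c => G.stepProj (t + 1) (φ (Fin.last t)) I (f c), fun e => ?_, fun h => ?_⟩
    · exact (congrArg (G.stepProj (t + 1) (φ (Fin.last t)) I) (hf e)).trans
        (G.stepProj_color _ _ _ _)
    · exact (G.stepProj_injective _ h).comp (hinj (by omega))

/-- A profile determines those with respect to subsamples. -/
theorem profile_comp {q : ℕ} {I : Idx r k} {W W' : Type*} (f : W → W') (Φ : Sample Ω W')
    {e e' : Edge Ω I.1} (h : G.profile q I Φ e = G.profile q I Φ e') :
    G.profile q I (fun i v => Φ i (f v)) e = G.profile q I (fun i v => Φ i (f v)) e' := by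
  funext ⟨J, K, a⟩
  exact congrFun h ⟨J, K, fun i => f (a i)⟩

/-- The entries of the new color of an edge spanned by a subedge of `e` and by sampled vertices are
old colors of edges of the same kind. -/
theorem profile_regularizeStep {q s m : ℕ} (hs : s + 1 ≤ q) {I : Idx r k} {W : Type*}
    (Φ : Sample Ω W) (f : Fin m → W) {e e' : Edge Ω I.1}
    (h : G.profile q I Φ e = G.profile q I Φ e') :
    (G.regularizeStep s fun i v => Φ i (f v)).profile q I Φ e =
      (G.regularizeStep s fun i v => Φ i (f v)).profile q I Φ e' := by
  classical
  funext ⟨⟨J, hJ⟩, ⟨K, hK⟩, a⟩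
  funext ⟨K', hKK', hcard⟩ b
  let a' : K'.1 → W := fun i => if h : i.1 ∈ K.1 then a ⟨i.1, h⟩ else
    f (b ⟨i.1, mem_sdiff.2 ⟨i.2, h⟩⟩)
  have hJK : J ∩ K.1 ⊂ I.1 := lt_of_le_of_lt inter_subset_left hJ
  have key : ∀ x : Edge Ω I.1, extendEdge (fun i v => Φ i (f v)) (mix hJ.subset x Φ K.1 a) b =
      mix hJK.subset x Φ K'.1 a' := by
    intro x
    funext i
    by_cases hi : i.1 ∈ K.1
    · by_cases hiJ : i.1 ∈ J
      · simp [extendEdge, mix, hi, hiJ]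
      · simp [extendEdge, mix, hi, hiJ, a']
    · simp [extendEdge, mix, hi, a']
  change G.color K' (extendEdge _ (mix hJ.subset e Φ K.1 a) b) =
    G.color K' (extendEdge _ (mix hJ.subset e' Φ K.1 a) b)
  rw [key, key]
  exact congrFun h ⟨⟨J ∩ K.1, hJK⟩, ⟨K', hcard.trans (max_le hs hK)⟩, a'⟩

/-- Profiles with respect to a sample that contains all samples `φ i` determine the profiles of
the hypergraph regularized by `φ`. -/
theorem profile_regularize {q t : ℕ} (ht : t + 1 ≤ q) {I : Idx r k} {W : Type*}
    (Φ : Sample Ω W) {m : Fin t → ℕ} (f : (i : Fin t) → Fin (m i) → W) {e e' : Edge Ω I.1}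
    (h : G.profile q I Φ e = G.profile q I Φ e') :
    (G.regularize fun (i : Fin t) j v => Φ j (f i v)).profile q I Φ e =
      (G.regularize fun (i : Fin t) j v => Φ j (f i v)).profile q I Φ e' := by
  induction t generalizing G with
  | zero => exact h
  | succ t ih =>
    rw [regularize_succ]
    exact ih _ (by omega) (fun i => f i.castSucc)
      (G.profile_regularizeStep (by omega) Φ (f (Fin.last t)) h)

/-- The frame is a part of the profile. Labels have to exist, although their images do not matter
for the entries of the frame. -/
theorem frame_eq_of_profile_eq {q : ℕ} {I : Idx r k} (hI : #I.1 ≤ q) {W : Type*} [Nonempty W]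
    (Φ : Sample Ω W) {e e' : Edge Ω I.1} (h : G.profile q I Φ e = G.profile q I Φ e') :
    G.frame I e = G.frame I e' := by
  funext ⟨⟨J, hJ⟩, hne⟩
  have hJI : J.1 ⊂ I.1 := hJ.ssubset_of_ne fun h => hne (Subtype.ext h)
  have key : ∀ x : Edge Ω I.1,
      mix hJI.subset x Φ J.1 (fun _ => Classical.arbitrary W) = Edge.restrict x hJ := by
    intro x
    funext i
    exact dif_pos i.2
  have := congrFun h ⟨⟨J.1, hJI⟩, ⟨J, (card_le_card hJ).trans hI⟩, fun _ => Classical.arbitrary W⟩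
  change G.color J (mix hJI.subset e Φ J.1 _) = G.color J (mix hJI.subset e' Φ J.1 _) at this
  rw [key, key] at this
  exact this

/-- The frames of the regularized hypergraph determine the profiles with respect to the sample that
was used first. -/
theorem profile_eq_of_frame_eq {t : ℕ} {m : Fin (t + 1) → ℕ}
    (φ : (i : Fin (t + 1)) → PMap Ω (m i)) {I : Idx r k} {e e' : Edge Ω I.1}
    (h : (G.regularize φ).frame I e = (G.regularize φ).frame I e') :
    G.profile (t + 2) I (φ (Fin.last t)) e = G.profile (t + 2) I (φ (Fin.last t)) e' := by
  classical
  funext ⟨⟨J, hJ⟩, ⟨K, hK⟩, a⟩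
  change G.color K (mix hJ.subset e _ K.1 a) = G.color K (mix hJ.subset e' _ K.1 a)
  -- The entry is a color of the proper subedge on `J ∩ K` after the first regularization step. If
  -- `J ∩ K` is empty, then it does not depend on the edge at all.
  by_cases hJK : (J ∩ K.1).Nonempty
  · have hsub : J ∩ K.1 ⊆ I.1 := inter_subset_left.trans hJ.subset
    let J₀ : Idx r k := ⟨J ∩ K.1, card_pos.2 hJK, (card_le_card hsub).trans I.2.2⟩
    have hne : J₀ ≠ I := by
      intro h
      have h1 : J ∩ K.1 = I.1 := congrArg Subtype.val h
      exact hJ.2 (h1 ▸ inter_subset_left)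
    have h1 := congrFun h ⟨⟨J₀, hsub⟩, hne⟩
    obtain ⟨f, hf, -⟩ := exists_regularize_proj
      (G.regularizeStep (t + 1) (φ (Fin.last t))) (fun i : Fin t => φ i.castSucc) J₀
    have h2 := congrArg f h1
    change f (((G.regularizeStep (t + 1) (φ (Fin.last t))).regularize
      fun i : Fin t => φ i.castSucc).color J₀ (Edge.restrict e hsub)) =
        f (((G.regularizeStep (t + 1) (φ (Fin.last t))).regularize
      fun i : Fin t => φ i.castSucc).color J₀ (Edge.restrict e' hsub)) at h2
    rw [hf, hf] at h2
    let b : (j : ↥(K.1 \ J₀.1)) → Fin (m (Fin.last t)) := fun j => a ⟨j.1, (mem_sdiff.1 j.2).1⟩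
    have key : ∀ x : Edge Ω I.1, extendEdge (φ (Fin.last t)) (Edge.restrict x hsub) b =
        mix hJ.subset x (φ (Fin.last t)) K.1 a := by
      intro x
      funext i
      by_cases hi : i.1 ∈ J
      · have : i.1 ∈ J ∩ K.1 := mem_inter.2 ⟨hi, i.2⟩
        simp [extendEdge, mix, hi, this, Edge.restrict]
      · have : i.1 ∉ J ∩ K.1 := fun h => hi (mem_inter.1 h).1
        simp only [extendEdge, mix, dif_neg hi, dif_neg this]
        rfl
    have h3 := congrFun (congrFun h2 ⟨K, inter_subset_right, hK.trans (le_max_left _ _)⟩) b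
    change G.color K (extendEdge _ _ b) = G.color K (extendEdge _ _ b) at h3
    rwa [key, key] at h3
  · congr 1
    funext i
    have : i.1 ∉ J := fun hi => hJK ⟨i.1, mem_inter.2 ⟨hi, i.2⟩⟩
    simp [mix, this]

variable [∀ i, Fintype (Ω i)] {p : (i : Fin r) → Ω i → ℝ}

/-! ### The energy increment -/

/-- The sum over all colors of size `q` of the energies of the profiles with respect to `Φ`. -/
noncomputable def totalEnergy (p : (i : Fin r) → Ω i → ℝ) (q : ℕ) {W : Type} (Φ : Sample Ω W) :
    ℝ :=
  ∑ I : Idx r k with #I.1 = q, ∑ c : G.Color I,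
    energy (edgeWeight p I.1) (G.profile q I Φ) (G.colorInd I c)

/-- The mean of the total energy over a random sample. -/
noncomputable def meanEnergy (p : (i : Fin r) → Ω i → ℝ) (q : ℕ) (W : Type) [Fintype W]
    [DecidableEq W] : ℝ :=
  Ex (sampleWeight p) fun Φ : Sample Ω W => G.totalEnergy p q Φ

theorem meanEnergy_nonneg (hp : ∀ i, p i ∈ stdSimplex ℝ (Ω i)) (q : ℕ) (W : Type) [Fintype W]
    [DecidableEq W] : 0 ≤ G.meanEnergy p q W :=
  Ex_nonneg (sampleWeight_mem hp W) fun _ => sum_nonneg fun _ _ => sum_nonneg fun _ _ =>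
    energy_nonneg (edgeWeight_mem hp _) _

theorem meanEnergy_le (hp : ∀ i, p i ∈ stdSimplex ℝ (Ω i)) (q : ℕ) (W : Type) [Fintype W]
    [DecidableEq W] {B : ℕ} (hB : ∀ I, Nat.card (G.Color I) ≤ B) :
    G.meanEnergy p q W ≤ Fintype.card (Idx r k) * B := by
  refine Ex_le_const (sampleWeight_mem hp W) fun Φ => ?_
  have h1 : ∀ I ∈ univ.filter fun I : Idx r k => #I.1 = q, ∑ c : G.Color I,
      energy (edgeWeight p I.1) (G.profile q I Φ) (G.colorInd I c) ≤ B := by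
    intro I _
    refine (sum_le_sum (g := fun _ => (1 : ℝ)) fun c _ => energy_le_one (edgeWeight_mem hp _)
      (fun _ => ind_nonneg _) fun _ => ind_le_one _).trans ?_
    rw [sum_const, nsmul_eq_mul, mul_one, card_univ, ← Nat.card_eq_fintype_card]
    exact_mod_cast hB I
  refine (sum_le_sum h1).trans ?_
  rw [sum_const, nsmul_eq_mul]
  refine mul_le_mul_of_nonneg_right ?_ (Nat.cast_nonneg B)
  exact_mod_cast card_le_univ _

theorem meanEnergy_mono (hp : ∀ i, p i ∈ stdSimplex ℝ (Ω i)) (q : ℕ) {W W' : Type} [Fintype W]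
    [DecidableEq W] [Fintype W'] [DecidableEq W'] (f : W → W') (hf : Function.Injective f) :
    G.meanEnergy p q W ≤ G.meanEnergy p q W' := by
  rw [meanEnergy, ← Ex_sample_comp hp f hf]
  exact Ex_mono (sampleWeight_mem hp W') fun Φ => sum_le_sum fun I _ => sum_le_sum fun c _ =>
    energy_mono (edgeWeight_mem hp _) _ fun e e' h => G.profile_comp f Φ h

/-- The union of the samples `φ i` and `ψ`. -/
def joinSample {t : ℕ} {m : Fin t → ℕ} (φ : (i : Fin t) → PMap Ω (m i)) {L : Type}
    (ψ : Sample Ω L) : Sample Ω (((i : Fin t) × Fin (m i)) ⊕ L) :=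
  fun j => Sum.elim (fun a => φ a.1 j a.2) (ψ j)

/-- The increments of the regularized hypergraph are bounded by an increment of the energy. -/
theorem incrementSum_regularize_le (hp : ∀ i, p i ∈ stdSimplex ℝ (Ω i)) {t : ℕ}
    {m : Fin (t + 1) → ℕ} (φ : (i : Fin (t + 1)) → PMap Ω (m i)) (L : Type) [Fintype L]
    [DecidableEq L] [Nonempty L] :
    (G.regularize φ).incrementSum p (t + 2) L ≤
      Ex (sampleWeight p) (fun ψ : Sample Ω L => G.totalEnergy p (t + 2) (joinSample φ ψ)) -
        G.totalEnergy p (t + 2) (φ (Fin.last t)) := by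
  classical
  set H := G.regularize φ with hH
  have hsw := sampleWeight_mem hp L
  simp only [totalEnergy]
  rw [Ex_sum, ← sum_sub_distrib]
  refine sum_le_sum fun I hI => ?_
  have hI : #I.1 = t + 2 := (mem_filter.1 hI).2
  have hw := edgeWeight_mem hp I.1
  rw [Ex_sum, ← sum_sub_distrib]
  obtain ⟨f, hf, hinj⟩ := G.exists_regularize_proj φ I
  have hinj := hinj (by omega)
  have hrefine : ∀ ψ : Sample Ω L, ∀ e e',
      G.profile (t + 2) I (joinSample φ ψ) e = G.profile (t + 2) I (joinSample φ ψ) e' →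
        H.profile (t + 2) I ψ e = H.profile (t + 2) I ψ e' := by
    intro ψ e e' h
    have h1 := G.profile_regularize (t := t + 1) le_rfl (joinSample φ ψ)
      (fun i v => Sum.inl ⟨i, v⟩) h
    exact H.profile_comp (fun v => Sum.inr v) (joinSample φ ψ) h1
  set g : G.Color I → ℝ := fun c =>
    Ex (sampleWeight p) (fun ψ : Sample Ω L => energy (edgeWeight p I.1)
      (G.profile (t + 2) I (joinSample φ ψ)) (G.colorInd I c)) -
        energy (edgeWeight p I.1) (G.profile (t + 2) I (φ (Fin.last t))) (G.colorInd I c) with hg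
  have hg0 : ∀ c, 0 ≤ g c := by
    intro c
    rw [hg, sub_nonneg, ← Ex_const hsw (energy (edgeWeight p I.1)
      (G.profile (t + 2) I (φ (Fin.last t))) (G.colorInd I c))]
    exact Ex_mono hsw fun ψ => energy_mono hw _ fun e e' h =>
      G.profile_comp (fun v => Sum.inl ⟨Fin.last t, v⟩) (joinSample φ ψ) h
  have hterm : ∀ c : H.Color I, Ex (edgeWeight p I.1) (H.increment p (t + 2) L I c) ≤ g (f c) := by
    intro c
    have hX : H.colorInd I c = G.colorInd I (f c) := by
      funext x
      refine ind_congr ?_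
      rw [← hf x]
      exact hinj.eq_iff.symm
    change Ex (edgeWeight p I.1) (fun x => H.increment p (t + 2) L I c x) ≤ _
    simp only [increment, hX]
    rw [Ex_comm]
    have h1 : ∀ ψ : Sample Ω L, Ex (edgeWeight p I.1) (fun x =>
        (cond (edgeWeight p I.1) (H.profile (t + 2) I ψ) (G.colorInd I (f c)) x -
          cond (edgeWeight p I.1) (H.frame I) (G.colorInd I (f c)) x) ^ 2) =
        energy (edgeWeight p I.1) (H.profile (t + 2) I ψ) (G.colorInd I (f c)) -
          energy (edgeWeight p I.1) (H.frame I) (G.colorInd I (f c)) := fun ψ =>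
      Ex_cond_sub_sq hw _ fun e e' h => H.frame_eq_of_profile_eq hI.le ψ h
    simp only [h1]
    rw [Ex_sub, Ex_const hsw]
    refine sub_le_sub (Ex_mono hsw fun ψ => energy_mono hw _ (hrefine ψ)) ?_
    exact energy_mono hw _ fun e e' h => G.profile_eq_of_frame_eq φ h
  calc _ ≤ ∑ c : H.Color I, g (f c) := sum_le_sum fun c _ => hterm c
    _ = ∑ c ∈ univ.image f, g c := (sum_image hinj.injOn).symm
    _ ≤ ∑ c, g c := sum_le_sum_of_subset_of_nonneg (subset_univ _) fun c _ _ => hg0 c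

/-- If `M` labels suffice for all the samples and for the labels in `L`, then the mean increments
are at most the growth of the mean energy from the sample size used first to `M`. -/
theorem tupleExp_incrementSum_le (hp : ∀ i, p i ∈ stdSimplex ℝ (Ω i)) {t : ℕ}
    (m : Fin (t + 1) → ℕ) (L : Type) [Fintype L] [DecidableEq L] [Nonempty L] {M : ℕ}
    (hM : ∑ i, m i + Fintype.card L ≤ M) :
    tupleExp p m (fun φ => (G.regularize φ).incrementSum p (t + 2) L) ≤
      G.meanEnergy p (t + 2) (Fin M) - G.meanEnergy p (t + 2) (Fin (m (Fin.last t))) := by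
  have hw := tuple_mem hp m
  have h1 : tupleExp p m (fun φ => (G.regularize φ).incrementSum p (t + 2) L) ≤
      tupleExp p m (fun φ => Ex (sampleWeight p)
        (fun ψ : Sample Ω L => G.totalEnergy p (t + 2) (joinSample φ ψ)) -
          G.totalEnergy p (t + 2) (φ (Fin.last t))) :=
    Ex_mono hw fun φ => G.incrementSum_regularize_le hp φ L
  refine h1.trans ?_
  have h2 : tupleExp p m (fun φ => Ex (sampleWeight p)
        (fun ψ : Sample Ω L => G.totalEnergy p (t + 2) (joinSample φ ψ)) -
          G.totalEnergy p (t + 2) (φ (Fin.last t))) =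
      tupleExp p m (fun φ => Ex (sampleWeight p)
        (fun ψ : Sample Ω L => G.totalEnergy p (t + 2) (joinSample φ ψ))) -
      tupleExp p m (fun φ => G.totalEnergy p (t + 2) (φ (Fin.last t))) := Ex_sub _ _
  rw [h2]
  have h3 := Ex_sample_sigma (p := p) m fun Φ => Ex (sampleWeight p)
    (fun ψ : Sample Ω L => G.totalEnergy p (t + 2) fun j => Sum.elim (Φ j) (ψ j))
  rw [← Ex_sample_sum fun Φ : Sample Ω (((i : Fin (t + 1)) × Fin (m i)) ⊕ L) =>
    G.totalEnergy p (t + 2) Φ] at h3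
  have h4 := Ex_sample_sigma (p := p) m fun Φ =>
    G.totalEnergy p (t + 2) fun j v => Φ j ⟨Fin.last t, v⟩
  rw [Ex_sample_comp (p := p) hp (fun v : Fin (m (Fin.last t)) =>
    (⟨Fin.last t, v⟩ : (i : Fin (t + 1)) × Fin (m i))) (fun v v' h => by simpa using h)
    fun Φ => G.totalEnergy p (t + 2) Φ] at h4
  refine sub_le_sub (h3.trans_le ?_) h4.ge
  obtain ⟨f⟩ : Nonempty ((((i : Fin (t + 1)) × Fin (m i)) ⊕ L) ↪ Fin M) :=
    Function.Embedding.nonempty_of_card_le (by simpa using hM)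
  exact G.meanEnergy_mono hp _ f f.injective

/-- An edge of size one has an empty frame, and its profiles do not depend on it. -/
theorem incrementSum_one (L : Type) [Fintype L] [DecidableEq L] :
    G.incrementSum p 1 L = 0 := by
  refine sum_eq_zero fun I hI => sum_eq_zero fun c _ => ?_
  have hI : #I.1 = 1 := (mem_filter.1 hI).2
  have h0 : ∀ J : Finset (Fin r), J ⊂ I.1 → J = ∅ := by
    intro J hJ
    have := card_lt_card hJ
    exact card_eq_zero.1 (by omega)
  have h1 : ∀ ψ : Sample Ω L, ∀ e e', G.profile 1 I ψ e = G.profile 1 I ψ e' ↔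
      G.frame I e = G.frame I e' := by
    intro ψ e e'
    refine ⟨fun _ => ?_, fun _ => ?_⟩
    · funext ⟨⟨J, hJ⟩, hne⟩
      have := card_lt_of_ne hJ hne
      have := J.2.1
      omega
    · funext ⟨⟨J, hJ⟩, K, a⟩
      obtain rfl := h0 J hJ
      change G.color _ (mix _ e ψ _ a) = G.color _ (mix _ e' ψ _ a)
      congr 1
  have h2 : ∀ x, G.increment p 1 L I c x = 0 := by
    intro x
    simp only [increment, cond_eq_of_iff (h1 _), sub_self]
    simp [Ex]
  simp [h2, Ex]

/-- The colors of a regularized hypergraph are bounded in number. -/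
theorem exists_card_regularizeStep_le (r B s m : ℕ) : ∃ B' : ℕ, ∀ {k : ℕ} {Ω : Fin r → Type u}
    (G : ColoredGraph.{u, w} r k Ω) (φ : PMap Ω m), (∀ I, Nat.card (G.Color I) ≤ B) →
      ∀ I, Nat.card ((G.regularizeStep s φ).Color I) ≤ B' := by
  classical
  refine ⟨((B + 1) ^ ((m + 1) ^ r)) ^ (Fintype.card (Finset (Fin r))), fun {k Ω} G φ hB I => ?_⟩
  change Nat.card ((K : {K : Idx r k // I.1 ⊆ K.1 ∧ #K.1 ≤ max (s + 1) (#I.1)}) →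
    ((j : ↥(K.1.1 \ I.1)) → Fin m) → G.Color K.1) ≤ _
  rw [Nat.card_pi]
  have h1 : ∀ K ∈ (univ : Finset {K : Idx r k // I.1 ⊆ K.1 ∧ #K.1 ≤ max (s + 1) (#I.1)}),
      Nat.card (((j : ↥(K.1.1 \ I.1)) → Fin m) → G.Color K.1) ≤ (B + 1) ^ ((m + 1) ^ r) := by
    intro K _
    rw [Nat.card_fun]
    refine (Nat.pow_le_pow_left ((hB K.1).trans (Nat.le_succ B)) _).trans ?_
    refine Nat.pow_le_pow_right (Nat.succ_pos _) ?_
    rw [Nat.card_fun, Nat.card_eq_fintype_card, Fintype.card_fin]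
    refine (Nat.pow_le_pow_left (Nat.le_succ m) _).trans ?_
    refine Nat.pow_le_pow_right (Nat.succ_pos _) ?_
    rw [Nat.card_eq_fintype_card, Fintype.card_coe]
    exact (card_le_univ _).trans (by simp)
  refine (prod_le_pow_card _ _ _ h1).trans ?_
  refine Nat.pow_le_pow_right (by positivity) ?_
  rw [card_univ]
  exact Fintype.card_le_of_injective (fun K => K.1.1) fun K K' h =>
    Subtype.ext (Subtype.ext h)

end ColoredGraph

/-! ### Sampling schemes -/

/-- A scheme for `t` steps: the sample sizes `M i` and the ranges `N i` as functions of the integers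
`n`. The size `M i` depends on the `n j` with `j ≥ i` only, and the range `N i` on those with
`j > i` only; both are nondecreasing, and the ranges are positive. -/
structure Scheme (t : ℕ) where
  M : Fin t → (Fin t → ℕ) → ℕ
  N : Fin t → (Fin t → ℕ) → ℕ
  M_congr : ∀ i x y, (∀ j, i ≤ j → x j = y j) → M i x = M i y
  N_congr : ∀ i x y, (∀ j, i < j → x j = y j) → N i x = N i y
  M_mono : ∀ i, Monotone (M i)
  N_mono : ∀ i, Monotone (N i)
  N_pos : ∀ i x, 0 < N i x

namespace Scheme

variable {t : ℕ}

/-- The integer vector `x`, extended by the last entry `n`. -/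
abbrev ext (x : Fin t → ℕ) (n : ℕ) : Fin (t + 1) → ℕ := Fin.snoc (α := fun _ => ℕ) x n

theorem ext_mono {x y : Fin t → ℕ} {n n' : ℕ} (h : x ≤ y) (hn : n ≤ n') : ext x n ≤ ext y n' := by
  intro i
  induction i using Fin.lastCases with
  | last => simpa [ext] using hn
  | cast i => simpa [ext] using h i

/-- One scheme is bounded by another one. -/
def Le (s s' : Scheme t) : Prop := s.M ≤ s'.M ∧ s.N ≤ s'.N

/-- The scheme that remains after the last integer has been picked to be `n`. -/
def tail (s : Scheme (t + 1)) (n : ℕ) : Scheme t where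
  M i x := s.M i.castSucc (ext x n)
  N i x := s.N i.castSucc (ext x n)
  M_congr i x y h := s.M_congr _ _ _ fun j hj => by
    induction j using Fin.lastCases with
    | last => simp [ext]
    | cast j => simpa [ext] using h j (by simpa using hj)
  N_congr i x y h := s.N_congr _ _ _ fun j hj => by
    induction j using Fin.lastCases with
    | last => simp [ext]
    | cast j => simpa [ext] using h j (by simpa using hj)
  M_mono i _ _ h := s.M_mono _ (ext_mono h le_rfl)
  N_mono i _ _ h := s.N_mono _ (ext_mono h le_rfl)
  N_pos i x := s.N_pos _ _

/-- The pointwise maximum of two schemes. -/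
def sup (s s' : Scheme t) : Scheme t where
  M i x := max (s.M i x) (s'.M i x)
  N i x := max (s.N i x) (s'.N i x)
  M_congr i x y h := by rw [s.M_congr i x y h, s'.M_congr i x y h]
  N_congr i x y h := by rw [s.N_congr i x y h, s'.N_congr i x y h]
  M_mono i _ _ h := max_le_max (s.M_mono i h) (s'.M_mono i h)
  N_mono i _ _ h := max_le_max (s.N_mono i h) (s'.N_mono i h)
  N_pos i x := lt_max_of_lt_left (s.N_pos i x)

/-- The scheme with range `N₀` and sample sizes `m` in the last position, which continues with
`sub n` if the last integer is `n`. -/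
def cons (N₀ : ℕ) (hN₀ : 0 < N₀) (m : ℕ → ℕ) (hm : Monotone m) (sub : ℕ → Scheme t)
    (hsub : ∀ n n', n ≤ n' → (sub n).Le (sub n')) : Scheme (t + 1) where
  M i x := Fin.lastCases (motive := fun _ => ℕ) (m (x (Fin.last t)))
    (fun i => (sub (x (Fin.last t))).M i fun j => x j.castSucc) i
  N i x := Fin.lastCases (motive := fun _ => ℕ) N₀
    (fun i => (sub (x (Fin.last t))).N i fun j => x j.castSucc) i
  M_congr i x y h := by
    have hl := h (Fin.last t) (Fin.le_last i)
    induction i using Fin.lastCases with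
    | last => simp [hl]
    | cast i =>
      simp only [Fin.lastCases_castSucc, hl]
      exact (sub _).M_congr _ _ _ fun j hj => h _ (by simpa using hj)
  N_congr i x y h := by
    induction i using Fin.lastCases with
    | last => simp
    | cast i =>
      simp only [Fin.lastCases_castSucc, h (Fin.last t) (Fin.castSucc_lt_last i)]
      exact (sub _).N_congr _ _ _ fun j hj => h _ (by simpa using hj)
  M_mono i x y h := by
    induction i using Fin.lastCases with
    | last => simpa using hm (h (Fin.last t))
    | cast i =>
      simp only [Fin.lastCases_castSucc]
      exact ((sub _).M_mono i fun j => h j.castSucc).trans ((hsub _ _ (h (Fin.last t))).1 i _)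
  N_mono i x y h := by
    induction i using Fin.lastCases with
    | last => simp
    | cast i =>
      simp only [Fin.lastCases_castSucc]
      exact ((sub _).N_mono i fun j => h j.castSucc).trans ((hsub _ _ (h (Fin.last t))).2 i _)
  N_pos i x := by
    induction i using Fin.lastCases with
    | last => simpa using hN₀
    | cast i => simpa using (sub _).N_pos _ _

/-- The integer vector `x` respects the ranges of the scheme. -/
def InBox (s : Scheme t) (x : Fin t → ℕ) : Prop := ∀ i, x i < s.N i x

theorem inBox_ext {s : Scheme (t + 1)} {n : ℕ} {x : Fin t → ℕ} :
    s.InBox (ext x n) ↔ n < s.N (Fin.last t) 0 ∧ (s.tail n).InBox x := by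
  have h0 : s.N (Fin.last t) (ext x n) = s.N (Fin.last t) 0 :=
    s.N_congr _ _ _ fun j hj => absurd hj (not_lt.2 (Fin.le_last j))
  constructor
  · intro h
    refine ⟨?_, fun i => ?_⟩
    · have := h (Fin.last t)
      rw [h0] at this
      simpa [ext] using this
    · have := h i.castSucc
      simpa [ext, tail] using this
  · rintro ⟨hn, hx⟩ i
    induction i using Fin.lastCases with
    | last => rw [h0]; simpa [ext] using hn
    | cast i => simpa [ext, tail] using hx i

/-- The expectation over integers picked uniformly in the ranges of the scheme, from the last one
down to the first one. -/
noncomputable def exp : {t : ℕ} → Scheme t → ((Fin t → ℕ) → ℝ) → ℝ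
  | 0, _, f => f 0
  | t + 1, s, f => (∑ n ∈ range (s.N (Fin.last t) 0), (s.tail n).exp fun x => f (ext x n)) /
      s.N (Fin.last t) 0

theorem exp_mono (s : Scheme t) {f g : (Fin t → ℕ) → ℝ} (h : ∀ x, s.InBox x → f x ≤ g x) :
    s.exp f ≤ s.exp g := by
  induction t with
  | zero => exact h _ fun i => i.elim0
  | succ t ih =>
    refine div_le_div_of_nonneg_right (sum_le_sum fun n hn => ih _ fun x hx => ?_)
      (Nat.cast_nonneg _)
    exact h _ (inBox_ext.2 ⟨mem_range.1 hn, hx⟩)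

theorem exp_const (s : Scheme t) (a : ℝ) : s.exp (fun _ => a) = a := by
  induction t with
  | zero => rfl
  | succ t ih =>
    simp only [exp, ih, sum_const, card_range, nsmul_eq_mul]
    have : (s.N (Fin.last t) 0 : ℝ) ≠ 0 := by exact_mod_cast (s.N_pos _ _).ne'
    field_simp

theorem exp_add (s : Scheme t) (f g : (Fin t → ℕ) → ℝ) :
    s.exp (fun x => f x + g x) = s.exp f + s.exp g := by
  induction t with
  | zero => rfl
  | succ t ih => simp only [exp, ih, sum_add_distrib, add_div]

theorem exp_mul_left (s : Scheme t) (a : ℝ) (f : (Fin t → ℕ) → ℝ) :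
    s.exp (fun x => a * f x) = a * s.exp f := by
  induction t with
  | zero => rfl
  | succ t ih => simp only [exp, ih, ← mul_sum, mul_div_assoc]

theorem exp_Ex (s : Scheme t) {T : Type*} [Fintype T] (w : T → ℝ) (f : (Fin t → ℕ) → T → ℝ) :
    s.exp (fun x => Ex w (f x)) = Ex w fun y => s.exp fun x => f x y := by
  induction t with
  | zero => rfl
  | succ t ih =>
    simp only [exp, ih]
    simp only [div_eq_mul_inv]
    rw [Ex_mul_right, Ex_sum]

/-- The expectation as a weighted sum over the vectors that respect the ranges. -/
theorem exists_box (s : Scheme t) : ∃ S : Finset (Fin t → ℕ), (∀ x, x ∈ S ↔ s.InBox x) ∧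
    ∀ f : (Fin t → ℕ) → ℝ, s.exp f = ∑ x ∈ S, (∏ i, ((s.N i x : ℕ) : ℝ)⁻¹) * f x := by
  classical
  induction t with
  | zero =>
    refine ⟨{0}, fun x => ?_, fun f => by simp [exp]⟩
    simp only [mem_singleton, Subsingleton.elim x 0, InBox, true_iff]
    exact fun i => i.elim0
  | succ t ih =>
    choose S hS hexp using fun n => ih (s.tail n)
    refine ⟨(range (s.N (Fin.last t) 0)).biUnion fun n => (S n).image fun x => ext x n,
      fun x => ?_, fun f => ?_⟩
    · simp only [mem_biUnion, mem_range, mem_image]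
      constructor
      · rintro ⟨n, hn, y, hy, rfl⟩
        exact inBox_ext.2 ⟨hn, (hS n y).1 hy⟩
      · intro hx
        have hx' : ext (fun i : Fin t => x i.castSucc) (x (Fin.last t)) = x := Fin.snoc_init_self x
        rw [← hx', inBox_ext] at hx
        exact ⟨_, hx.1, _, (hS _ _).2 hx.2, hx'⟩
    · rw [sum_biUnion]
      · rw [exp, sum_div]
        refine sum_congr rfl fun n _ => ?_
        rw [hexp, sum_image fun x _ y _ h => (Fin.snoc_injective2 h).1, sum_div]
        refine sum_congr rfl fun x _ => ?_
        rw [Fin.prod_univ_castSucc]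
        have h0 : s.N (Fin.last t) (ext x n) = s.N (Fin.last t) 0 :=
          s.N_congr _ _ _ fun j hj => absurd hj (not_lt.2 (Fin.le_last j))
        rw [h0, div_eq_mul_inv]
        simp only [tail]
        ring
      · intro n _ n' _ hne
        rw [Function.onFun, disjoint_left]
        intro x hx hx'
        obtain ⟨y, -, rfl⟩ := mem_image.1 hx
        obtain ⟨y', -, h⟩ := mem_image.1 hx'
        exact hne (Fin.snoc_injective2 h).2.symm

end Scheme

/-! ### The expected failure of control -/

namespace ColoredGraph

variable {r k : ℕ} {Ω : Fin r → Type u} (G : ColoredGraph.{u, w} r k Ω) [∀ i, Fintype (Ω i)]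
  {p : (i : Fin r) → Ω i → ℝ}

/-- The infimum of the values `ρ` with which `G` is controlled. The set of these values is nonempty,
since all total colors may be declared bad. -/
noncomputable def ctrlVal (p : (i : Fin r) → Ω i → ℝ) (q h : ℕ) (ε η : ℝ) : ℝ :=
  sInf {ρ : ℝ | 0 ≤ ρ ∧ ∃ bad, G.IsControlled p q h ε η ρ bad}

variable {G} {q h : ℕ} {ε η ρ : ℝ} {bad : (I : Idx r k) → G.TotalColor I → Prop}

theorem IsControlled.ctrlVal_le (C : G.IsControlled p q h ε η ρ bad) (hρ : 0 ≤ ρ) :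
    G.ctrlVal p q h ε η ≤ ρ :=
  csInf_le ⟨0, fun _ h => h.1⟩ ⟨hρ, bad, C⟩

theorem IsControlled.mono (C : G.IsControlled p q h ε η ρ bad) {ε' η' : ℝ} (hε : ε ≤ ε')
    (hη : η' ≤ η) : G.IsControlled p q h ε' η' ρ bad := by
  refine ⟨C.up, C.prob, fun I c hI hc => hη.trans (C.dens I c hI hc), ?_⟩
  intro V _ _ hV vis col hvis hgood
  obtain ⟨x, hx, hP⟩ := C.count V hV vis col hvis hgood
  exact ⟨x, fun e he => ⟨(hx e he).1.trans hε, (hx e he).2⟩, hP⟩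

/-- Declaring all total colors bad. -/
theorem isControlled_true (hp : ∀ i, p i ∈ stdSimplex ℝ (Ω i)) {q h : ℕ} {ε η ρ : ℝ}
    (hρ : ∀ I : Idx r k, #I.1 ≤ q → (Nat.card (G.Color I) : ℝ) ≤ ρ) :
    G.IsControlled p q h ε η ρ fun _ _ => True := by
  refine ⟨fun _ _ _ _ h => h, fun I hI => ?_, fun _ _ _ h => absurd trivial h, ?_⟩
  · refine le_trans (mul_le_of_le_one_right (Nat.cast_nonneg _) ?_) (hρ I hI)
    exact Ex_le_const (edgeWeight_mem hp _) fun _ => ind_le_one _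
  · intro V _ _ hV vis col _ hgood
    have hvis : vis = ∅ := eq_empty_of_forall_notMem fun e he => (hgood e he).2 trivial
    subst hvis
    refine ⟨fun _ => 0, fun e he => absurd he (notMem_empty e), ?_⟩
    have : ∀ φ : Sample Ω V, ind (G.Matches col ∅ φ) = 1 := fun φ =>
      ind_of fun e he => absurd he (notMem_empty e)
    simp only [this, Ex_const (sampleWeight_mem hp V), prod_empty]

theorem ctrlVal_nonneg : 0 ≤ G.ctrlVal p q h ε η := Real.sInf_nonneg fun _ h => h.1

theorem exists_isControlled_of_lt (hp : ∀ i, p i ∈ stdSimplex ℝ (Ω i)) {a : ℝ}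
    (ha : G.ctrlVal p q h ε η < a) :
    ∃ ρ bad, 0 ≤ ρ ∧ ρ < a ∧ G.IsControlled p q h ε η ρ bad := by
  have hne : {ρ : ℝ | 0 ≤ ρ ∧ ∃ bad, G.IsControlled p q h ε η ρ bad}.Nonempty := by
    refine ⟨∑ I, (Nat.card (G.Color I) : ℝ), sum_nonneg fun _ _ => Nat.cast_nonneg _, _,
      isControlled_true hp fun I _ => ?_⟩
    exact single_le_sum (f := fun I => (Nat.card (G.Color I) : ℝ))
      (fun _ _ => Nat.cast_nonneg _) (mem_univ I)
  obtain ⟨ρ, ⟨hρ, bad, C⟩, hlt⟩ := exists_lt_of_csInf_lt hne ha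
  exact ⟨ρ, bad, hρ, hlt, C⟩

theorem ctrlVal_zero (hp : ∀ i, p i ∈ stdSimplex ℝ (Ω i)) : G.ctrlVal p 0 h ε η = 0 :=
  le_antisymm ((isControlled_true hp fun I hI => by have := I.2.1; omega).ctrlVal_le le_rfl)
    ctrlVal_nonneg

/-- The constants of the step from size `q` to size `q + 1`; here `T` bounds the number of faces of
a pattern, and `B` the number of colors of size `q + 1`. Densities below `η₁` and increments above
`κ` are bad, `γ` is the relative error of one swap of an indicator for a density, and `δ` is the
resulting error of a single factor. -/
structure StepConst (B T : ℕ) (ε : ℝ) where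
  η₁ : ℝ
  δ : ℝ
  γ : ℝ
  κ : ℝ
  η₁_pos : 0 < η₁
  η₁_le : η₁ ≤ 1
  η₁_small : B * (η₁ * B) ≤ ε / 3
  δ_nonneg : 0 ≤ δ
  δ_le : δ * B ≤ ε
  δ_le' : 2 * δ ≤ η₁
  γ_nonneg : 0 ≤ γ
  γ_le : T * γ ≤ δ * η₁ ^ T
  κ_pos : 0 < κ
  κ_le : κ * (16 ^ T + 1) ≤ γ ^ 2

theorem stepConst_nonempty (B T : ℕ) {ε : ℝ} (hε : 0 < ε) : Nonempty (StepConst B T ε) := by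
  obtain ⟨η₁, hη₁, hη₁1, hη₁B⟩ : ∃ η₁ : ℝ, 0 < η₁ ∧ η₁ ≤ 1 ∧ B * (η₁ * B) ≤ ε / 3 := by
    refine ⟨min 1 (ε / (3 * (B ^ 2 + 1))), by positivity, min_le_left _ _, ?_⟩
    have h1 : min 1 (ε / (3 * ((B : ℝ) ^ 2 + 1))) * (3 * ((B : ℝ) ^ 2 + 1)) ≤ ε := by
      rw [← le_div_iff₀ (by positivity)]
      exact min_le_right _ _
    have h2 : 0 < min 1 (ε / (3 * ((B : ℝ) ^ 2 + 1))) := by positivity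
    nlinarith
  obtain ⟨δ, hδ, hδε, hδη⟩ : ∃ δ : ℝ, 0 < δ ∧ δ * B ≤ ε ∧ 2 * δ ≤ η₁ := by
    refine ⟨min (η₁ / 2) (ε / (B + 1)), by positivity, ?_, by
      linarith [min_le_left (η₁ / 2) (ε / ((B : ℝ) + 1))]⟩
    have h1 : min (η₁ / 2) (ε / ((B : ℝ) + 1)) * ((B : ℝ) + 1) ≤ ε := by
      rw [← le_div_iff₀ (by positivity)]
      exact min_le_right _ _
    have h2 : 0 < min (η₁ / 2) (ε / ((B : ℝ) + 1)) := by positivity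
    linarith
  have hγ : 0 < δ * η₁ ^ T / (T + 1) := by positivity
  refine ⟨⟨η₁, δ, δ * η₁ ^ T / (T + 1), (δ * η₁ ^ T / (T + 1)) ^ 2 / (16 ^ T + 1), hη₁, hη₁1, hη₁B,
    hδ.le, hδε, hδη, hγ.le, ?_, by positivity, ?_⟩⟩
  · rw [← mul_div_assoc, div_le_iff₀ (by positivity)]
    nlinarith [show 0 < δ * η₁ ^ T by positivity]
  · rw [div_mul_cancel₀ _ (by positivity)]

/-- The step from size `q` to size `q + 1` in terms of the least values of `ρ`. -/
theorem ctrlVal_succ_le (hp : ∀ i, p i ∈ stdSimplex ℝ (Ω i)) {B T N : ℕ}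
    (hT : T = Fintype.card (Face r k (Fin h))) (K : StepConst B T ε) {ε' η' : ℝ} (hε' : ε' ≤ ε)
    (hη : 0 < η) (hη1 : η ≤ 1) (hη' : η' ≤ min η K.η₁)
    (hB : ∀ I : Idx r k, #I.1 = q + 1 → Nat.card (G.Color I) ≤ B) (hN : 1 ≤ N * (η / 2) ^ T) :
    G.ctrlVal p (q + 1) h ε η' ≤
      (1 + B * Fintype.card (Idx r k)) * G.ctrlVal p q (2 * h) ε' η + ε / 3 +
        B / K.κ * G.incrementSum p (q + 1) (Fin N × Fin h) := by
  have hκ := K.κ_pos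
  have hinc0 : 0 ≤ G.incrementSum p (q + 1) (Fin N × Fin h) :=
    sum_nonneg fun I _ => sum_nonneg fun c _ => Ex_nonneg (edgeWeight_mem hp _)
      fun x => G.increment_nonneg hp _ I c x
  refine le_of_forall_pos_le_add fun a ha => ?_
  have hR : (0 : ℝ) < 1 + B * Fintype.card (Idx r k) := by positivity
  obtain ⟨ρ, bad, hρ, hlt, C⟩ := exists_isControlled_of_lt (G := G) (q := q) (h := 2 * h)
    (ε := ε') (η := η) hp
    (a := G.ctrlVal p q (2 * h) ε' η + a / (1 + B * Fintype.card (Idx r k)))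
    (by linarith [show 0 < a / (1 + B * Fintype.card (Idx r k)) by positivity])
  have C' := ((C.mono hε' le_rfl).succ hp hη hη1 hρ hB hT K.η₁_pos K.η₁_le K.δ_nonneg K.δ_le
    K.δ_le' K.κ_pos K.γ_nonneg K.κ_le K.γ_le hN).mono le_rfl hη'
  have hη₁ := K.η₁_pos
  refine (C'.ctrlVal_le (by positivity)).trans ?_
  have h1 := mul_le_mul_of_nonneg_left hlt.le hR.le
  rw [mul_add, mul_div_cancel₀ _ hR.ne'] at h1
  have h2 := K.η₁_small
  have h3 : (B : ℝ) * (G.incrementSum p (q + 1) (Fin N × Fin h) / K.κ) =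
    B / K.κ * G.incrementSum p (q + 1) (Fin N × Fin h) := by ring
  nlinarith

end ColoredGraph

/-! ### Construction of the sampling scheme -/

namespace Scheme

variable {t : ℕ}

theorem le_sup_left (s s' : Scheme t) : s.Le (s.sup s') :=
  ⟨fun _ _ => le_max_left _ _, fun _ _ => le_max_left _ _⟩

theorem le_sup_right (s s' : Scheme t) : s'.Le (s.sup s') :=
  ⟨fun _ _ => le_max_right _ _, fun _ _ => le_max_right _ _⟩

theorem Le.trans {s s' s'' : Scheme t} (h : s.Le s') (h' : s'.Le s'') : s.Le s'' :=
  ⟨h.1.trans h'.1, h.2.trans h'.2⟩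

theorem le_cons {s : Scheme (t + 1)} {N₀ : ℕ} {hN₀ : 0 < N₀} {m : ℕ → ℕ} {hm : Monotone m}
    {sub : ℕ → Scheme t} {hsub : ∀ n n', n ≤ n' → (sub n).Le (sub n')}
    (hN : s.N (Fin.last t) 0 ≤ N₀) (hM : ∀ n, s.M (Fin.last t) (ext 0 n) ≤ m n)
    (hs : ∀ n, (s.tail n).Le (sub n)) : s.Le (cons N₀ hN₀ m hm sub hsub) := by
  have hext : ∀ x : Fin (t + 1) → ℕ, ext (fun i : Fin t => x i.castSucc) (x (Fin.last t)) = x :=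
    fun x => Fin.snoc_init_self x
  constructor <;> intro i x
  · induction i using Fin.lastCases with
    | last =>
      simp only [cons, Fin.lastCases_last]
      refine le_trans (le_of_eq (s.M_congr _ _ _ fun j hj => ?_)) (hM _)
      rw [Fin.last_le_iff.1 hj]
      simp [ext]
    | cast i =>
      simp only [cons, Fin.lastCases_castSucc]
      have := (hs (x (Fin.last t))).1 i fun j => x j.castSucc
      simpa only [tail, hext] using this
  · induction i using Fin.lastCases with
    | last =>
      simp only [cons, Fin.lastCases_last]
      exact le_trans (le_of_eq (s.N_congr _ _ _ fun j hj => absurd hj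
        (not_lt.2 (Fin.le_last j)))) hN
    | cast i =>
      simp only [cons, Fin.lastCases_castSucc]
      have := (hs (x (Fin.last t))).2 i fun j => x j.castSucc
      simpa only [tail, hext] using this

theorem tail_cons {N₀ : ℕ} {hN₀ : 0 < N₀} {m : ℕ → ℕ} {hm : Monotone m}
    {sub : ℕ → Scheme t} {hsub : ∀ n n', n ≤ n' → (sub n).Le (sub n')} (n : ℕ) :
    (cons N₀ hN₀ m hm sub hsub).tail n = sub n := by
  have hM : ((cons N₀ hN₀ m hm sub hsub).tail n).M = (sub n).M := by
    funext i x
    simp [cons, tail, ext]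
  have hN : ((cons N₀ hN₀ m hm sub hsub).tail n).N = (sub n).N := by
    funext i x
    simp [cons, tail, ext]
  generalize (cons N₀ hN₀ m hm sub hsub).tail n = s at *
  generalize sub n = s' at *
  cases s
  cases s'
  simp only at hM hN
  subst hM hN
  rfl

end Scheme

namespace ColoredGraph

variable {r k : ℕ} {Ω : Fin r → Type u} (G : ColoredGraph.{u, w} r k Ω) [∀ i, Fintype (Ω i)]
  {p : (i : Fin r) → Ω i → ℝ}

/-- The sample that is used first can be picked first. -/
theorem tupleExp_regularize_succ {t : ℕ} {M : Fin (t + 1) → ℕ} {m : ℕ} {M' : Fin t → ℕ}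
    (hm : M (Fin.last t) = m) (hM : ∀ i : Fin t, M i.castSucc = M' i)
    (g : ColoredGraph.{u, w} r k Ω → ℝ) :
    tupleExp p M (fun φ => g (G.regularize φ)) =
      Ex (mapWeight p) fun φ₀ : PMap Ω m => tupleExp p M' fun φ =>
        g ((G.regularizeStep (t + 1) φ₀).regularize φ) := by
  subst hm
  obtain rfl : (fun i : Fin t => M i.castSucc) = M' := funext hM
  unfold tupleExp Ex
  rw [← (Fin.snocEquiv fun i => PMap Ω (M i)).sum_comp, Fintype.sum_prod_type]
  refine sum_congr rfl fun φ₀ _ => ?_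
  rw [mul_sum]
  refine sum_congr rfl fun φ _ => ?_
  rw [Fin.prod_univ_castSucc]
  simp only [Fin.snocEquiv, Equiv.coe_fn_mk, Fin.snoc_castSucc, Fin.snoc_last, regularize_succ]
  ring

end ColoredGraph

/-- The sampling schemes exist, and can be chosen above any given scheme. The density bound `η` and
the bound `tot` for the number of sampled vertices do not depend on the hypergraph. In the
induction the last
range is long enough for the energy, which is bounded and nondecreasing in the last sample size, to
increase by little in the mean; the next sample size exceeds the previous one by the number of all
vertices that are sampled later on or are needed to count patterns. -/
theorem exists_scheme (r k t : ℕ) : ∀ (h B : ℕ) (ε : ℝ), 1 ≤ h → 0 < ε → ∀ s₀ : Scheme t,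
    ∃ (s : Scheme t) (η : ℝ) (tot : ℕ), s₀.Le s ∧ 0 < η ∧ η ≤ 1 ∧
      (∀ x, s.InBox x → ∑ i, s.M i x ≤ tot) ∧
      ∀ (Ω : Fin r → Type u) [∀ i, Fintype (Ω i)] (p : (i : Fin r) → Ω i → ℝ),
        (∀ i, p i ∈ stdSimplex ℝ (Ω i)) → ∀ G : ColoredGraph.{u, w} r k Ω,
          (∀ I, Nat.card (G.Color I) ≤ B) →
            s.exp (fun x => tupleExp p (fun i => s.M i x) fun φ =>
              (G.regularize φ).ctrlVal p (t + 1) h ε η) ≤ ε := by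
  have hexN : ∀ (η : ℝ) (T : ℕ), 0 < η → ∃ N : ℕ, 1 ≤ (N : ℝ) * (η / 2) ^ T := by
    intro η T hη
    obtain ⟨N, hN⟩ := exists_nat_ge (1 / (η / 2) ^ T)
    exact ⟨N, by rwa [div_le_iff₀ (by positivity)] at hN⟩
  induction t with
  | zero =>
    -- Nothing is sampled: size one has no increments, and only small densities are bad.
    intro h B ε hh hε s₀
    obtain ⟨K⟩ := ColoredGraph.stepConst_nonempty B (Fintype.card (Face r k (Fin h))) hε
    obtain ⟨N, hN⟩ := hexN 1 (Fintype.card (Face r k (Fin h))) one_pos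
    refine ⟨s₀, min 1 K.η₁, 0, ⟨le_rfl, le_rfl⟩, lt_min one_pos K.η₁_pos, min_le_left _ _,
      fun x _ => by simp, fun Ω _ p hp G hB => ?_⟩
    refine Ex_le_const (tuple_mem hp _) fun φ => ?_
    have h1 := ColoredGraph.ctrlVal_succ_le (G := G) (q := 0) (p := p) hp rfl K le_rfl one_pos
      le_rfl le_rfl (fun I _ => hB I) hN
    rw [ColoredGraph.ctrlVal_zero hp, G.incrementSum_one, mul_zero, mul_zero, zero_add,
      add_zero] at h1
    exact h1.trans (by linarith)
  | succ t ih =>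
    intro h B ε hh hε s₀
    set T := Fintype.card (Face r k (Fin h)) with hT
    set R := Fintype.card (Idx r k) with hR
    obtain ⟨K⟩ := ColoredGraph.stepConst_nonempty B T hε
    have hκ := K.κ_pos
    have hBR : (0 : ℝ) < 1 + B * R := by positivity
    set ε' := min ε (ε / (3 * (1 + B * R))) with hε'
    have hε'0 : 0 < ε' := by positivity
    have hε'1 : (1 + B * R) * ε' ≤ ε / 3 := by
      have h1 : ε' ≤ ε / (3 * (1 + B * R)) := min_le_right _ _
      rw [le_div_iff₀ (by positivity)] at h1
      linarith
    choose B' hB' using fun m : ℕ =>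
      ColoredGraph.exists_card_regularizeStep_le.{u, w} r B (t + 1) m
    choose sub η tot hsub hη hη1 htot hexp using fun m : ℕ =>
      ih (2 * h) (B' m) ε' (by omega) hε'0
    choose NN hNN using fun (m : ℕ) (s : Scheme t) => hexN (η m s) T (hη m s)
    -- The sample size `m n` together with a lower bound for the scheme that follows.
    let a : ℕ → ℕ × Scheme t := fun n => Nat.rec
      (s₀.M (Fin.last t) (Scheme.ext 0 0), s₀.tail 0)
      (fun n x => (max (x.1 + tot x.1 x.2 + NN x.1 x.2 * h)
          (s₀.M (Fin.last t) (Scheme.ext 0 (n + 1))),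
        (sub x.1 x.2).sup (s₀.tail (n + 1)))) n
    set m : ℕ → ℕ := fun n => (a n).1 with hm_def
    set S : ℕ → Scheme t := fun n => sub (a n).1 (a n).2 with hS_def
    have hm_succ : ∀ n, m n + tot (a n).1 (a n).2 + NN (a n).1 (a n).2 * h ≤ m (n + 1) :=
      fun n => le_max_left _ _
    have hm : Monotone m := monotone_nat_of_le_succ fun n => by
      have := hm_succ n
      omega
    have hS : ∀ n n', n ≤ n' → (S n).Le (S n') := by
      intro n n' hnn
      induction hnn with
      | refl => exact ⟨le_rfl, le_rfl⟩
      | step _ ih => exact ih.trans ((Scheme.le_sup_left _ _).trans (hsub _ _))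
    have hS₀ : ∀ n, (s₀.tail n).Le (S n) := by
      intro n
      cases n with
      | zero => exact hsub _ _
      | succ n => exact (Scheme.le_sup_right _ _).trans (hsub _ _)
    have hm₀ : ∀ n, s₀.M (Fin.last t) (Scheme.ext 0 n) ≤ m n := by
      intro n
      cases n with
      | zero => exact le_rfl
      | succ n => exact le_max_right _ _
    -- The energy is at most `R * B`, so that its mean increment is at most `R * B / N₀`.
    obtain ⟨N₁, hN₁⟩ := exists_nat_ge (B / K.κ * (R * B) / (ε / 3))
    set N₀ := max (s₀.N (Fin.last t) 0) N₁ with hN₀_def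
    have hN₀ : 0 < N₀ := lt_max_of_lt_left (s₀.N_pos _ _)
    have hN₀' : (0 : ℝ) < N₀ := by exact_mod_cast hN₀
    have hN₀ε : B / K.κ * (R * B) ≤ N₀ * (ε / 3) := by
      rw [div_le_iff₀ (by positivity)] at hN₁
      refine hN₁.trans (mul_le_mul_of_nonneg_right ?_ (by positivity))
      exact_mod_cast le_max_right _ _
    -- The constant `η` may depend on `n`; only finitely many values of `n` occur.
    obtain ⟨η₀, hη₀, hη₀1, hη₀le⟩ : ∃ η₀ : ℝ, 0 < η₀ ∧ η₀ ≤ 1 ∧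
        ∀ n < N₀, η₀ ≤ min (η (a n).1 (a n).2) K.η₁ := by
      have hne : (range N₀).Nonempty := nonempty_range_iff.2 hN₀.ne'
      refine ⟨(range N₀).inf' hne fun n => min (η (a n).1 (a n).2) K.η₁, ?_, ?_, fun n hn =>
        inf'_le _ (mem_range.2 hn)⟩
      · exact (lt_inf'_iff hne).2 fun n _ => lt_min (hη _ _) K.η₁_pos
      · exact (inf'_le _ (mem_range.2 hN₀)).trans ((min_le_left _ _).trans (hη1 _ _))
    set s : Scheme (t + 1) := Scheme.cons N₀ hN₀ m hm S hS with hs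
    have hsN : s.N (Fin.last t) 0 = N₀ := by simp [hs, Scheme.cons]
    have hsMlast : ∀ x n, s.M (Fin.last t) (Scheme.ext x n) = m n := by
      intro x n
      simp [hs, Scheme.cons, Scheme.ext]
    have hsM : ∀ (i : Fin t) x n, s.M i.castSucc (Scheme.ext x n) = (S n).M i x := by
      intro i x n
      simp [hs, Scheme.cons, Scheme.ext]
    have hstail : ∀ n, s.tail n = S n := fun n => Scheme.tail_cons n
    refine ⟨s, η₀, ∑ n ∈ range N₀, (m n + tot (a n).1 (a n).2),
      Scheme.le_cons (le_max_left _ _) hm₀ hS₀, hη₀, hη₀1, fun x hx => ?_, fun Ω _ p hp G hB => ?_⟩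
    · have hx' : Scheme.ext (fun i : Fin t => x i.castSucc) (x (Fin.last t)) = x :=
        Fin.snoc_init_self x
      rw [← hx', Scheme.inBox_ext, hsN, hstail] at hx
      rw [← hx', Fin.sum_univ_castSucc, hsMlast]
      simp only [hsM]
      have h1 : ∑ i, (S (x (Fin.last t))).M i (fun i => x i.castSucc) ≤
          tot (a (x (Fin.last t))).1 (a (x (Fin.last t))).2 := htot _ _ _ hx.2
      have h2 := single_le_sum (f := fun n => m n + tot (a n).1 (a n).2)
        (fun _ _ => Nat.zero_le _) (mem_range.2 hx.1)
      omega
    · set A : ℕ → ℝ := fun n => G.meanEnergy p (t + 2) (Fin (m n)) with hA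
      have hn : ∀ n ∈ range N₀, (S n).exp (fun x => tupleExp p (fun i => s.M i (Scheme.ext x n))
          fun φ => (G.regularize φ).ctrlVal p (t + 1 + 1) h ε η₀) ≤
            2 * (ε / 3) + B / K.κ * (A (n + 1) - A n) := by
        intro n hn
        have hn := mem_range.1 hn
        set ηn := η (a n).1 (a n).2 with hηn
        set Nn := NN (a n).1 (a n).2 with hNn_def
        have hNn : 1 ≤ (Nn : ℝ) * (ηn / 2) ^ T := hNN _ _
        have : Nonempty (Fin Nn × Fin h) := by
          have h1 : 0 < Nn := by
            rcases Nat.eq_zero_or_pos Nn with h0 | h0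
            · rw [h0] at hNn; norm_num at hNn
            · exact h0
          exact ⟨⟨0, h1⟩, ⟨0, hh⟩⟩
        have hbox : ∀ x, (S n).InBox x →
            tupleExp p (fun i => s.M i (Scheme.ext x n))
              (fun φ => (G.regularize φ).ctrlVal p (t + 1 + 1) h ε η₀) ≤
            ((1 + B * R) * Ex (mapWeight p) (fun φ₀ : PMap Ω (m n) =>
              tupleExp p (fun i => (S n).M i x) fun φ =>
                ((G.regularizeStep (t + 1) φ₀).regularize φ).ctrlVal p (t + 1) (2 * h) ε' ηn)) +
              (ε / 3 + B / K.κ * (A (n + 1) - A n)) := by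
          intro x hx
          set M := fun i => s.M i (Scheme.ext x n) with hM_def
          have hpt : ∀ φ : (i : Fin (t + 1)) → PMap Ω (M i),
              (G.regularize φ).ctrlVal p (t + 1 + 1) h ε η₀ ≤
              (1 + B * R) * (G.regularize φ).ctrlVal p (t + 1) (2 * h) ε' ηn + ε / 3 +
                B / K.κ * (G.regularize φ).incrementSum p (t + 1 + 1) (Fin Nn × Fin h) := by
            intro φ
            refine ColoredGraph.ctrlVal_succ_le hp hT K (min_le_left _ _) (hη _ _) (hη1 _ _)
              (hη₀le n hn) (fun I hI => ?_) hNn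
            obtain ⟨f, -, hinj⟩ := G.exists_regularize_proj φ I
            have := G.finite_color I
            exact (Nat.card_le_card_of_injective f (hinj (by omega))).trans (hB I)
          have hw := tuple_mem hp M
          have h1 := Ex_mono hw hpt
          rw [Ex_add, Ex_add, Ex_mul_left, Ex_mul_left, Ex_const hw] at h1
          have h2 : tupleExp p M (fun φ => (G.regularize φ).incrementSum p (t + 2)
              (Fin Nn × Fin h)) ≤ A (n + 1) - A n := by
            have h3 := G.tupleExp_incrementSum_le hp M (Fin Nn × Fin h) (M := m (n + 1)) (by
              rw [Fin.sum_univ_castSucc]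
              simp only [hM_def, hsM, hsMlast, Fintype.card_prod, Fintype.card_fin]
              have h4 : ∑ i, (S n).M i x ≤ tot (a n).1 (a n).2 := htot _ _ _ hx
              have h5 : m n + tot (a n).1 (a n).2 + Nn * h ≤ m (n + 1) := hm_succ n
              omega)
            have h6 : M (Fin.last t) = m n := hsMlast x n
            rw [h6] at h3
            exact h3
          have h3 := G.tupleExp_regularize_succ (p := p) (M := M)
            (M' := fun i => (S n).M i x) (hsMlast x n) (fun i => hsM i x n)
            (fun H => H.ctrlVal p (t + 1) (2 * h) ε' ηn)
          rw [← h3]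
          have h4 := mul_le_mul_of_nonneg_left h2 (show 0 ≤ B / K.κ by positivity)
          refine h1.trans ?_
          rw [add_assoc]
          exact add_le_add le_rfl (add_le_add le_rfl h4)
        refine ((S n).exp_mono hbox).trans ?_
        rw [Scheme.exp_add, Scheme.exp_const, Scheme.exp_mul_left, Scheme.exp_Ex]
        have h5 : Ex (mapWeight p) (fun φ₀ : PMap Ω (m n) => (S n).exp fun x =>
            tupleExp p (fun i => (S n).M i x) fun φ =>
              ((G.regularizeStep (t + 1) φ₀).regularize φ).ctrlVal p (t + 1) (2 * h) ε' ηn) ≤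
              ε' :=
          Ex_le_const (sampleWeight_mem hp (Fin (m n))) fun φ₀ =>
            hexp _ _ Ω p hp _ (hB' (m n) G φ₀ hB)
        have h6 := mul_le_mul_of_nonneg_left h5 hBR.le
        linarith
      rw [Scheme.exp, hsN, div_le_iff₀ hN₀']
      simp only [hstail]
      refine (sum_le_sum hn).trans ?_
      rw [sum_add_distrib, sum_const, card_range, nsmul_eq_mul, ← mul_sum, sum_range_sub]
      have h1 : A N₀ - A 0 ≤ R * B := by
        have h2 := G.meanEnergy_le hp (t + 2) (Fin (m N₀)) hB
        have h3 := G.meanEnergy_nonneg hp (t + 2) (Fin (m 0))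
        simp only [hA]
        linarith
      have h2 := mul_le_mul_of_nonneg_left h1 (show 0 ≤ B / K.κ by positivity)
      linarith

/-! ### From control to regularity -/

namespace ColoredGraph

variable {r k : ℕ} {Ω : Fin r → Type u} {G : ColoredGraph.{u, w} r k Ω} [∀ i, Fintype (Ω i)]
  {p : (i : Fin r) → Ω i → ℝ}

/-- A controlled hypergraph is regular: the function `δ` is `1` on the bad total colors, and a
pattern with bad faces is compared with the pattern of its good faces. -/
theorem IsControlled.isRegular (hp : ∀ i, p i ∈ stdSimplex ℝ (Ω i)) {q h : ℕ} {ε η ρ : ℝ}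
    {bad : (I : Idx r k) → G.TotalColor I → Prop} (C : G.IsControlled p q h ε η ρ bad)
    (hq : k ≤ q) (hε : 0 ≤ ε) : G.IsRegular p h (ε + ρ) := by
  classical
  have hcard : ∀ I, (1 : ℝ) ≤ Nat.card (G.Color I) := fun I => by
    exact_mod_cast G.one_le_card_color hp I
  refine ⟨fun I c => if bad I c then 1 else ε / Nat.card (G.Color I), fun I c => ?_, fun S => ?_,
    fun I => ?_⟩
  · dsimp only
    split_ifs
    · exact zero_le_one
    · exact div_nonneg hε (Nat.cast_nonneg _)
  · -- The invisible faces get an arbitrary color, which plays no role.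
    let col : (e : Face r k (Fin h)) → G.Color e.1 := fun e =>
      (S.face e.1 e.2).getD (G.color e.1 (edge_nonempty hp e.1.1).some)
    have hcol : ∀ (e : Face r k (Fin h)) (he : (S.face e.1 e.2).isSome),
        (S.face e.1 e.2).get he = col e := fun e he => Option.get_eq_getD _
    have htotal : ∀ e : S.Visible, S.total e = G.faceTotal col e.1 := fun e =>
      funext fun J => hcol (Face.sub e.1 J.1 J.2) _
    set visS : Finset (Face r k (Fin h)) := univ.filter fun e => (S.face e.1 e.2).isSome with hvisS
    have hSdown : DownClosed visS := by
      intro e he J hJ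
      refine mem_filter.2 ⟨mem_univ _, ?_⟩
      have he := (mem_filter.1 he).2
      rw [Option.isSome_iff_ne_none] at he ⊢
      exact fun hn => he (S.invisible_of_subset _ _ hJ _ hn)
    set good := visS.filter fun e => ¬ bad e.1 (G.faceTotal col e) with hgood
    have hgdown : DownClosed good := by
      intro e he J hJ
      obtain ⟨he, hb⟩ := mem_filter.1 he
      exact mem_filter.2 ⟨hSdown e he J hJ, fun h => hb (C.up e.1 J hJ _ h)⟩
    obtain ⟨x₀, hx₀, hP₀⟩ := C.count (Fin h) (by simp) good col hgdown fun e he =>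
      ⟨e.1.2.2.trans hq, (mem_filter.1 he).2⟩
    set P₀ := Ex (sampleWeight p) fun φ : Sample Ω (Fin h) => ind (G.Matches col good φ)
    set P := Ex (sampleWeight p) fun φ : Sample Ω (Fin h) => ind (G.Matches col visS φ) with hP
    have hPP₀ : P ≤ P₀ := Ex_mono (sampleWeight_mem hp _) fun φ =>
      ind_mono fun hm e he => hm e (mem_filter.1 he).1
    have hP0 : 0 ≤ P := Ex_nonneg (sampleWeight_mem hp _) fun _ => ind_nonneg _
    have hmap : mapProb p h (fun φ => ∀ e : S.Visible,
        G.color e.1.1 (fun i => φ i (e.1.2 i)) = (S.face e.1.1 e.1.2).get e.2) = P := by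
      change Ex (sampleWeight p) (fun φ : Sample Ω (Fin h) => ind (∀ e : S.Visible,
        G.color e.1.1 (fun i => φ i (e.1.2 i)) = (S.face e.1.1 e.1.2).get e.2)) = P
      rw [hP]
      congr 1; funext φ
      refine ind_congr ⟨fun hm e he => ?_, fun hm e => ?_⟩
      · rw [← hcol e (mem_filter.1 he).2]
        exact hm ⟨e, (mem_filter.1 he).2⟩
      · rw [hcol]
        exact hm e.1 (mem_filter.2 ⟨mem_univ _, e.2⟩)
    -- The factors of the bad faces, with product `P / P₀`.
    set badS := visS.filter fun e : Face r k (Fin h) => ¬ ¬ bad e.1 (G.faceTotal col e) with hbadS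
    obtain ⟨g, hg0, hg1, hgP⟩ : ∃ g : Face r k (Fin h) → ℝ, (∀ e, 0 ≤ g e) ∧ (∀ e, g e ≤ 1) ∧
        P₀ * ∏ e ∈ badS, g e = P := by
      rcases badS.eq_empty_or_nonempty with hbad | ⟨e₀, he₀⟩
      · refine ⟨fun _ => 1, fun _ => zero_le_one, fun _ => le_rfl, ?_⟩
        rw [hbad, prod_empty, mul_one]
        have : good = visS := by
          refine filter_true_of_mem fun e he hb => ?_
          exact notMem_empty e (hbad ▸ mem_filter.2 ⟨he, not_not.2 hb⟩)
        rw [hP, ← this]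
      · refine ⟨fun e => if e = e₀ then P / P₀ else 1, fun e => ?_, fun e => ?_, ?_⟩
        · dsimp only
          split_ifs
          · exact div_nonneg hP0 (hP0.trans hPP₀)
          · exact zero_le_one
        · dsimp only
          split_ifs
          · exact div_le_one_of_le₀ hPP₀ (hP0.trans hPP₀)
          · exact le_rfl
        · rw [prod_ite_eq' _ e₀, if_pos he₀]
          by_cases h0 : P₀ = 0
          · rw [h0, zero_mul]; linarith
          · exact mul_div_cancel₀ _ h0
    refine ⟨fun e => if ¬ bad e.1.1 (G.faceTotal col e.1) then x₀ e.1 else g e.1, fun e => ?_, ?_⟩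
    · rw [htotal e]
      have hd0 := G.relDensity_nonneg hp e.1.1 (G.faceTotal col e.1)
      have hd1 := G.relDensity_le_one hp e.1.1 (G.faceTotal col e.1)
      by_cases hb : bad e.1.1 (G.faceTotal col e.1)
      · simp only [hb, not_true, if_false, if_true]
        exact ⟨max_le (hg0 _) (by linarith [hg0 e.1]), le_min (hg1 _) (by linarith [hg1 e.1])⟩
      · simp only [hb, not_false_iff, if_false, if_true]
        obtain ⟨h1, h2, -, h4⟩ := hx₀ e.1 (mem_filter.2 ⟨mem_filter.2 ⟨mem_univ _, e.2⟩, hb⟩)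
        rw [← le_div_iff₀ (by linarith [hcard e.1.1]), abs_le] at h1
        exact ⟨max_le (by linarith) (by linarith [h1.1]), le_min h4 (by linarith [h1.2])⟩
    · rw [hmap, ← hgP, hP₀,
        ← prod_subtype visS (fun e => by simp [hvisS]) fun e : Face r k (Fin h) =>
          if ¬ bad e.1 (G.faceTotal col e) then x₀ e else g e,
        ← prod_filter_mul_prod_filter_not visS fun e => ¬ bad e.1 (G.faceTotal col e)]
      congr 1
      · exact prod_congr rfl fun e he => (if_pos (mem_filter.1 he).2).symm
      · exact prod_congr rfl fun e he => (if_neg (mem_filter.1 he).2).symm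
  · have hw := edgeWeight_mem hp I.1
    have h1 : ∀ e, (if bad I (G.total I e) then (1 : ℝ) else ε / Nat.card (G.Color I)) ≤
        ε / Nat.card (G.Color I) + ind (bad I (G.total I e)) := by
      intro e
      split_ifs with hb
      · rw [ind_of hb]
        linarith [div_nonneg hε (Nat.cast_nonneg (α := ℝ) (Nat.card (G.Color I)))]
      · rw [ind_not hb, add_zero]
    refine (Ex_mono hw h1).trans ?_
    rw [Ex_add, Ex_const hw, add_div]
    refine add_le_add le_rfl ?_
    rw [le_div_iff₀ (by linarith [hcard I]), mul_comm]
    exact C.prob I (I.2.2.trans hq)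

/-- If control reaches all sizes, then it bounds the regularity value. -/
theorem reg_le_add_ctrlVal (hp : ∀ i, p i ∈ stdSimplex ℝ (Ω i)) {q h : ℕ} {ε η : ℝ} (hq : k ≤ q)
    (hε : 0 ≤ ε) : G.reg p h ≤ ε + G.ctrlVal p q h ε η := by
  refine le_of_forall_pos_le_add fun a ha => ?_
  obtain ⟨ρ, bad, hρ, hlt, C⟩ := exists_isControlled_of_lt (G := G) (q := q) (h := h)
    (ε := ε) (η := η) hp (lt_add_of_pos_right _ ha)
  have h1 : G.reg p h ≤ ε + ρ :=
    csInf_le ⟨0, fun _ h => h.1⟩ ⟨by positivity, C.isRegular hp hq hε⟩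
  linarith

end ColoredGraph

end HypergraphRegularity

theorem mainTheorem1 (r k h : ℕ) (hk : 1 ≤ k) (hkr : k ≤ r) (hh : 1 ≤ h) (b : ℕ → ℕ)
    (ε : ℝ) (hε : 0 < ε) :
    ∃ (m : (i : Fin (k - 1)) → (Set.Ici i → ℕ) → ℕ)
      (N : (i : Fin (k - 1)) → (Set.Ioi i → ℕ) → ℕ),
      (∀ i, Monotone (m i)) ∧ (∀ i, Monotone (N i)) ∧ (∀ i x, 0 < N i x) ∧
      ∀ (Ω : Fin r → Type u) [∀ i, Fintype (Ω i)] (p : (i : Fin r) → Ω i → ℝ)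
        (_hp : ∀ i, p i ∈ stdSimplex ℝ (Ω i))
        (G : HypergraphRegularity.ColoredGraph.{u, w} r k Ω) (_hG : G.IsColored b),
        HypergraphRegularity.intExp N (fun n =>
          HypergraphRegularity.tupleExp p (fun i => m i fun j => n j) (fun φ =>
            (G.regularize φ).reg p h)) ≤ ε := by
  classical
  let s₀ : HypergraphRegularity.Scheme (k - 1) :=
    { M := fun _ _ => 0
      N := fun _ _ => 1
      M_congr := fun _ _ _ _ => rfl
      N_congr := fun _ _ _ _ => rfl
      M_mono := fun _ _ _ _ => le_rfl
      N_mono := fun _ _ _ _ => le_rfl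
      N_pos := fun _ _ => one_pos }
  obtain ⟨s, η, -, -, -, -, -, hs⟩ := HypergraphRegularity.exists_scheme.{u, w} r k (k - 1) h
    (∑ i ∈ Finset.range (k + 1), b i) (ε / 2) hh (half_pos hε) s₀
  have hM : ∀ i (n : Fin (k - 1) → ℕ),
      s.M i (fun j => if i ≤ j then n j else 0) = s.M i n := fun i n =>
    s.M_congr _ _ _ fun j hj => if_pos hj
  have hN : ∀ i (n : Fin (k - 1) → ℕ),
      s.N i (fun j => if i < j then n j else 0) = s.N i n := fun i n =>
    s.N_congr _ _ _ fun j hj => if_pos hj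
  -- The entries that do not matter are set to zero.
  refine ⟨fun i x => s.M i fun j => if hj : i ≤ j then x ⟨j, hj⟩ else 0,
    fun i x => s.N i fun j => if hj : i < j then x ⟨j, hj⟩ else 0, fun i x y hxy => ?_,
    fun i x y hxy => ?_, fun i x => s.N_pos _ _, ?_⟩
  · refine s.M_mono i fun j => ?_
    dsimp only
    split_ifs
    · exact hxy _
    · exact le_rfl
  · refine s.N_mono i fun j => ?_
    dsimp only
    split_ifs
    · exact hxy _
    · exact le_rfl
  · intro Ω _ p hp G hG
    simp only [HypergraphRegularity.intExp, dite_eq_ite, hN]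
    obtain ⟨S, hS, hexp⟩ := s.exists_box
    have hset : {n : Fin (k - 1) → ℕ | ∀ i, n i < s.N i n} = (S : Set (Fin (k - 1) → ℕ)) := by
      ext n
      exact (hS n).symm
    rw [hset, finsum_mem_coe_finset, ← hexp]
    have hB : ∀ I, Nat.card (G.Color I) ≤ ∑ i ∈ Finset.range (k + 1), b i := fun I => by
      rw [hG I]
      exact Finset.single_le_sum (f := b) (fun _ _ => Nat.zero_le _)
        (Finset.mem_range.2 (Nat.lt_succ_of_le I.2.2))
    have h1 : ∀ n, s.InBox n → HypergraphRegularity.tupleExp p (fun i => s.M i n)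
        (fun φ => (G.regularize φ).reg p h) ≤ ε / 2 +
          HypergraphRegularity.tupleExp p (fun i => s.M i n) (fun φ =>
            (G.regularize φ).ctrlVal p (k - 1 + 1) h (ε / 2) η) := by
      intro n _
      have hw := HypergraphRegularity.tuple_mem hp fun i => s.M i n
      have h2 := HypergraphRegularity.Ex_mono hw fun φ =>
        (G.regularize φ).reg_le_add_ctrlVal (h := h) (η := η) hp
          (show k ≤ k - 1 + 1 by omega) (half_pos hε).le
      rw [HypergraphRegularity.Ex_add, HypergraphRegularity.Ex_const hw] at h2
      exact h2
    have h3 : ∀ n, s.InBox n → HypergraphRegularity.tupleExp p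
        (fun i => s.M i fun j => if i ≤ j then n j else 0) (fun φ => (G.regularize φ).reg p h) ≤
          ε / 2 + HypergraphRegularity.tupleExp p (fun i => s.M i n) (fun φ =>
            (G.regularize φ).ctrlVal p (k - 1 + 1) h (ε / 2) η) := by
      intro n hn
      have h2 : ∀ M : Fin (k - 1) → ℕ, M = (fun i => s.M i n) →
          HypergraphRegularity.tupleExp p M (fun φ => (G.regularize φ).reg p h) ≤
            ε / 2 + HypergraphRegularity.tupleExp p (fun i => s.M i n) (fun φ =>
              (G.regularize φ).ctrlVal p (k - 1 + 1) h (ε / 2) η) := by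
        rintro _ rfl
        exact h1 n hn
      exact h2 _ (funext fun i => hM i n)
    refine (s.exp_mono h3).trans ?_
    rw [HypergraphRegularity.Scheme.exp_add, HypergraphRegularity.Scheme.exp_const]
    linarith [hs Ω p hp G hB]
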